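/- **Setting.** Let $T>0$, let $(\mathbb X,d)$ be a locally compact metric space and $E\colon[0,T]\times\mathbb X\to\mathbb R$. The slope is $|\partial E_t|(x)=\limsup_{x'\to x}\frac{(E_t(x)-E_t(x'))^+}{d(x,x')}$ ($0$ at isolated points), and $\mathscr C_t=\{x:|\partial E_t|(x)=0\}$. Assume throughout: * (A2) $E$ is continuous and differentiable in $t$; $\partial_tE$ is continuous on $[0,T]\times\mathbb X$; the slope is finite and continuous on $[0,T]\times\mathbb X$. * (A3) There are $C_1,C_2>0$ with $|\partial_tE_t(x)|\le C_1E_t(x)+C_2$ for all $(t,x)$. * (A4) The sublevel sets of $x\mapsto\sup_{t\in[0,T]}|E_t(x)|$ are compact. * (A5) For every $t$, $\mathscr C_t$ is a disjoint union of compact sets, each one at positive distance from the rest of $\mathscr C_t$ and path-connected by rectifiable paths; $E_t$ is constant on the path-connected components of $\mathscr C_t$. Let $\mathcal X$ be the quotient of $[0,T]\times\mathbb X$, with the quotient topology, that identifies $(t,x)$ with $(t,x')$ when $x,x'$ lie in the same path-connected component of $\mathscr C_t$; $q$ is the quotient map, and $\hat E([(t,x)]):=E_t(x)$. A transition rule is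 a family of maps $\bar\omega_t\colon\mathbb X\to\mathbb X$, $t\in[0,T]$. Given $x_0\in\mathscr C_0$ and $\delta>0$, put $M=\lfloor T/\delta\rfloor$ ($M=T/\delta-1$ if $T/\delta$ is an integer), $w_0=x_0$, $w_i=\bar\omega_{i\delta}(w_{i-1})$ for $1\le i\le M$; the discrete quasistatic evolution $\eta^\delta$ equals $w_i$ on $[i\delta,(i+1)\delta)$ for $i<M$ and $w_M$ on $[M\delta,T]$. Put $\mathcal E_t(\eta^\delta)=E_t(\eta^\delta(t))$, $\mathcal D^\delta(t)=\partial_tE_t(\eta^\delta(t))$ and $\mu^\delta=\sum_{i=1}^M\big(\mathcal E^-_{i\delta}(\eta^\delta)-\mathcal E^+_{i\delta}(\eta^\delta)\big)\,\delta_{\{i\delta\}}$, where $\mathcal E^\pm$ are one-sided limits in $t$. * (Ax1) $E_t(\bar\omega_t(x))\le E_t(x)$ for all $t,x$. * (Ax2) $|\partial E_t|(\bar\omega_t(x))=0$ for all $t,x$. * (Ax3) Let $\delta_n>0$ decrease to $0$, and suppose that $\mu^{\delta_n}\rightharpoonup^*\bar\mu$ in $\mathcal M([0,T])$, $\mathcal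 E_t(\eta^{\delta_n})\to\bar{\mathcal E}_t$ for every $t$ with $\bar{\mathcal E}\in BV$, and $\mathcal D^{\delta_n}\rightharpoonup^*\mathcal D$ in $L^\infty$. If $t_1^n\le t_2^n$ both tend to $t$, $\eta^{\delta_n}(t_1^n)\to x_1$, $\eta^{\delta_n}(t_2^n)\to x_2$, and $x_1,x_2$ lie in different path-connected components of $\mathscr C_t$, then there is $c>0$ with $\bar\mu(\{t\})\ge c$ and $E_t(x_1)-E_t(x_2)\ge c$. An action is a family of lower semicontinuous $c_t\colon\mathbb X\times\mathbb X\to[0,\infty)$ with $E_t(x)-E_t(x')\le c_t(x,x')$; $\bar\omega$ is compatible with it if $E_t(x)-E_t(\bar\omega_t(x))=c_t(x,\bar\omega_t(x))$ for all $t,x$. * (Ax3') $\bar\omega$ is compatible with an action $c_t$ such that: for all $\varepsilon,C>0$, $t\in[0,T]$ and compact $K\subseteq\mathbb X$ there is $\Delta>0$ such that for all $n\ge2$, $x_1,\dots,x_n\in K$ and $t_1,\dots,t_{n-1}\in[t-\Delta,t+\Delta]\cap[0,T]$ with $\sum_{i<n}c_{t_i}(x_i,x_{i+1})\le C$ one has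 $c_t(x_1,x_n)\le\sum_{i<n}c_{t_i}(x_i,x_{i+1})+\varepsilon$; and for $x,x'\in\mathscr C_t$, $c_t(x,x')=0$ if and only if $x,x'$ lie in the same path-connected component of $\mathscr C_t$. An action is generated by curves if there are $\mathbb I\in\{\mathbb Z,\mathbb R\}$ (with $\nu$ counting resp. Lebesgue measure), a metric space $\mathscr P$, a closed embedding $i\colon\mathbb X\to\mathscr P$, a continuous price $\mathcal L\colon\mathscr P\times[0,T]\to[0,\infty)$ and sets $\Gamma(p_1,p_2)$ of curves $\gamma\colon[a,b]_{\mathbb I}\to\mathscr P$, $a<b$ in $\mathbb I$, with $\gamma(a)=p_1$, $\gamma(b)=p_2$, such that $c_t(x_1,x_2)=\mathfrak c_t(i(x_1),i(x_2))$, where $\mathfrak c_t(p_1,p_2)=\inf_{\gamma\in\Gamma(p_1,p_2)}\int_{(a,b]_{\mathbb I}}\mathcal L_t(\gamma)\,d\nu$, and: 1. restrictions to $[a,s]_{\mathbb I}$ and $[s,b]_{\mathbb I}$ with $a<s<b$, concatenations and shifts of admissible curves are admissible; 2. $\mathcal L_t(p)=0$ if and only if $p=i(x)$ for some $x\in\mathscr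 C_t$; 3. for $x_1\ne x_2$: $c_t(x_1,x_2)=0$ if and only if $i(x_1),i(x_2)$ lie in the same connected component of $\{\mathcal L_t=0\}$; 4. for every compact $K\subseteq\mathscr P$ there is a compact $K'\subseteq\mathscr P$ such that for all $t\in[0,T]$, $p_1,p_2\in K$, $\varepsilon>0$ some $\gamma\in\Gamma(p_1,p_2)$ with image in $K'$ has cost at most $\mathfrak c_t(p_1,p_2)+\varepsilon$; 5. for every $t\in[0,T]$, compact $K\subseteq\mathscr P$ and $\varepsilon>0$ there are $\ell,\rho>0$ such that $\mathfrak c_t(p_1,p_2)\le\varepsilon$ whenever $p_1,p_2\in K$, $\mathcal L_t(p_1),\mathcal L_t(p_2)\le\rho$ and $d_{\mathscr P}(p_1,p_2)\le\ell$. **Theorem.** (I) If $\bar\omega$ is compatible with an action generated by curves, then (Ax3') holds with this action. (Ax3') implies (Ax1), and (Ax2) and (Ax3') together imply (Ax3) (for every $x_0\in\mathscr C_0$). (II) Assume (Ax1), (Ax2), (Ax3) and let $\delta_n>0$, $\delta_n\to0$. Then there are a subsequence (not relabelled), a finite positive measure $\bar\mu$ on $[0,T]$, $\mathcal D\in L^\infty([0,T])$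 and $\hat\eta\colon[0,T]\to\mathcal X$ such that, with $J=\{t:\bar\mu(\{t\})>0\}$: 1. $\mu^{\delta_n}\rightharpoonup^*\bar\mu$ and $\mathcal D^{\delta_n}\rightharpoonup^*\mathcal D$ in $L^\infty$. 2. $q(t,\eta^{\delta_n}(t))\to\hat\eta(t)$ in $\mathcal X$ for every $t\in[0,T]$. 3. The one-sided limits $\hat\eta^-(t)$, $t\in(0,T]$, and $\hat\eta^+(t)$, $t\in[0,T)$, exist; put $\hat\eta^-(0)=\hat\eta(0)$ and $\hat\eta^+(T)=\hat\eta(T)$. 4. For $0\le s<t\le T$: $\hat E(\hat\eta^+(t))-\hat E(\hat\eta^-(s))=\int_s^t\mathcal D(\tau)\,d\tau-\bar\mu([s,t])$. 5. For all $t\in[0,T]$, $\hat\eta(t)\subset\{(t,x):|\partial E_t|(x)=0\}$. 6. $J$ is countable and $\hat\eta$ is continuous at every $t\in[0,T]\setminus J$. 7. Assume in addition that every $x\in\mathscr C_t$, $t\in[0,T]$, has a neighbourhood $U$ and $\varepsilon_x\colon[0,\infty)\to[0,\infty)$ with $\varepsilon_x(0)=\lim_{r\to0^+}\varepsilon_x(r)=0$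 and $|E_t(x')-E_t(x)|\le\varepsilon_x(d(x,x'))\,|\partial E_t|(x')$ on $U$, and that $t\mapsto|\partial E_t|(x)$ is Lipschitz on $[0,T]$ locally uniformly in $x$. Then for almost every $t$, $\partial_tE_t(x)=\mathcal D(t)$ for all $(t,x)\in\hat\eta(t)$; and for all maps $h_t\colon\mathcal X\to[0,T]$, $h_{\mathbb X}\colon\mathcal X\to\mathbb X$ with $q\circ(h_t\times h_{\mathbb X})=\mathrm{id}_{\mathcal X}$ and all $s<t$, $\hat E(\hat\eta^+(t))-\hat E(\hat\eta^-(s))=\int_s^t\partial_tE_\tau(h_{\mathbb X}(\hat\eta(\tau)))\,d\tau-\bar\mu([s,t])$. 8. If (Ax3') holds with the action $c_t$, then for every $t\in J$: $\hat E(\hat\eta^-(t))-\hat E(\hat\eta^+(t))=\bar\mu(\{t\})=\hat c_t(\hat\eta^-(t),\hat\eta^+(t))$, where $\hat c_t([(t,x_1)],[(t,x_2)]):=c_t(x_1,x_2)$ is well defined. 9. Assume in addition that: every $x\in\mathscr C_t$, $t\in[0,T]$, has $U$ and $\varepsilon_x$ as in 7 with $E_t(x')-E_t(x)\ge-\varepsilon_x(d(x,x'))\,|\partial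 E_t|(x')$ on $U$; $t\mapsto|\partial E_t|(x)$ is Lipschitz on $[0,T]$ locally uniformly in $x$; $d(x,x')$ is the infimum of the lengths $\int_0^1|\dot\gamma|$ of absolutely continuous curves $\gamma$ from $x$ to $x'$; $|\partial E_t|$ is Lipschitz in $x$ uniformly in $t$; and $\partial_tE$ factors through $q$ as a continuous $\partial_t\hat E\colon\mathcal X\to\mathbb R$. Then $\tau\mapsto\partial_t\hat E(\hat\eta(\tau))$ is integrable, for $0\le s<t\le T$ one has $\hat E(\hat\eta^+(t))-\hat E(\hat\eta^-(s))=\int_s^t\partial_t\hat E(\hat\eta(\tau))\,d\tau-\bar\mu([s,t])$, and $\bar\mu$ is purely atomic: $\bar\mu([0,T]\setminus J)=0$. -/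

import Mathlib

open Set Filter Topology MeasureTheory

namespace Quasistatic

noncomputable section

variable {X : Type*} [MetricSpace X]

/-! ### The driving energy `E t x`, `t ∈ [0, T]`, and its critical points.
Energies, rules and actions are indexed by `ℝ`; only the times in `[0, T]` are ever used. -/

/-- The descending slope of `E t` at `x`, with values in `[0, ∞]`; it is `0` at isolated points. -/
def descSlope (E : ℝ → X → ℝ) (t : ℝ) (x : X) : ENNReal :=
  limsup (fun y => ENNReal.ofReal (max (E t x - E t y) 0 / dist x y)) (𝓝[≠] x)

/-- The critical points of `E t`. -/
def crit (E : ℝ → X → ℝ) (t : ℝ) : Set X := {x | descSlope E t x = 0}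

/-- The time derivative of the energy on `[0, T]` (one-sided at `0` and `T`). -/
def timeDeriv (T : ℝ) (E : ℝ → X → ℝ) (t : ℝ) (x : X) : ℝ :=
  derivWithin (fun s => E s x) (Icc 0 T) t

/-- Continuity of the energy, of its time derivative, and of its (finite) slope. -/
structure EnergyRegular (T : ℝ) (E : ℝ → X → ℝ) : Prop where
  continuousOn : ContinuousOn (fun p : ℝ × X => E p.1 p.2) (Icc 0 T ×ˢ univ)
  differentiableOn : ∀ x, DifferentiableOn ℝ (fun s => E s x) (Icc 0 T)
  continuousOn_timeDeriv :
    ContinuousOn (fun p : ℝ × X => timeDeriv T E p.1 p.2) (Icc 0 T ×ˢ univ)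
  slope_ne_top : ∀ t ∈ Icc 0 T, ∀ x, descSlope E t x ≠ ⊤
  continuousOn_slope :
    ContinuousOn (fun p : ℝ × X => (descSlope E p.1 p.2).toReal) (Icc 0 T ×ˢ univ)

/-- The power of the external forces is controlled by the energy. -/
def PowerControl (T : ℝ) (E : ℝ → X → ℝ) : Prop :=
  ∃ C₁ > 0, ∃ C₂ > 0, ∀ t ∈ Icc 0 T, ∀ x, |timeDeriv T E t x| ≤ C₁ * E t x + C₂

/-- The function `x ↦ sup_t |E t x|` has compact sublevel sets. -/
def Coercive (T : ℝ) (E : ℝ → X → ℝ) : Prop :=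
  ∀ C : ℝ, IsCompact {x : X | ⨆ t : Icc (0 : ℝ) T, |E t x| ≤ C}

/-- For each time, the critical set is a disjoint union of compact pieces, each one at positive
distance from the rest of the critical set and path-connected by rectifiable paths; the energy is
constant on the path-connected components of the critical set. -/
structure CriticalComponents (T : ℝ) (E : ℝ → X → ℝ) : Prop where
  pieces : ∀ t ∈ Icc 0 T, ∃ 𝒦 : Set (Set X), ⋃₀ 𝒦 = crit E t ∧ 𝒦.PairwiseDisjoint id ∧
    ∀ K ∈ 𝒦, IsCompact K ∧
      (∃ r > 0, ∀ x ∈ K, ∀ y ∈ crit E t \ K, r ≤ dist x y) ∧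
      ∀ x ∈ K, ∀ y ∈ K, ∃ γ : Path x y, (∀ s, γ s ∈ K) ∧ BoundedVariationOn γ univ
  energy_eq : ∀ t ∈ Icc 0 T, ∀ x y, JoinedIn (crit E t) x y → E t x = E t y

/-- The slope is Lipschitz continuous in time on `[0, T]`, locally uniformly in space. -/
def SlopeTimeLipschitz (T : ℝ) (E : ℝ → X → ℝ) : Prop :=
  ∀ x, ∃ U ∈ 𝓝 x, ∃ C : ℝ, ∀ y ∈ U, ∀ s ∈ Icc 0 T, ∀ t ∈ Icc 0 T,
    |(descSlope E s y).toReal - (descSlope E t y).toReal| ≤ C * |s - t|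

/-- One-sided Łojasiewicz-type inequality at critical points, together with the Lipschitz
continuity in time of the slope. -/
structure OneSidedSlopeIneq (T : ℝ) (E : ℝ → X → ℝ) : Prop where
  ineq : ∀ t ∈ Icc 0 T, ∀ x ∈ crit E t, ∃ U ∈ 𝓝 x, ∃ ε : ℝ → ℝ,
    (∀ r, 0 ≤ r → 0 ≤ ε r) ∧ ε 0 = 0 ∧ Tendsto ε (𝓝[>] 0) (𝓝 0) ∧
    ∀ y ∈ U, -(ε (dist x y) * (descSlope E t y).toReal) ≤ E t y - E t x
  lipschitz : SlopeTimeLipschitz T E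

/-- The two-sided strengthening of `OneSidedSlopeIneq`. -/
structure TwoSidedSlopeIneq (T : ℝ) (E : ℝ → X → ℝ) : Prop where
  ineq : ∀ t ∈ Icc 0 T, ∀ x ∈ crit E t, ∃ U ∈ 𝓝 x, ∃ ε : ℝ → ℝ,
    (∀ r, 0 ≤ r → 0 ≤ ε r) ∧ ε 0 = 0 ∧ Tendsto ε (𝓝[>] 0) (𝓝 0) ∧
    ∀ y ∈ U, |E t y - E t x| ≤ ε (dist x y) * (descSlope E t y).toReal
  lipschitz : SlopeTimeLipschitz T E

/-- The metric speed of a curve. -/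
def metricSpeed (γ : ℝ → X) (s : ℝ) : ENNReal :=
  limsup (fun r => edist (γ r) (γ s) / ENNReal.ofReal |r - s|) (𝓝[≠] s)

/-- `X` is a path space: the distance is the infimum of the lengths of absolutely continuous
curves. Moreover the slope is Lipschitz continuous in space, uniformly in time. -/
structure PathSpaceLipschitz (T : ℝ) (E : ℝ → X → ℝ) : Prop where
  path : ∀ x y : X, edist x y =
    ⨅ (γ : ℝ → X) (_ : AbsolutelyContinuousOnInterval γ 0 1 ∧ γ 0 = x ∧ γ 1 = y),
      ∫⁻ s in Icc (0 : ℝ) 1, metricSpeed γ s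
  lipschitz : ∃ L > 0, ∀ t ∈ Icc 0 T, ∀ x y : X,
    |(descSlope E t x).toReal - (descSlope E t y).toReal| ≤ L * dist x y

/-! ### The quotient space -/

/-- Two points of `[0, T] × X` are identified when they are equal, or when they have the same time
`t` and lie in the same path-connected component of the critical set of `E t`. -/
def critSetoid (T : ℝ) (E : ℝ → X → ℝ) : Setoid (Icc (0 : ℝ) T × X) where
  r p q := p = q ∨ (p.1 = q.1 ∧ JoinedIn (crit E p.1) p.2 q.2)
  iseqv :=
    { refl := fun _ => Or.inl rfl
      symm := by
        rintro ⟨t, x⟩ ⟨s, y⟩ (h | ⟨h, h'⟩)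
        · exact Or.inl h.symm
        · obtain rfl : t = s := h
          exact Or.inr ⟨rfl, h'.symm⟩
      trans := by
        rintro ⟨t, x⟩ ⟨s, y⟩ ⟨r, z⟩ (h | ⟨h, h'⟩) (k | ⟨k, k'⟩)
        · exact Or.inl (h.trans k)
        · rw [h]; exact Or.inr ⟨k, k'⟩
        · rw [← k]; exact Or.inr ⟨h, h'⟩
        · obtain rfl : t = s := h
          obtain rfl : t = r := k
          exact Or.inr ⟨rfl, h'.trans k'⟩ }

/-- The quotient space, with the quotient topology. -/
abbrev QuotSpace (T : ℝ) (E : ℝ → X → ℝ) : Type _ := Quotient (critSetoid T E)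

/-- The class of `(t, x)`. -/
def cls (T : ℝ) (E : ℝ → X → ℝ) (t : Icc (0 : ℝ) T) (x : X) : QuotSpace T E :=
  Quotient.mk (critSetoid T E) (t, x)

/-- The energy on the quotient space: its value at the class of `(t, x)` is `E t x`. -/
def energyHat {T : ℝ} {E : ℝ → X → ℝ} (h : CriticalComponents T E) : QuotSpace T E → ℝ :=
  Quotient.lift (fun p => E p.1 p.2) (by
    rintro ⟨t, x⟩ ⟨s, y⟩ (h' | ⟨h', h''⟩)
    · rw [h']
    · obtain rfl : t = s := h'
      exact h.energy_eq t t.2 x y h'')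

/-- `F` is the factorization of the time derivative of the energy through the quotient space,
and it is continuous. -/
structure IsTimeDerivHat (T : ℝ) (E : ℝ → X → ℝ) (F : QuotSpace T E → ℝ) : Prop where
  continuous : Continuous F
  factors : ∀ (t : Icc (0 : ℝ) T) (x : X), F (cls T E t x) = timeDeriv T E t x

/-! ### Discrete quasistatic evolutions -/

/-- The number `M` of steps: `⌊T/δ⌋`, or `T/δ - 1` if `T/δ` is an integer. -/
def numSteps (T δ : ℝ) : ℕ :=
  if (⌊T / δ⌋₊ : ℝ) = T / δ then ⌊T / δ⌋₊ - 1 else ⌊T / δ⌋₊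

/-- The states `w₀ = x₀`, `wᵢ = ω_{iδ}(wᵢ₋₁)`. -/
def states (ω : ℝ → X → X) (δ : ℝ) (x₀ : X) : ℕ → X
  | 0 => x₀
  | i + 1 => ω (((i + 1 : ℕ) : ℝ) * δ) (states ω δ x₀ i)

/-- The discrete quasistatic evolution: equal to `wᵢ` on `[iδ, (i+1)δ)` for `i < M`, and to `w_M` on
`[Mδ, T]`. -/
def evolution (T : ℝ) (ω : ℝ → X → X) (x₀ : X) (δ : ℝ) (t : Icc (0 : ℝ) T) : X :=
  states ω δ x₀ (min ⌊(t : ℝ) / δ⌋₊ (numSteps T δ))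

/-- The jump times `iδ`, `1 ≤ i ≤ M`. -/
def jumpTimes (T δ : ℝ) : Set (Icc (0 : ℝ) T) :=
  {t | ∃ i : ℕ, 1 ≤ i ∧ i ≤ numSteps T δ ∧ (t : ℝ) = i * δ}

/-- The energy along a curve. -/
def energyAlong {T : ℝ} (E : ℝ → X → ℝ) (η : Icc (0 : ℝ) T → X) (t : Icc (0 : ℝ) T) : ℝ :=
  E t (η t)

/-- The power along a curve. -/
def powerAlong {T : ℝ} (E : ℝ → X → ℝ) (η : Icc (0 : ℝ) T → X) (t : Icc (0 : ℝ) T) : ℝ :=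
  timeDeriv T E t (η t)

/-- The measure collecting the energy drops `𝓔⁻ - 𝓔⁺` of the discrete evolution at its jump
times. -/
def dropMeasure (T : ℝ) (E : ℝ → X → ℝ) (ω : ℝ → X → X) (x₀ : X) (δ : ℝ) :
    Measure (Icc (0 : ℝ) T) :=
  Measure.sum fun t : jumpTimes T δ =>
    ENNReal.ofReal (Function.leftLim (energyAlong E (evolution T ω x₀ δ)) t.1 -
      Function.rightLim (energyAlong E (evolution T ω x₀ δ)) t.1) • Measure.dirac t.1

/-- Lebesgue measure on `[0, T]`. -/
def leb (T : ℝ) : Measure (Icc (0 : ℝ) T) := Measure.comap Subtype.val volume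

/-- Weak-* convergence of measures on `[0, T]`. -/
def WeakStarMeasure {T : ℝ} (μ : ℕ → Measure (Icc (0 : ℝ) T)) (μbar : Measure (Icc (0 : ℝ) T)) :
    Prop :=
  ∀ f : C(Icc (0 : ℝ) T, ℝ), Tendsto (fun n => ∫ t, f t ∂(μ n)) atTop (𝓝 (∫ t, f t ∂μbar))

/-- Weak-* convergence in `L^∞([0, T])`. -/
def WeakStarLinfty {T : ℝ} (D : ℕ → Icc (0 : ℝ) T → ℝ) (Dbar : Icc (0 : ℝ) T → ℝ) : Prop :=
  ∀ g : Icc (0 : ℝ) T → ℝ, Integrable g (leb T) →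
    Tendsto (fun n => ∫ t, D n t * g t ∂(leb T)) atTop (𝓝 (∫ t, Dbar t * g t ∂(leb T)))

/-- Along the step sizes `δ n`: weak-* convergence of the drop measures to `μbar`, pointwise
convergence of the energies to `Ebar`, weak-* convergence of the powers to `D`. -/
structure EnergyConvergence (T : ℝ) (E : ℝ → X → ℝ) (ω : ℝ → X → X) (x₀ : X) (δ : ℕ → ℝ)
    (μbar : Measure (Icc (0 : ℝ) T)) (Ebar D : Icc (0 : ℝ) T → ℝ) : Prop where
  finite : IsFiniteMeasure μbar
  bounded_variation : BoundedVariationOn Ebar univ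
  memLp : MemLp D ⊤ (leb T)
  measure : WeakStarMeasure (fun n => dropMeasure T E ω x₀ (δ n)) μbar
  energy : ∀ t, Tendsto (fun n => energyAlong E (evolution T ω x₀ (δ n)) t) atTop (𝓝 (Ebar t))
  power : WeakStarLinfty (fun n => powerAlong E (evolution T ω x₀ (δ n))) D

/-! ### Axioms for a transition rule `ω t : X → X` -/

/-- Energy is not increased. -/
def AxiomDecreasing (T : ℝ) (E : ℝ → X → ℝ) (ω : ℝ → X → X) : Prop :=
  ∀ t ∈ Icc 0 T, ∀ x, E t (ω t x) ≤ E t x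

/-- The rule returns critical points. -/
def AxiomCritical (T : ℝ) (E : ℝ → X → ℝ) (ω : ℝ → X → X) : Prop :=
  ∀ t ∈ Icc 0 T, ∀ x, ω t x ∈ crit E t

/-- Limits of the discrete evolutions (started at `x₀`) along times collapsing to the same instant
`t` either lie in the same component of critical points, or are separated by an energy drop. -/
def AxiomLimits (T : ℝ) (E : ℝ → X → ℝ) (ω : ℝ → X → X) (x₀ : X) : Prop :=
  ∀ (δ : ℕ → ℝ), (∀ n, 0 < δ n) → StrictAnti δ → Tendsto δ atTop (𝓝 0) →
  ∀ (μbar : Measure (Icc (0 : ℝ) T)) (Ebar D : Icc (0 : ℝ) T → ℝ),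
    EnergyConvergence T E ω x₀ δ μbar Ebar D →
  ∀ (t : Icc (0 : ℝ) T) (t₁ t₂ : ℕ → Icc (0 : ℝ) T) (x₁ x₂ : X),
    Tendsto t₁ atTop (𝓝 t) → Tendsto t₂ atTop (𝓝 t) → (∀ n, t₁ n ≤ t₂ n) →
    Tendsto (fun n => evolution T ω x₀ (δ n) (t₁ n)) atTop (𝓝 x₁) →
    Tendsto (fun n => evolution T ω x₀ (δ n) (t₂ n)) atTop (𝓝 x₂) →
    x₁ ∈ crit E t → x₂ ∈ crit E t → ¬ JoinedIn (crit E t) x₁ x₂ →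
    ∃ c > 0, c ≤ μbar.real {t} ∧ c ≤ E t x₁ - E t x₂

/-- An action. -/
structure IsAction (T : ℝ) (E : ℝ → X → ℝ) (c : ℝ → X → X → ℝ) : Prop where
  nonneg : ∀ t ∈ Icc 0 T, ∀ x y, 0 ≤ c t x y
  lsc : ∀ t ∈ Icc 0 T, LowerSemicontinuous fun p : X × X => c t p.1 p.2
  drop_le : ∀ t ∈ Icc 0 T, ∀ x y, E t x - E t y ≤ c t x y

/-- Compatibility of a transition rule with an action. -/
def IsCompatible (T : ℝ) (E : ℝ → X → ℝ) (ω : ℝ → X → X) (c : ℝ → X → X → ℝ) : Prop :=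
  ∀ t ∈ Icc 0 T, ∀ x, E t x - E t (ω t x) = c t x (ω t x)

/-- The rule is compatible with the action `c`, which satisfies a triangle inequality that is stable
in time (for chains `x 0, …, x m` with at least one link), and whose vanishing characterizes the
path-connected components of critical points. -/
structure AxiomTimeStable (T : ℝ) (E : ℝ → X → ℝ) (ω : ℝ → X → X) (c : ℝ → X → X → ℝ) :
    Prop where
  action : IsAction T E c
  compatible : IsCompatible T E ω c
  stable : ∀ ε > 0, ∀ C > 0, ∀ t ∈ Icc 0 T, ∀ K : Set X, IsCompact K → ∃ Δ > 0,
    ∀ (m : ℕ) (x : ℕ → X) (s : ℕ → ℝ), 1 ≤ m → (∀ i ≤ m, x i ∈ K) →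
      (∀ i < m, s i ∈ Icc 0 T ∧ s i ∈ Icc (t - Δ) (t + Δ)) →
      ∑ i ∈ Finset.range m, c (s i) (x i) (x (i + 1)) ≤ C →
      c t (x 0) (x m) ≤ ∑ i ∈ Finset.range m, c (s i) (x i) (x (i + 1)) + ε
  zero_iff : ∀ t ∈ Icc 0 T, ∀ x ∈ crit E t, ∀ y ∈ crit E t,
    c t x y = 0 ↔ JoinedIn (crit E t) x y

section ActionHat

variable {T : ℝ} {E : ℝ → X → ℝ} {ω : ℝ → X → X} {c : ℝ → X → X → ℝ}

theorem AxiomTimeStable.triangle (h : AxiomTimeStable T E ω c) {t : ℝ} (ht : t ∈ Icc 0 T)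
    (x y z : X) : c t x z ≤ c t x y + c t y z := by
  refine le_of_forall_pos_le_add fun ε hε => ?_
  have h1 := h.action.nonneg t ht x y
  have h2 := h.action.nonneg t ht y z
  obtain ⟨Δ, hΔ, H⟩ := h.stable ε hε (c t x y + c t y z + 1) (by linarith) t ht {x, y, z}
    (Set.toFinite _).isCompact
  have := H 2 (fun i => if i = 0 then x else if i = 1 then y else z) (fun _ => t) (by norm_num)
    (by intro i _; split_ifs <;> simp)
    (fun _ _ => ⟨ht, by constructor <;> linarith⟩)
    (by simp [Finset.sum_range_succ])
  simpa [Finset.sum_range_succ] using this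

theorem AxiomTimeStable.congr (h : AxiomTimeStable T E ω c) {t : ℝ} (ht : t ∈ Icc 0 T)
    {x x' y y' : X} (hx : x = x' ∨ JoinedIn (crit E t) x x')
    (hy : y = y' ∨ JoinedIn (crit E t) y y') : c t x y = c t x' y' := by
  have key : ∀ {x x' y y' : X}, (x = x' ∨ JoinedIn (crit E t) x x') →
      (y = y' ∨ JoinedIn (crit E t) y y') → c t x y ≤ c t x' y' := by
    intro x x' y y' hx hy
    have e1 : c t x y ≤ c t x' y := by
      rcases hx with rfl | hx
      · exact le_rfl
      · have := h.triangle ht x x' y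
        rwa [(h.zero_iff t ht x hx.source_mem x' hx.target_mem).2 hx, zero_add] at this
    have e2 : c t x' y ≤ c t x' y' := by
      rcases hy with rfl | hy
      · exact le_rfl
      · have := h.triangle ht x' y' y
        rwa [(h.zero_iff t ht y' hy.target_mem y hy.source_mem).2 hy.symm, add_zero] at this
    exact e1.trans e2
  exact le_antisymm (key hx hy)
    (key (hx.imp Eq.symm JoinedIn.symm) (hy.imp Eq.symm JoinedIn.symm))

open Classical in
/-- The action on the quotient space: its value at the classes of `(t, x)` and `(t, y)` is
`c t x y`; classes of different times get the value `0`. -/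
def actionHat (h : AxiomTimeStable T E ω c) : QuotSpace T E → QuotSpace T E → ℝ :=
  Quotient.lift₂ (fun p q => if p.1 = q.1 then c p.1 p.2 q.2 else 0) (by
    have aux : ∀ p q : Icc (0 : ℝ) T × X, critSetoid T E p q →
        p.1 = q.1 ∧ (p.2 = q.2 ∨ JoinedIn (crit E p.1) p.2 q.2) := by
      rintro p q (h' | h')
      · exact ⟨by rw [h'], Or.inl (by rw [h'])⟩
      · exact ⟨h'.1, Or.inr h'.2⟩
    intro p q p' q' hp hq
    obtain ⟨hp1, hp2⟩ := aux _ _ hp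
    obtain ⟨hq1, hq2⟩ := aux _ _ hq
    by_cases hpq : p.1 = q.1
    · rw [if_pos hpq, if_pos (by rw [← hp1, ← hq1, hpq]), ← hp1]
      rw [← hpq] at hq2
      exact h.congr p.1.2 hp2 hq2
    · rw [if_neg hpq, if_neg (by rwa [← hp1, ← hq1])])

end ActionHat

/-! ### Actions generated by curves -/

section Curves

variable {𝕀 : Type} [AddCommGroup 𝕀] [LinearOrder 𝕀] [MeasurableSpace 𝕀] {P : Type*}

/-- The cost of a curve `γ` on `(a, b]` for the price `L` at time `t`. -/
def curveCost (ν : Measure 𝕀) (L : P → ℝ → ℝ) (t : ℝ) (a b : 𝕀) (γ : 𝕀 → P) : ENNReal :=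
  ∫⁻ s in Ioc a b, ENNReal.ofReal (L (γ s) t) ∂ν

/-- The infimum of the costs of the admissible curves from `p` to `q`. -/
def phaseCost (ν : Measure 𝕀) (Γ : P → P → 𝕀 → 𝕀 → Set (𝕀 → P)) (L : P → ℝ → ℝ) (t : ℝ)
    (p q : P) : ENNReal :=
  ⨅ (a : 𝕀) (b : 𝕀) (γ : 𝕀 → P) (_ : γ ∈ Γ p q a b), curveCost ν L t a b γ

/-- The data generating an action `c` by curves in the phase space `P`, with index set `𝕀` and
reference measure `ν`. Here `Γ p q a b` is the set of admissible curves from `p` to `q` with domain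
`[a, b]`; a curve on `[a, b]` is represented by a function on `𝕀` whose values off `[a, b]` are
irrelevant. -/
structure CurveGeneration (T : ℝ) (E : ℝ → X → ℝ) (c : ℝ → X → X → ℝ) (ν : Measure 𝕀)
    (P : Type*) [MetricSpace P] where
  Γ : P → P → 𝕀 → 𝕀 → Set (𝕀 → P)
  i : X → P
  L : P → ℝ → ℝ
  domain : ∀ p q a b, ∀ γ ∈ Γ p q a b, a < b
  ends : ∀ p q a b, ∀ γ ∈ Γ p q a b, γ a = p ∧ γ b = q
  congr : ∀ p q a b, ∀ γ ∈ Γ p q a b, ∀ γ' : 𝕀 → P, EqOn γ γ' (Icc a b) → γ' ∈ Γ p q a b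
  isClosedEmbedding : IsClosedEmbedding i
  L_nonneg : ∀ p, ∀ t ∈ Icc 0 T, 0 ≤ L p t
  L_continuousOn : ContinuousOn (fun z : P × ℝ => L z.1 z.2) (univ ×ˢ Icc 0 T)
  action_eq : ∀ t ∈ Icc 0 T, ∀ x y, ENNReal.ofReal (c t x y) = phaseCost ν Γ L t (i x) (i y)
  restrict_left : ∀ p q a b, ∀ γ ∈ Γ p q a b, ∀ s, a < s → s < b → γ ∈ Γ p (γ s) a s
  restrict_right : ∀ p q a b, ∀ γ ∈ Γ p q a b, ∀ s, a < s → s < b → γ ∈ Γ (γ s) q s b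
  concat : ∀ p q r a s b, ∀ γ ∈ Γ p q a s, ∀ γ' ∈ Γ q r s b,
    (fun u => if u ≤ s then γ u else γ' u) ∈ Γ p r a b
  shift : ∀ p q a b, ∀ γ ∈ Γ p q a b, ∀ r, (fun u => γ (u + r)) ∈ Γ p q (a - r) (b - r)
  price_zero : ∀ t ∈ Icc 0 T, ∀ p, L p t = 0 ↔ ∃ x ∈ crit E t, i x = p
  action_zero : ∀ t ∈ Icc 0 T, ∀ x y, x ≠ y →
    (c t x y = 0 ↔ i y ∈ connectedComponentIn {p | L p t = 0} (i x))
  coercive : ∀ K : Set P, IsCompact K → ∃ K' : Set P, IsCompact K' ∧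
    ∀ t ∈ Icc 0 T, ∀ p ∈ K, ∀ q ∈ K, ∀ ε > 0, ∃ a b, ∃ γ ∈ Γ p q a b,
      (∀ s ∈ Icc a b, γ s ∈ K') ∧
        curveCost ν L t a b γ ≤ phaseCost ν Γ L t p q + ENNReal.ofReal ε
  cheap : ∀ t ∈ Icc 0 T, ∀ K : Set P, IsCompact K → ∀ ε > 0, ∃ l > 0, ∃ ρ > 0,
    ∀ p ∈ K, ∀ q ∈ K, L p t ≤ ρ → L q t ≤ ρ → dist p q ≤ l →
      phaseCost ν Γ L t p q ≤ ENNReal.ofReal ε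

end Curves

/-- The action `c` is generated by curves in the phase space `P`, either with real parameter and
Lebesgue measure or with integer parameter and counting measure. -/
def IsGeneratedByCurves (T : ℝ) (E : ℝ → X → ℝ) (c : ℝ → X → X → ℝ)
    (P : Type*) [MetricSpace P] : Prop :=
  Nonempty (CurveGeneration T E c (volume : Measure ℝ) P) ∨
    Nonempty (CurveGeneration T E c (Measure.count : Measure ℤ) P)

end

end Quasistatic

open Quasistatic

/-!
The argument rests on one comparison: the energy that an evolution loses, up to the work of the
external forces, is what the measure of the energy drops charges, and distinct components of
critical points can only be connected by losing energy.

*Actions.* For an action generated by curves, a chain of transitions at times close to `t` is traced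
by a single curve, whose cost at time `t` has to be compared with its cost at the other times. Where
the price is not small, prices at close times are comparable in ratio. Where it is small, the curve
is close to one of the finitely many components of critical points that meet a fixed compact set;
replacing the part of the curve between the first and the last visit of each component by a cheap
shortcut (`cost_le_of_cells`) bounds the error independently of the length of the curve. This gives
`CurveGeneration.stable`. Conversely, applied to the jumps of a discrete evolution in a collapsing
time interval, stability shows that the two limit points are connected at a cost of at most their
energy difference (`AxiomTimeStable.action_le`), while this difference is at most the mass of the
limit measure at `t` (`WeakStarMeasure.energy_sub_le`); the axiom on limits follows.

*The limit evolution.* Grönwall's inequality keeps all discrete evolutions in one compact set. One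
selects a subsequence along which measures and powers converge weakly-* and the evolutions converge
on a countable dense set of times containing the atoms of the limit measure (`exists_isSelected`).
The discrete energy balance `energyAlong_eq` then makes the energies converge at every time. At a
time without an atom, the axiom on limits says that all limits along converging times lie in one
component, so comparison with nearby times of the dense set gives convergence in the quotient at
every time and continuity of the limit there; at an atom, limits of equal energy lie in one
component, and as the limit energy has one-sided limits, so has the limit evolution
(`HasComponentLimits.exists_tendsto_limit`). Uniqueness of limits in the quotient is
`t2Space_quotSpace`: each component is surrounded by a neighbourhood whose boundary contains no
critical points at nearby times, so that components cannot leave it. The balance of the limit is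
the limit of the discrete balance along times without atoms.

*The power.* Under the two-sided slope inequality, the difference quotients of the limit energy
along critical points converge to the power at the limit point. If the power were not constant on
the limiting component at uncountably many times, then some such time would be an accumulation
point of the others, and a quotient would have two limits. Off a countable set the powers therefore
converge pointwise, and the weak-* limit `D` is identified.

*Pure atomicity.* If the power is a continuous function on the quotient, the one-sided slope
inequality bounds the lower right derivative of the limit energy from below by the density of the
work. By the balance, the limit measure has zero right density off its atoms, and a finite measure
with this property is carried by its atoms (`measure_diff_atoms_eq_zero`).
-/

namespace Quasistatic

/-! ### Components of the critical sets -/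

section Crit

variable {X : Type*} [MetricSpace X] {T : ℝ} {E : ℝ → X → ℝ}

theorem mem_crit_iff_toReal (hreg : EnergyRegular T E) {t : ℝ} (ht : t ∈ Icc 0 T) {x : X} :
    x ∈ crit E t ↔ (descSlope E t x).toReal = 0 := by
  rw [ENNReal.toReal_eq_zero_iff]
  exact ⟨Or.inl, fun h => h.resolve_right (hreg.slope_ne_top t ht x)⟩

theorem continuous_slope (hreg : EnergyRegular T E) :
    Continuous fun p : Icc (0 : ℝ) T × X => (descSlope E p.1 p.2).toReal :=
  hreg.continuousOn_slope.comp_continuous (f := fun p : Icc (0 : ℝ) T × X => ((p.1 : ℝ), p.2))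
    (by fun_prop) fun p => ⟨p.1.2, mem_univ _⟩

theorem continuous_energy (hreg : EnergyRegular T E) :
    Continuous fun p : Icc (0 : ℝ) T × X => E p.1 p.2 :=
  hreg.continuousOn.comp_continuous (f := fun p : Icc (0 : ℝ) T × X => ((p.1 : ℝ), p.2))
    (by fun_prop) fun p => ⟨p.1.2, mem_univ _⟩

theorem continuous_timeDeriv (hreg : EnergyRegular T E) :
    Continuous fun p : Icc (0 : ℝ) T × X => timeDeriv T E p.1 p.2 :=
  hreg.continuousOn_timeDeriv.comp_continuous
    (f := fun p : Icc (0 : ℝ) T × X => ((p.1 : ℝ), p.2))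
    (by fun_prop) fun p => ⟨p.1.2, mem_univ _⟩

theorem isClosed_crit (hreg : EnergyRegular T E) {t : ℝ} (ht : t ∈ Icc 0 T) :
    IsClosed (crit E t) := by
  have h : crit E t = {x | (descSlope E t x).toReal = 0} := by
    ext x; exact mem_crit_iff_toReal hreg ht
  rw [h]
  exact isClosed_eq ((continuous_slope hreg).comp (f := fun x => ((⟨t, ht⟩ : Icc (0 : ℝ) T), x))
    (by fun_prop)) continuous_const

theorem mem_crit_of_tendsto (hreg : EnergyRegular T E) {ι : Type*} {l : Filter ι} [l.NeBot]
    {s : ι → Icc (0 : ℝ) T} {y : ι → X} {t : Icc (0 : ℝ) T} {x : X} (hs : Tendsto s l (𝓝 t))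
    (hy : Tendsto y l (𝓝 x)) (h : ∀ᶠ i in l, y i ∈ crit E (s i)) : x ∈ crit E t := by
  rw [mem_crit_iff_toReal hreg t.2]
  have h1 := (continuous_slope hreg).continuousAt.tendsto.comp (hs.prodMk_nhds hy)
  refine tendsto_nhds_unique_of_eventuallyEq h1 tendsto_const_nhds ?_
  filter_upwards [h] with i hi
  exact (mem_crit_iff_toReal hreg (s i).2).1 hi

/-- The path component of `x` in the critical set. -/
def critClass (E : ℝ → X → ℝ) (t : ℝ) (x : X) : Set X := {y | JoinedIn (crit E t) x y}

/-- The path components of the critical set are compact, isolated from each other, and they are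
also its connected components. -/
theorem CriticalComponents.exists_separation (hcomp : CriticalComponents T E) {t : ℝ}
    (ht : t ∈ Icc 0 T) {x : X} (hx : x ∈ crit E t) :
    IsCompact (critClass E t x) ∧
      (∃ r > 0, ∀ y ∈ critClass E t x, ∀ z ∈ crit E t, dist y z < r → z ∈ critClass E t x) ∧
      ∀ B ⊆ crit E t, IsPreconnected B → x ∈ B → B ⊆ critClass E t x := by
  obtain ⟨𝒦, hU, -, hK⟩ := hcomp.pieces t ht
  obtain ⟨K, hK𝒦, hxK⟩ : ∃ K ∈ 𝒦, x ∈ K := by rwa [← hU, mem_sUnion] at hx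
  have hKc : K ⊆ crit E t := hU ▸ subset_sUnion_of_mem hK𝒦
  obtain ⟨hKcpt, ⟨r, hr, hsep⟩, hpath⟩ := hK K hK𝒦
  have hpre : ∀ B ⊆ crit E t, IsPreconnected B → x ∈ B → B ⊆ K := by
    intro B hB hBp hxB
    have : PreconnectedSpace B := Subtype.preconnectedSpace hBp
    have hclopen : IsClopen {b : B | (b : X) ∈ K} := by
      refine ⟨hKcpt.isClosed.preimage continuous_subtype_val, ?_⟩
      rw [Metric.isOpen_iff]
      intro b hb
      refine ⟨r, hr, fun c hc => ?_⟩
      by_contra hcK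
      have := hsep b hb c ⟨hB c.2, hcK⟩
      rw [Metric.mem_ball, dist_comm] at hc
      exact absurd hc (not_lt.2 this)
    have huniv := hclopen.eq_univ ⟨⟨x, hxB⟩, hxK⟩
    intro b hb
    have : (⟨b, hb⟩ : B) ∈ {b : B | (b : X) ∈ K} := huniv ▸ mem_univ _
    exact this
  have hclass : critClass E t x = K := by
    apply Subset.antisymm
    · intro y hy
      refine hpre (range hy.somePath) ?_ (isPreconnected_range hy.somePath.continuous)
        ⟨0, hy.somePath.source⟩ ⟨1, hy.somePath.target⟩
      rintro _ ⟨s, rfl⟩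
      exact hy.somePath_mem s
    · intro y hy
      obtain ⟨γ, hγ, -⟩ := hpath x hxK y hy
      exact ⟨γ, fun s => hKc (hγ s)⟩
  rw [hclass]
  refine ⟨hKcpt, ⟨r, hr, fun y hy z hz hyz => ?_⟩, hpre⟩
  by_contra hzK
  exact absurd hyz (not_lt.2 (hsep y hy z ⟨hz, hzK⟩))

theorem mem_critClass_self {t : ℝ} {x : X} (hx : x ∈ crit E t) : x ∈ critClass E t x :=
  JoinedIn.refl hx

/-- A compact set meets only finitely many components of the critical set. -/
theorem CriticalComponents.exists_finset (hcomp : CriticalComponents T E)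
    (hreg : EnergyRegular T E) {t : ℝ} (ht : t ∈ Icc 0 T) {K : Set X} (hK : IsCompact K) :
    ∃ F : Finset X, ∀ y ∈ crit E t ∩ K, ∃ x ∈ F, JoinedIn (crit E t) x y := by
  have hc : IsCompact (crit E t ∩ K) := hK.inter_left (isClosed_crit hreg ht)
  choose! r hr hsep using fun (x : X) (hx : x ∈ crit E t) =>
    (hcomp.exists_separation ht hx).2.1
  obtain ⟨F, hF, hcov⟩ := hc.elim_nhds_subcover (fun x => Metric.ball x (r x))
    (fun x hx => Metric.ball_mem_nhds x (hr x hx.1))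
  refine ⟨F, fun y hy => ?_⟩
  obtain ⟨x, hxF, hxy⟩ := mem_iUnion₂.1 (hcov hy)
  have hx := (hF x hxF).1
  refine ⟨x, hxF, hsep x hx x (mem_critClass_self hx) y hy.1 ?_⟩
  rwa [Metric.mem_ball, dist_comm] at hxy

end Crit

/-! ### Actions generated by curves -/

section Curves

variable {𝕀 : Type} [AddCommGroup 𝕀] [LinearOrder 𝕀] [MeasurableSpace 𝕀]

/-- The properties shared by Lebesgue measure on `ℝ` and the counting measure on `ℤ` on which the
comparison of costs at different times rests. The last two say that a bounded set of parameters is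
almost attained at both of its ends, up to an interval of measure at most `1`. -/
structure IsCurveParameter (ν : Measure 𝕀) : Prop where
  measurableSet_Ioc : ∀ a b : 𝕀, MeasurableSet (Ioc a b)
  measurableSet_Icc : ∀ a b : 𝕀, MeasurableSet (Icc a b)
  lintegral_shift : ∀ (f : 𝕀 → ENNReal) (a b r : 𝕀),
    ∫⁻ u in Ioc (a - r) (b - r), f (u + r) ∂ν = ∫⁻ u in Ioc a b, f u ∂ν
  sub_add_mem : ∀ a b r u : 𝕀, u ∈ Icc (a - r) (b - r) → u + r ∈ Icc a b
  exists_near_inf : ∀ (S : Set 𝕀) (a : 𝕀), S.Nonempty → (∀ u ∈ S, a ≤ u) →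
    ∃ w ∈ S, ∃ α, (∀ u ∈ S, α ≤ u) ∧ ν (Icc α w) ≤ 1
  exists_near_sup : ∀ (S : Set 𝕀) (b : 𝕀), S.Nonempty → (∀ u ∈ S, u ≤ b) →
    ∃ v ∈ S, ∃ β, (∀ u ∈ S, u ≤ β) ∧ ν (Ioc v β) ≤ 1

theorem isCurveParameter_volume : IsCurveParameter (volume : Measure ℝ) where
  measurableSet_Ioc a b := _root_.measurableSet_Ioc
  measurableSet_Icc a b := _root_.measurableSet_Icc
  lintegral_shift f a b r := by
    have h := (measurePreserving_add_right (volume : Measure ℝ) r).setLIntegral_comp_preimage_emb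
      (measurableEmbedding_addRight r) f (Ioc a b)
    rwa [preimage_add_const_Ioc] at h
  sub_add_mem a b r u h := ⟨by linarith [h.1], by linarith [h.2]⟩
  exists_near_inf S a hS ha := by
    obtain ⟨w, hw, hlt⟩ := exists_lt_of_csInf_lt hS (lt_add_one (sInf S))
    refine ⟨w, hw, sInf S, fun u hu => csInf_le ⟨a, ha⟩ hu, ?_⟩
    rw [Real.volume_Icc]
    exact ENNReal.ofReal_le_one.2 (by linarith)
  exists_near_sup S b hS hb := by
    obtain ⟨v, hv, hlt⟩ := exists_lt_of_lt_csSup hS (sub_one_lt (sSup S))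
    refine ⟨v, hv, sSup S, fun u hu => le_csSup ⟨b, hb⟩ hu, ?_⟩
    rw [Real.volume_Ioc]
    exact ENNReal.ofReal_le_one.2 (by linarith)

theorem isCurveParameter_count : IsCurveParameter (Measure.count : Measure ℤ) where
  measurableSet_Ioc a b := _root_.measurableSet_Ioc
  measurableSet_Icc a b := _root_.measurableSet_Icc
  lintegral_shift f a b r := by
    have h := (measurePreserving_add_right
      (Measure.count : Measure ℤ) r).setLIntegral_comp_preimage_emb
      (measurableEmbedding_addRight r) f (Ioc a b)
    rwa [preimage_add_const_Ioc] at h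
  sub_add_mem a b r u h := ⟨by linarith [h.1], by linarith [h.2]⟩
  exists_near_inf S a hS ha := by
    obtain ⟨w, hw, hmin⟩ := Int.exists_least_of_bdd (P := (· ∈ S)) ⟨a, ha⟩ hS
    exact ⟨w, hw, w, hmin, by simp⟩
  exists_near_sup S b hS hb := by
    obtain ⟨v, hv, hmax⟩ := Int.exists_greatest_of_bdd (P := (· ∈ S)) ⟨b, hb⟩ hS
    exact ⟨v, hv, v, hmax, by simp⟩

theorem setLIntegral_Ioc_add {ν : Measure 𝕀} (hν : IsCurveParameter ν) (f : 𝕀 → ENNReal)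
    {a s b : 𝕀} (h₁ : a ≤ s) (h₂ : s ≤ b) :
    ∫⁻ u in Ioc a b, f u ∂ν = ∫⁻ u in Ioc a s, f u ∂ν + ∫⁻ u in Ioc s b, f u ∂ν := by
  rw [← Ioc_union_Ioc_eq_Ioc h₁ h₂, lintegral_union (hν.measurableSet_Ioc s b)]
  exact Set.disjoint_left.2 fun u hu hu' => (hu'.1.trans_le hu.2).false

theorem setLIntegral_le_add_of_forall {ν : Measure 𝕀} (hν : IsCurveParameter ν)
    {f g : 𝕀 → ENNReal} {o : ENNReal} {u w : 𝕀} {S : Set 𝕀} (hS : MeasurableSet S) {m : ENNReal}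
    (hm : ν S ≤ m) (h : ∀ s ∈ Ioc u w, f s ≤ g s + S.indicator (fun _ => o) s) :
    ∫⁻ s in Ioc u w, f s ∂ν ≤ ∫⁻ s in Ioc u w, g s ∂ν + o * m := by
  calc ∫⁻ s in Ioc u w, f s ∂ν
      ≤ ∫⁻ s in Ioc u w, (g s + S.indicator (fun _ => o) s) ∂ν :=
        setLIntegral_mono' (hν.measurableSet_Ioc u w) h
    _ = ∫⁻ s in Ioc u w, g s ∂ν + ∫⁻ s in Ioc u w, S.indicator (fun _ => o) s ∂ν :=
        lintegral_add_right _ (measurable_const.indicator hS)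
    _ ≤ ∫⁻ s in Ioc u w, g s ∂ν + o * m := by
        gcongr
        calc _ ≤ ∫⁻ s, S.indicator (fun _ => o) s ∂ν := setLIntegral_le_lintegral _ _
          _ = o * ν S := by rw [lintegral_indicator hS]; simp
          _ ≤ o * m := by gcongr

/-- Shortcutting a path. Let `φ u w` be a cost that satisfies the triangle inequality and is bounded
by the integral of `ℓ` over `(u, w]`. Parameters in the same cell are connected at cost at most
`e`; outside of the cells `ℓ ≤ g`, and inside `ℓ ≤ g + o`. Going from the first visit of any cell
directly to the last visit of that cell, every cell is used at most once. -/
theorem cost_le_of_cells {ν : Measure 𝕀} (hν : IsCurveParameter ν) {ι : Type*}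
    (φ : 𝕀 → 𝕀 → ENNReal) (ℓ g : 𝕀 → ENNReal) (o e : ENNReal) (a b : 𝕀) (cell : ι → Set 𝕀)
    (htri : ∀ u v w, φ u w ≤ φ u v + φ v w)
    (hseg : ∀ u w, a ≤ u → u < w → w ≤ b → φ u w ≤ ∫⁻ s in Ioc u w, ℓ s ∂ν)
    (hjump : ∀ i, ∀ v ∈ cell i, ∀ w ∈ cell i, φ v w ≤ e)
    (hhi : ∀ s ∈ Ioc a b, (∀ i, s ∉ cell i) → ℓ s ≤ g s)
    (hlo : ∀ s ∈ Ioc a b, ℓ s ≤ g s + o) :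
    ∀ (n : ℕ) (J : Finset ι), J.card = n → ∀ u β₀, a ≤ u → u < b → ν (Ioc u β₀) ≤ 1 →
      (∀ s ∈ Ioc u b, β₀ < s → ∀ i, s ∈ cell i → i ∈ J) →
      φ u b ≤ ∫⁻ s in Ioc u b, g s ∂ν + (n + 1) * (2 * o + e) := by
  classical
  have hbase : ∀ u β₀, a ≤ u → u < b → ν (Ioc u β₀) ≤ 1 →
      (∀ s ∈ Ioc u b, β₀ < s → ∀ i, s ∉ cell i) →
      φ u b ≤ ∫⁻ s in Ioc u b, g s ∂ν + (2 * o + e) := by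
    intro u β₀ hau hub hβ hcell
    refine (hseg u b hau hub le_rfl).trans ?_
    refine (setLIntegral_le_add_of_forall hν (g := g) (o := o)
      (hν.measurableSet_Ioc u β₀) hβ fun s hs => ?_).trans ?_
    · by_cases hsβ : s ∈ Ioc u β₀
      · rw [indicator_of_mem hsβ]
        exact hlo s ⟨hau.trans_lt hs.1, hs.2⟩
      · rw [indicator_of_notMem hsβ, add_zero]
        exact hhi s ⟨hau.trans_lt hs.1, hs.2⟩
          (hcell s hs (not_le.1 fun h => hsβ ⟨hs.1, h⟩))
    · refine add_le_add le_rfl ?_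
      rw [mul_one, two_mul, add_assoc]
      exact le_self_add
  intro n
  induction n with
  | zero =>
    intro J hJ u β₀ hau hub hβ hcell
    rw [Finset.card_eq_zero] at hJ
    subst hJ
    simpa using hbase u β₀ hau hub hβ fun s hs h i hi => by simpa using hcell s hs h i hi
  | succ n ih =>
    intro J hJ u β₀ hau hub hβ hcell
    have hn : (2 * o + e) ≤ ((n + 1 : ℕ) + 1) * (2 * o + e) := by
      calc 2 * o + e = 1 * (2 * o + e) := (one_mul _).symm
        _ ≤ _ := by gcongr; exact le_add_self
    by_cases hne : ∃ s ∈ Ioc u b, β₀ < s ∧ ∃ i, s ∈ cell i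
    swap
    · refine (hbase u β₀ hau hub hβ fun s hs h i hi => hne ⟨s, hs, h, i, hi⟩).trans ?_
      gcongr
    -- `w` is almost the first parameter that belongs to a cell
    obtain ⟨w, ⟨hwI, hβw, i, hwi⟩, α, hα, hαw⟩ := hν.exists_near_inf
      {s | s ∈ Ioc u b ∧ β₀ < s ∧ ∃ i, s ∈ cell i} u
      (by obtain ⟨s, h1, h2⟩ := hne; exact ⟨s, h1, h2⟩) (fun s hs => hs.1.1.le)
    -- `v` is almost the last parameter in the cell of `w`
    obtain ⟨v, ⟨hvI, hwv, hvi⟩, β, hβ', hvβ⟩ := hν.exists_near_sup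
      {s | s ∈ Ioc u b ∧ w ≤ s ∧ s ∈ cell i} b ⟨w, hwI, le_rfl, hwi⟩ (fun s hs => hs.1.2)
    have h1 : φ u w ≤ ∫⁻ s in Ioc u w, g s ∂ν + o * 2 := by
      refine (hseg u w hau hwI.1 hwI.2).trans ?_
      refine setLIntegral_le_add_of_forall hν
        ((hν.measurableSet_Ioc u β₀).union (hν.measurableSet_Icc α w)) ?_ fun s hs => ?_
      · calc _ ≤ ν (Ioc u β₀) + ν (Icc α w) := measure_union_le _ _
          _ ≤ 1 + 1 := by gcongr
          _ = 2 := one_add_one_eq_two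
      · have hs' : s ∈ Ioc a b := ⟨hau.trans_lt hs.1, hs.2.trans hwI.2⟩
        by_cases hsβ : s ∈ Ioc u β₀ ∪ Icc α w
        · rw [indicator_of_mem hsβ]
          exact hlo s hs'
        · rw [indicator_of_notMem hsβ, add_zero]
          refine hhi s hs' fun k hk => hsβ ?_
          by_cases h : s ≤ β₀
          · exact Or.inl ⟨hs.1, h⟩
          · exact Or.inr ⟨hα s ⟨⟨hs.1, hs'.2⟩, not_le.1 h, k, hk⟩, hs.2⟩
    have h2 : φ w v ≤ e := hjump i w hwi v hvi
    have hi : i ∈ J := hcell w hwI hβw i hwi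
    have hmono : ∫⁻ s in Ioc u w, g s ∂ν ≤ ∫⁻ s in Ioc u v, g s ∂ν :=
      lintegral_mono_set (Ioc_subset_Ioc_right hwv)
    have h12 : φ u v ≤ ∫⁻ s in Ioc u v, g s ∂ν + (2 * o + e) := by
      calc φ u v ≤ φ u w + φ w v := htri _ _ _
        _ ≤ (∫⁻ s in Ioc u v, g s ∂ν + o * 2) + e := by gcongr; exact h1.trans (by gcongr)
        _ = _ := by ring
    rcases hvI.2.eq_or_lt with rfl | hvb
    · exact h12.trans (by gcongr)
    · have h3 := ih (J.erase i) (by rw [Finset.card_erase_of_mem hi, hJ]; rfl) v β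
        (hau.trans hvI.1.le) hvb hvβ (by
          intro s hs hβs k hk
          refine Finset.mem_erase.2 ⟨?_, hcell s ⟨hvI.1.trans hs.1, hs.2⟩
            (hβw.trans_le (hwv.trans hs.1.le)) k hk⟩
          rintro rfl
          exact (hβ' s ⟨⟨hvI.1.trans hs.1, hs.2⟩, hwv.trans hs.1.le, hk⟩).not_gt hβs)
      calc φ u b ≤ φ u v + φ v b := htri _ _ _
        _ ≤ (∫⁻ s in Ioc u v, g s ∂ν + (2 * o + e)) +
            (∫⁻ s in Ioc v b, g s ∂ν + (n + 1) * (2 * o + e)) := by gcongr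
        _ = _ := by
            rw [setLIntegral_Ioc_add hν g hvI.1.le hvI.2]; push_cast; ring

end Curves

section CurveActions

theorem phaseCost_le_curveCost {𝕀 : Type} [LinearOrder 𝕀] [MeasurableSpace 𝕀] {ν : Measure 𝕀}
    {P : Type*} {Γ : P → P → 𝕀 → 𝕀 → Set (𝕀 → P)} {L : P → ℝ → ℝ} {t : ℝ}
    {p q : P} {a b : 𝕀} {γ : 𝕀 → P} (h : γ ∈ Γ p q a b) :
    phaseCost ν Γ L t p q ≤ curveCost ν L t a b γ :=
  (iInf_le _ a).trans ((iInf_le _ b).trans ((iInf_le _ γ).trans (iInf_le _ h)))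

theorem exists_curveCost_lt {𝕀 : Type} [LinearOrder 𝕀] [MeasurableSpace 𝕀] {ν : Measure 𝕀}
    {P : Type*} {Γ : P → P → 𝕀 → 𝕀 → Set (𝕀 → P)} {L : P → ℝ → ℝ} {t : ℝ}
    {p q : P} {C : ENNReal} (h : phaseCost ν Γ L t p q < C) :
    ∃ a b, ∃ γ ∈ Γ p q a b, curveCost ν L t a b γ < C := by
  simpa [phaseCost, iInf_lt_iff] using h

variable {X : Type*} [MetricSpace X] {T : ℝ} {E : ℝ → X → ℝ} {c : ℝ → X → X → ℝ}
variable {𝕀 : Type} [AddCommGroup 𝕀] [LinearOrder 𝕀] [MeasurableSpace 𝕀] {ν : Measure 𝕀}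
variable {P : Type*} [MetricSpace P]

/-- Concatenation of two admissible curves, the second one being shifted. Both curves carry a
density, and these are concatenated as well; the density may come from prices at various times. -/
theorem CurveGeneration.exists_concat (G : CurveGeneration T E c ν P) (hν : IsCurveParameter ν)
    {p q r : P} {a s s' b' : 𝕀} {γ γ' : 𝕀 → P} (hγ : γ ∈ G.Γ p q a s) (hγ' : γ' ∈ G.Γ q r s' b')
    (f f' : 𝕀 → ENNReal) :
    ∃ b, ∃ γ'' ∈ G.Γ p r a b, ∃ f'' : 𝕀 → ENNReal,
      (∀ Q : P → ENNReal → Prop, (∀ u ∈ Ioc a s, Q (γ u) (f u)) →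
        (∀ u ∈ Ioc s' b', Q (γ' u) (f' u)) → ∀ u ∈ Ioc a b, Q (γ'' u) (f'' u)) ∧
      ∫⁻ u in Ioc a b, f'' u ∂ν = ∫⁻ u in Ioc a s, f u ∂ν + ∫⁻ u in Ioc s' b', f' u ∂ν := by
  have hss : s' - (s' - s) = s := sub_sub_cancel s' s
  have h1 := G.shift q r s' b' γ' hγ' (s' - s)
  rw [hss] at h1
  have has := G.domain _ _ _ _ _ hγ
  have hsb := G.domain _ _ _ _ _ h1
  refine ⟨_, _, G.concat p q r a s _ γ hγ _ h1,
    fun u => if u ≤ s then f u else f' (u + (s' - s)), ?_, ?_⟩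
  · intro Q hQ hQ' u hu
    by_cases hus : u ≤ s
    · simp only [hus, if_true]
      exact hQ u ⟨hu.1, hus⟩
    · simp only [hus, if_false]
      have hmem := hν.sub_add_mem s' b' (s' - s) u ⟨by rw [hss]; exact (not_le.1 hus).le, hu.2⟩
      refine hQ' _ ⟨hmem.1.lt_of_ne fun h => hus ?_, hmem.2⟩
      have : u = s := by
        have h' : s' = u + (s' - s) := h
        have := congrArg (fun z => z - (s' - s)) h'
        simpa [hss] using this.symm
      exact this.le
  · rw [setLIntegral_Ioc_add hν _ has.le hsb.le]
    congr 1
    · exact setLIntegral_congr_fun (hν.measurableSet_Ioc _ _) fun u hu => if_pos hu.2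
    · rw [← hν.lintegral_shift f' s' b' (s' - s), hss]
      exact setLIntegral_congr_fun (hν.measurableSet_Ioc _ _) fun u hu => if_neg (not_le.2 hu.1)

theorem CurveGeneration.phaseCost_triangle (G : CurveGeneration T E c ν P)
    (hν : IsCurveParameter ν) (t : ℝ) (p q r : P) :
    phaseCost ν G.Γ G.L t p r ≤ phaseCost ν G.Γ G.L t p q + phaseCost ν G.Γ G.L t q r := by
  refine ENNReal.le_of_forall_pos_le_add fun ε hε hlt => ?_
  have hε2 : ((ε / 2 : NNReal) : ENNReal) ≠ 0 := by simpa using hε.ne'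
  obtain ⟨hlt1, hlt2⟩ := ENNReal.add_lt_top.1 hlt
  obtain ⟨a, s, γ, hγ, h1⟩ := exists_curveCost_lt (ENNReal.lt_add_right hlt1.ne hε2)
  obtain ⟨s', b', γ', hγ', h2⟩ := exists_curveCost_lt (ENNReal.lt_add_right hlt2.ne hε2)
  obtain ⟨b, γ'', hγ'', f'', hQ, hf⟩ := G.exists_concat hν hγ hγ'
    (fun u => ENNReal.ofReal (G.L (γ u) t)) (fun u => ENNReal.ofReal (G.L (γ' u) t))
  have hcost : curveCost ν G.L t a b γ'' = curveCost ν G.L t a s γ + curveCost ν G.L t s' b' γ' := by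
    rw [curveCost, curveCost, curveCost, ← hf]
    refine setLIntegral_congr_fun (hν.measurableSet_Ioc _ _) ?_
    exact hQ (fun p x => ENNReal.ofReal (G.L p t) = x) (fun _ _ => rfl) (fun _ _ => rfl)
  calc _ ≤ curveCost ν G.L t a b γ'' := phaseCost_le_curveCost hγ''
    _ ≤ _ := hcost.le.trans (add_le_add h1.le h2.le)
    _ = _ := by
      rw [add_add_add_comm, ← ENNReal.coe_add, add_halves]

theorem CurveGeneration.phaseCost_restrict (G : CurveGeneration T E c ν P) (t : ℝ) {p q : P}
    {a b u w : 𝕀} {γ : 𝕀 → P} (hγ : γ ∈ G.Γ p q a b) (hau : a ≤ u) (huw : u < w) (hwb : w ≤ b) :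
    phaseCost ν G.Γ G.L t (γ u) (γ w) ≤ curveCost ν G.L t u w γ := by
  apply phaseCost_le_curveCost
  have h1 : γ ∈ G.Γ (γ u) q u b := by
    rcases hau.eq_or_lt with rfl | hau
    · rwa [(G.ends _ _ _ _ _ hγ).1]
    · exact G.restrict_right _ _ _ _ _ hγ u hau (huw.trans_le hwb)
  rcases hwb.eq_or_lt with rfl | hwb
  · rwa [(G.ends _ _ _ _ _ hγ).2]
  · exact G.restrict_left _ _ _ _ _ h1 w huw hwb

theorem CurveGeneration.action_self (G : CurveGeneration T E c ν P) (hact : IsAction T E c) {t : ℝ}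
    (ht : t ∈ Icc 0 T) {x : X} (hx : x ∈ crit E t) : c t x x = 0 := by
  refine le_antisymm (le_of_forall_pos_le_add fun ε hε => ?_) (hact.nonneg t ht x x)
  obtain ⟨l, hl, ρ, hρ, h⟩ := G.cheap t ht {G.i x} isCompact_singleton ε hε
  have hL : G.L (G.i x) t = 0 := (G.price_zero t ht _).2 ⟨x, hx, rfl⟩
  have := h _ rfl _ rfl (hL.trans_le hρ.le) (hL.trans_le hρ.le) (by simpa using hl.le)
  rw [← G.action_eq t ht, ENNReal.ofReal_le_ofReal_iff hε.le] at this
  simpa using this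

theorem CurveGeneration.zero_iff (G : CurveGeneration T E c ν P) (hact : IsAction T E c)
    (hcomp : CriticalComponents T E) {t : ℝ} (ht : t ∈ Icc 0 T) {x y : X} (hx : x ∈ crit E t)
    (hy : y ∈ crit E t) : c t x y = 0 ↔ JoinedIn (crit E t) x y := by
  rcases eq_or_ne x y with rfl | hxy
  · exact ⟨fun _ => JoinedIn.refl hx, fun _ => G.action_self hact ht hx⟩
  have hF : {p | G.L p t = 0} = G.i '' crit E t := by
    ext p; exact G.price_zero t ht p
  rw [G.action_zero t ht x y hxy, hF]
  constructor
  · intro h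
    have hsub := connectedComponentIn_subset (G.i '' crit E t) (G.i x)
    have himg : G.i '' (G.i ⁻¹' connectedComponentIn (G.i '' crit E t) (G.i x)) =
        connectedComponentIn (G.i '' crit E t) (G.i x) :=
      image_preimage_eq_of_subset (hsub.trans (image_subset_range _ _))
    refine (hcomp.exists_separation ht hx).2.2
      (G.i ⁻¹' connectedComponentIn (G.i '' crit E t) (G.i x)) ?_ ?_ ?_ h
    · intro z hz
      obtain ⟨z', hz', h'⟩ := hsub hz
      rwa [← G.isClosedEmbedding.injective h']
    · rw [← G.isClosedEmbedding.isInducing.isPreconnected_image, himg]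
      exact isPreconnected_connectedComponentIn
    · exact mem_connectedComponentIn ⟨x, hx, rfl⟩
  · intro h
    have hr : range (fun s => G.i (h.somePath s)) ⊆ G.i '' crit E t := by
      rintro _ ⟨s, rfl⟩
      exact ⟨_, h.somePath_mem s, rfl⟩
    exact (isPreconnected_range (G.isClosedEmbedding.continuous.comp
      h.somePath.continuous)).subset_connectedComponentIn
      (x := G.i x) ⟨0, by simp⟩ hr ⟨1, by simp⟩

/-- A chain of transitions is traced by a single admissible curve with a density. -/
theorem CurveGeneration.exists_curve_of_chain (G : CurveGeneration T E c ν P)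
    (hν : IsCurveParameter ν) {t o η : ℝ} (hη : 0 < η) {K : Set X} {K' : Set P}
    (hK' : ∀ t ∈ Icc 0 T, ∀ p ∈ G.i '' K, ∀ q ∈ G.i '' K, ∀ ε > 0, ∃ a b, ∃ γ ∈ G.Γ p q a b,
      (∀ s ∈ Icc a b, γ s ∈ K') ∧
        curveCost ν G.L t a b γ ≤ phaseCost ν G.Γ G.L t p q + ENNReal.ofReal ε)
    (s : ℕ → ℝ) (x : ℕ → X) (m : ℕ) :
    (∀ i ≤ m + 1, x i ∈ K) →
    (∀ i < m + 1, s i ∈ Icc 0 T ∧ ∀ p ∈ K', G.L p t ≤ G.L p (s i) + o) →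
    ∃ a b, ∃ γ ∈ G.Γ (G.i (x 0)) (G.i (x (m + 1))) a b, ∃ f : 𝕀 → ENNReal,
      (∀ u ∈ Ioc a b, γ u ∈ K' ∧ ENNReal.ofReal (G.L (γ u) t) ≤ f u + ENNReal.ofReal o) ∧
      ∫⁻ u in Ioc a b, f u ∂ν ≤
        ∑ i ∈ Finset.range (m + 1), (ENNReal.ofReal (c (s i) (x i) (x (i + 1))) +
          ENNReal.ofReal η) := by
  have step : ∀ k, x k ∈ K → x (k + 1) ∈ K → s k ∈ Icc 0 T →
      (∀ p ∈ K', G.L p t ≤ G.L p (s k) + o) →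
      ∃ a b, ∃ γ ∈ G.Γ (G.i (x k)) (G.i (x (k + 1))) a b, ∃ f : 𝕀 → ENNReal,
      (∀ u ∈ Ioc a b, γ u ∈ K' ∧ ENNReal.ofReal (G.L (γ u) t) ≤ f u + ENNReal.ofReal o) ∧
      ∫⁻ u in Ioc a b, f u ∂ν ≤ ENNReal.ofReal (c (s k) (x k) (x (k + 1))) +
          ENNReal.ofReal η := by
    intro k h1 h2 h3 h4
    obtain ⟨a, b, γ, hγ, hmem, hcost⟩ := hK' (s k) h3 _ ⟨_, h1, rfl⟩ _ ⟨_, h2, rfl⟩ η hη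
    refine ⟨a, b, γ, hγ, fun u => ENNReal.ofReal (G.L (γ u) (s k)), fun u hu => ?_, ?_⟩
    · have hu' := hmem u ⟨hu.1.le, hu.2⟩
      exact ⟨hu', (ENNReal.ofReal_le_ofReal (h4 _ hu')).trans ENNReal.ofReal_add_le⟩
    · rw [G.action_eq _ h3]
      exact hcost
  induction m with
  | zero =>
    intro hx hs
    have := step 0 (hx 0 (by omega)) (hx 1 (by omega)) (hs 0 (by omega)).1 (hs 0 (by omega)).2
    simpa using this
  | succ m ih =>
    intro hx hs
    obtain ⟨a, b, γ, hγ, f, hf, hint⟩ :=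
      ih (fun i hi => hx i (by omega)) (fun i hi => hs i (by omega))
    obtain ⟨a', b', γ', hγ', f', hf', hint'⟩ := step (m + 1) (hx _ (by omega)) (hx _ (by omega))
      (hs (m + 1) (by omega)).1 (hs (m + 1) (by omega)).2
    obtain ⟨b'', γ'', hγ'', f'', hQ, hI⟩ := G.exists_concat hν hγ hγ' f f'
    refine ⟨a, b'', γ'', hγ'', f'',
      hQ (fun p x => p ∈ K' ∧ ENNReal.ofReal (G.L p t) ≤ x + ENNReal.ofReal o) hf hf', ?_⟩
    rw [hI, Finset.sum_range_succ]
    exact add_le_add hint hint'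

end CurveActions

section CurveActions

variable {X : Type*} [MetricSpace X] {T : ℝ} {E : ℝ → X → ℝ} {c : ℝ → X → X → ℝ}
variable {𝕀 : Type} [AddCommGroup 𝕀] [LinearOrder 𝕀] [MeasurableSpace 𝕀] {ν : Measure 𝕀}
variable {P : Type*} [MetricSpace P]

/-- Points of a compact set at which the price is small are close to its zeros. -/
theorem CurveGeneration.exists_price_lt_imp (G : CurveGeneration T E c ν P) {t : ℝ}
    (ht : t ∈ Icc 0 T) {K' : Set P} (hK' : IsCompact K') {l : ℝ} (hl : 0 < l) :
    ∃ ρ > 0, ∀ p ∈ K', G.L p t ≤ ρ → ∃ y ∈ crit E t, G.i y ∈ K' ∧ dist p (G.i y) ≤ l := by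
  have hcont : Continuous fun p => G.L p t :=
    G.L_continuousOn.comp_continuous (f := fun p => (p, t)) (by fun_prop) fun p => ⟨mem_univ _, ht⟩
  have hN : IsCompact (K' \ Metric.thickening l (K' ∩ {p | G.L p t = 0})) :=
    hK'.diff Metric.isOpen_thickening
  have hpos : ∀ p ∈ K' \ Metric.thickening l (K' ∩ {p | G.L p t = 0}), 0 < G.L p t := by
    intro p hp
    refine (G.L_nonneg p t ht).lt_of_ne' fun h0 => hp.2 ?_
    exact Metric.self_subset_thickening hl _ ⟨hp.1, h0⟩
  obtain ⟨ρ, hρ, hle⟩ := hN.exists_forall_le' hcont.continuousOn hpos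
  refine ⟨ρ / 2, half_pos hρ, fun p hp hpρ => ?_⟩
  by_cases hth : p ∈ Metric.thickening l (K' ∩ {p | G.L p t = 0})
  · obtain ⟨z, ⟨hz, hz0⟩, hpz⟩ := Metric.mem_thickening_iff.1 hth
    obtain ⟨y, hy, rfl⟩ := (G.price_zero t ht z).1 hz0
    exact ⟨y, hy, hz, hpz.le⟩
  · have := hle p ⟨hp, hth⟩
    linarith

theorem CurveGeneration.exists_price_close (G : CurveGeneration T E c ν P) {t : ℝ}
    (ht : t ∈ Icc 0 T) {K' : Set P} (hK' : IsCompact K') {o : ℝ} (ho : 0 < o) :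
    ∃ Δ > 0, ∀ s ∈ Icc 0 T, s ∈ Icc (t - Δ) (t + Δ) → ∀ p ∈ K', G.L p t ≤ G.L p s + o := by
  have hu : UniformContinuousOn (fun z : P × ℝ => G.L z.1 z.2) (K' ×ˢ Icc 0 T) :=
    (hK'.prod isCompact_Icc).uniformContinuousOn_of_continuous
      (G.L_continuousOn.mono (prod_mono (subset_univ _) le_rfl))
  obtain ⟨Δ, hΔ, h⟩ := Metric.uniformContinuousOn_iff.1 hu o ho
  refine ⟨Δ / 2, half_pos hΔ, fun s hs hst p hp => ?_⟩
  have := h (p, t) ⟨hp, ht⟩ (p, s) ⟨hp, hs⟩ (by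
    rw [Prod.dist_eq, dist_self, Real.dist_eq]
    refine max_lt hΔ (abs_lt.2 ⟨by linarith [hst.2], by linarith [hst.1]⟩))
  rw [Real.dist_eq] at this
  linarith [(abs_lt.1 this).2]

/-- For actions generated by curves the triangle inequality is stable in time. The curves tracing a
chain may be arbitrarily long, but only finitely many components of the critical set matter, and the
visit of each of them is shortcut at small cost; away from the zeros of the price, the prices at
two close times are close to each other in ratio. -/
theorem CurveGeneration.stable (G : CurveGeneration T E c ν P) (hν : IsCurveParameter ν)
    (hreg : EnergyRegular T E) (hcomp : CriticalComponents T E) (hact : IsAction T E c)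
    {ε : ℝ} (hε : 0 < ε) {C : ℝ} (hC : 0 < C) {t : ℝ} (ht : t ∈ Icc 0 T) {K : Set X}
    (hK : IsCompact K) : ∃ Δ > 0,
    ∀ (m : ℕ) (x : ℕ → X) (s : ℕ → ℝ), 1 ≤ m → (∀ i ≤ m, x i ∈ K) →
      (∀ i < m, s i ∈ Icc 0 T ∧ s i ∈ Icc (t - Δ) (t + Δ)) →
      ∑ i ∈ Finset.range m, c (s i) (x i) (x (i + 1)) ≤ C →
      c t (x 0) (x m) ≤ ∑ i ∈ Finset.range m, c (s i) (x i) (x (i + 1)) + ε := by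
  obtain ⟨K', hK'c, hK'⟩ := G.coercive _ (hK.image G.isClosedEmbedding.continuous)
  obtain ⟨F, hF⟩ := hcomp.exists_finset hreg ht (G.isClosedEmbedding.isCompact_preimage hK'c)
  set N : ℝ := F.card + 1 with hN
  have hNpos : 0 < N := by positivity
  set e : ℝ := ε / (8 * N) with he
  have hepos : 0 < e := by positivity
  set θ : ℝ := ε / (8 * (C + 1)) with hθ
  have hθpos : 0 < θ := by positivity
  obtain ⟨l, hl, ρ, hρ, hcheap⟩ := G.cheap t ht K' hK'c e hepos
  obtain ⟨ρ₁, hρ₁, hnear⟩ := G.exists_price_lt_imp ht hK'c hl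
  set o : ℝ := min e (θ * min ρ ρ₁ / (1 + θ)) with ho
  have hopos : 0 < o := lt_min hepos (by positivity)
  have ho' : o * (1 + θ) ≤ θ * min ρ ρ₁ := (le_div_iff₀ (by positivity)).1 (min_le_right _ _)
  obtain ⟨Δ, hΔ, hclose⟩ := G.exists_price_close ht hK'c hopos
  refine ⟨Δ, hΔ, fun m x s hm hx hs hsum => ?_⟩
  obtain ⟨m, rfl⟩ : ∃ k, m = k + 1 := ⟨m - 1, by omega⟩
  set S : ℝ := ∑ i ∈ Finset.range (m + 1), c (s i) (x i) (x (i + 1)) with hS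
  have hc0 : ∀ i ∈ Finset.range (m + 1), 0 ≤ c (s i) (x i) (x (i + 1)) := fun i hi =>
    hact.nonneg _ (hs i (Finset.mem_range.1 hi)).1 _ _
  have hS0 : 0 ≤ S := Finset.sum_nonneg hc0
  set η : ℝ := ε / (8 * (1 + θ) * (m + 1)) with hη
  have hηpos : 0 < η := by positivity
  obtain ⟨a, b, γ, hγ, f, hf, hint⟩ := G.exists_curve_of_chain hν (t := t) (o := o) hηpos hK' s x m
    hx (fun i hi => ⟨(hs i hi).1, hclose _ (hs i hi).1 (hs i hi).2⟩)
  have hab := G.domain _ _ _ _ _ hγ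
  have hends := G.ends _ _ _ _ _ hγ
  have hbound := cost_le_of_cells hν (fun u w => phaseCost ν G.Γ G.L t (γ u) (γ w))
    (fun u => ENNReal.ofReal (G.L (γ u) t)) (fun u => ENNReal.ofReal (1 + θ) * f u)
    (ENNReal.ofReal o) (ENNReal.ofReal (2 * e)) a b
    (fun z : X => {u | z ∈ F ∧ γ u ∈ K' ∧ G.L (γ u) t ≤ min ρ ρ₁ ∧
      ∃ y, JoinedIn (crit E t) z y ∧ G.i y ∈ K' ∧ dist (γ u) (G.i y) ≤ l})
    (fun u v w => G.phaseCost_triangle hν t _ _ _)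
    (fun u w hau huw hwb => G.phaseCost_restrict t hγ hau huw hwb)
    (by
      -- both points are close to the same component, along which motion is free
      rintro z v ⟨-, hvK, hvL, y, hzy, hyK, hvy⟩ w ⟨-, hwK, hwL, y', hzy', hyK', hwy'⟩
      have hy0 : G.L (G.i y) t = 0 := (G.price_zero t ht _).2 ⟨y, hzy.target_mem, rfl⟩
      have hy0' : G.L (G.i y') t = 0 := (G.price_zero t ht _).2 ⟨y', hzy'.target_mem, rfl⟩
      have h1 := hcheap _ hvK _ hyK (hvL.trans (min_le_left _ _)) (hy0.trans_le hρ.le) hvy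
      have h2 : phaseCost ν G.Γ G.L t (G.i y) (G.i y') = 0 := by
        rw [← G.action_eq t ht, (G.zero_iff hact hcomp ht hzy.target_mem hzy'.target_mem).2
          (hzy.symm.trans hzy'), ENNReal.ofReal_zero]
      have h3 := hcheap _ hyK' _ hwK (hy0'.trans_le hρ.le) (hwL.trans (min_le_left _ _))
        (by rwa [dist_comm])
      calc _ ≤ phaseCost ν G.Γ G.L t (γ v) (G.i y) + phaseCost ν G.Γ G.L t (G.i y) (γ w) :=
            G.phaseCost_triangle hν t _ _ _
        _ ≤ ENNReal.ofReal e + (0 + ENNReal.ofReal e) := by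
            refine add_le_add h1 ((G.phaseCost_triangle hν t _ (G.i y') _).trans ?_)
            exact add_le_add h2.le h3
        _ = _ := by rw [zero_add, ← ENNReal.ofReal_add hepos.le hepos.le, two_mul])
    (by
      intro u hu hcell
      obtain ⟨huK, hle⟩ := hf u hu
      have hhigh : min ρ ρ₁ < G.L (γ u) t := by
        by_contra! hlow
        obtain ⟨y, hy, hyK, hd⟩ := hnear _ huK (hlow.trans (min_le_right _ _))
        obtain ⟨z, hz, hzy⟩ := hF y ⟨hy, hyK⟩
        exact hcell z ⟨hz, huK, hlow, y, hzy, hyK, hd⟩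
      rcases eq_or_ne (f u) ⊤ with hftop | hftop
      · rw [hftop, ENNReal.mul_top (by simpa using by linarith)]
        exact le_top
      · lift f u to NNReal using hftop with r
        rw [← ENNReal.ofReal_coe_nnreal, ← ENNReal.ofReal_add (NNReal.coe_nonneg r) hopos.le,
          ENNReal.ofReal_le_ofReal_iff (by positivity)] at hle
        rw [← ENNReal.ofReal_coe_nnreal, ← ENNReal.ofReal_mul (by positivity)]
        refine ENNReal.ofReal_le_ofReal ?_
        have : θ * min ρ ρ₁ ≤ θ * G.L (γ u) t := by gcongr
        nlinarith)
    (by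
      intro u hu
      refine (hf u hu).2.trans (add_le_add ?_ le_rfl)
      calc f u = 1 * f u := (one_mul _).symm
        _ ≤ _ := by gcongr; rw [ENNReal.one_le_ofReal]; linarith)
    F.card F rfl a a le_rfl hab (by simp) (fun _ _ _ _ h => h.1)
  simp only [hends.1, hends.2] at hbound
  rw [lintegral_const_mul' _ _ ENNReal.ofReal_ne_top, ← G.action_eq t ht] at hbound
  have hsumr : ∑ i ∈ Finset.range (m + 1), (ENNReal.ofReal (c (s i) (x i) (x (i + 1))) +
      ENNReal.ofReal η) = ENNReal.ofReal (S + (m + 1) * η) := by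
    rw [Finset.sum_add_distrib, ← ENNReal.ofReal_sum_of_nonneg hc0, Finset.sum_const,
      Finset.card_range, ENNReal.ofReal_add hS0 (by positivity), nsmul_eq_mul,
      ENNReal.ofReal_mul (by positivity)]
    congr 2
    rw [← Nat.cast_succ, ENNReal.ofReal_natCast]
  have hfin : ENNReal.ofReal (c t (x 0) (x (m + 1))) ≤
      ENNReal.ofReal ((1 + θ) * (S + (m + 1) * η) + N * (2 * o + 2 * e)) := by
    have hR : ENNReal.ofReal ((1 + θ) * (S + (m + 1) * η) + N * (2 * o + 2 * e)) =
        ENNReal.ofReal (1 + θ) * ENNReal.ofReal (S + (m + 1) * η) +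
          (F.card + 1) * (2 * ENNReal.ofReal o + ENNReal.ofReal (2 * e)) := by
      have hN' : ENNReal.ofReal N = F.card + 1 := by
        rw [hN, ← Nat.cast_succ, ENNReal.ofReal_natCast, Nat.cast_succ]
      have ho2 : ENNReal.ofReal (2 * o) = 2 * ENNReal.ofReal o := by
        rw [ENNReal.ofReal_mul zero_le_two, ENNReal.ofReal_ofNat]
      rw [ENNReal.ofReal_add (by positivity : 0 ≤ (1 + θ) * (S + (m + 1) * η)) (by positivity),
        ENNReal.ofReal_mul (by positivity),
        ENNReal.ofReal_mul hNpos.le, hN',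
        ENNReal.ofReal_add (by positivity : 0 ≤ 2 * o) (by positivity), ho2]
    rw [hR]
    refine hbound.trans ?_
    gcongr
    exact hint.trans_eq hsumr
  rw [ENNReal.ofReal_le_ofReal_iff (by positivity)] at hfin
  refine hfin.trans ?_
  have h1 : (1 + θ) * ((m + 1) * η) = ε / 8 := by rw [hη]; field_simp
  have h2 : θ * S ≤ ε / 8 := by
    calc θ * S ≤ θ * (C + 1) := by gcongr; linarith
      _ = ε / 8 := by rw [hθ]; field_simp
  have h3 : N * e = ε / 8 := by rw [he]; field_simp
  have h4 : N * o ≤ ε / 8 := h3 ▸ by gcongr; exact min_le_left _ _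
  nlinarith

theorem AxiomTimeStable.of_curveGeneration {ω : ℝ → X → X} (G : CurveGeneration T E c ν P)
    (hν : IsCurveParameter ν) (hreg : EnergyRegular T E) (hcomp : CriticalComponents T E)
    (hact : IsAction T E c) (hω : IsCompatible T E ω c) : AxiomTimeStable T E ω c where
  action := hact
  compatible := hω
  stable _ hε _ hC _ ht _ hK := G.stable hν hreg hcomp hact hε hC ht hK
  zero_iff _ ht _ hx _ hy := G.zero_iff hact hcomp ht hx hy

end CurveActions

theorem AxiomTimeStable.of_isGeneratedByCurves {X : Type*} [MetricSpace X] {T : ℝ} {E : ℝ → X → ℝ}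
    {c : ℝ → X → X → ℝ} {ω : ℝ → X → X} {P : Type*} [MetricSpace P] (hreg : EnergyRegular T E)
    (hcomp : CriticalComponents T E) (hact : IsAction T E c) (hω : IsCompatible T E ω c)
    (h : IsGeneratedByCurves T E c P) : AxiomTimeStable T E ω c := by
  rcases h with ⟨⟨G⟩⟩ | ⟨⟨G⟩⟩
  · exact .of_curveGeneration G isCurveParameter_volume hreg hcomp hact hω
  · exact .of_curveGeneration G isCurveParameter_count hreg hcomp hact hω

/-! ### The energy in time -/

section Energy

variable {X : Type*} [MetricSpace X] {T : ℝ} {E : ℝ → X → ℝ}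

theorem EnergyRegular.hasDerivWithinAt (hreg : EnergyRegular T E) {t : ℝ} (ht : t ∈ Icc 0 T)
    (x : X) : HasDerivWithinAt (fun s => E s x) (timeDeriv T E t x) (Icc 0 T) t :=
  (hreg.differentiableOn x t ht).hasDerivWithinAt

theorem EnergyRegular.hasDerivAt (hreg : EnergyRegular T E) {t : ℝ} (ht : t ∈ Ioo 0 T)
    (x : X) : HasDerivAt (fun s => E s x) (timeDeriv T E t x) t :=
  (hreg.hasDerivWithinAt (Ioo_subset_Icc_self ht) x).hasDerivAt (Icc_mem_nhds ht.1 ht.2)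

theorem EnergyRegular.integral_timeDeriv (hreg : EnergyRegular T E) {a b : ℝ} (ha : 0 ≤ a)
    (hab : a ≤ b) (hb : b ≤ T) (x : X) :
    IntervalIntegrable (fun s => timeDeriv T E s x) volume a b ∧
      ∫ s in a..b, timeDeriv T E s x = E b x - E a x := by
  have hsub : Icc a b ⊆ Icc 0 T := Icc_subset_Icc ha hb
  have hc : ContinuousOn (fun s => timeDeriv T E s x) (Icc a b) :=
    hreg.continuousOn_timeDeriv.comp (f := fun s => (s, x)) (by fun_prop)
      fun s hs => ⟨hsub hs, mem_univ _⟩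
  have hi : IntervalIntegrable (fun s => timeDeriv T E s x) volume a b :=
    hc.intervalIntegrable_of_Icc hab
  refine ⟨hi, intervalIntegral.integral_eq_sub_of_hasDerivAt_of_le hab
    ((hreg.differentiableOn x).continuousOn.mono hsub) (fun s hs => hreg.hasDerivAt
      ⟨ha.trans_lt hs.1, hs.2.trans_le hb⟩ x) hi⟩

/-- Difference quotients in time along convergent points converge to the time derivative. -/
theorem EnergyRegular.tendsto_slope (hreg : EnergyRegular T E) {ι : Type*} {l : Filter ι}
    {s : ι → Icc (0 : ℝ) T} {y : ι → X} {t : Icc (0 : ℝ) T} {x : X} (hs : Tendsto s l (𝓝 t))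
    (hy : Tendsto y l (𝓝 x)) (hne : ∀ i, s i ≠ t) :
    Tendsto (fun i => (E (s i) (y i) - E t (y i)) / ((s i : ℝ) - t)) l (𝓝 (timeDeriv T E t x)) := by
  rw [Metric.tendsto_nhds]
  intro ε hε
  have hcont : ContinuousAt (fun p : Icc (0 : ℝ) T × X => timeDeriv T E p.1 p.2) (t, x) :=
    (continuous_timeDeriv hreg).continuousAt
  obtain ⟨r, hr, hball⟩ := Metric.continuousAt_iff.1 hcont (ε / 2) (half_pos hε)
  filter_upwards [hs (Metric.ball_mem_nhds t hr), hy (Metric.ball_mem_nhds x hr)] with i his hiy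
  have hne' : ((s i : ℝ) - t) ≠ 0 := sub_ne_zero.2 fun h => hne i (Subtype.ext h)
  have hsub : uIcc (t : ℝ) (s i) ⊆ Icc 0 T := ordConnected_Icc.uIcc_subset t.2 (s i).2
  have key := (convex_uIcc (t : ℝ) (s i)).norm_image_sub_le_of_norm_hasDerivWithin_le
    (f := fun τ => E τ (y i) - τ * timeDeriv T E t x)
    (f' := fun τ => timeDeriv T E τ (y i) - 1 * timeDeriv T E t x) (C := ε / 2)
    (fun τ hτ => ((hreg.hasDerivWithinAt (hsub hτ) (y i)).mono hsub).sub
      ((hasDerivWithinAt_id τ _).mul_const _))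
    (fun τ hτ => by
      have h1 : dist ((⟨τ, hsub hτ⟩ : Icc (0 : ℝ) T), y i) (t, x) < r := by
        rw [Prod.dist_eq]
        refine max_lt (lt_of_le_of_lt ?_ his) hiy
        rw [Subtype.dist_eq, Subtype.dist_eq, Real.dist_eq, Real.dist_eq]
        exact abs_sub_left_of_mem_uIcc hτ
      have h2 := hball h1
      rw [Real.dist_eq] at h2
      rw [one_mul, Real.norm_eq_abs]
      exact h2.le) left_mem_uIcc right_mem_uIcc
  rw [Real.norm_eq_abs, Real.norm_eq_abs] at key
  rw [Real.dist_eq]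
  have h3 : (E (s i) (y i) - E t (y i)) / ((s i : ℝ) - t) - timeDeriv T E t x =
      (E (s i) (y i) - s i * timeDeriv T E t x - (E t (y i) - t * timeDeriv T E t x)) /
        ((s i : ℝ) - t) := by
    field_simp
    ring
  rw [h3, abs_div]
  exact ((div_le_iff₀ (abs_pos.2 hne')).2 key).trans_lt (half_lt_self hε)

/-- Grönwall's inequality for the energy, forward in time and backward in time. -/
theorem energy_gronwall (hreg : EnergyRegular T E) {C₁ C₂ : ℝ} (hC₁ : 0 < C₁)
    (h : ∀ t ∈ Icc 0 T, ∀ x, |timeDeriv T E t x| ≤ C₁ * E t x + C₂) {s t : ℝ} (hs : s ∈ Icc 0 T)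
    (ht : t ∈ Icc 0 T) (hst : s ≤ t) (x : X) :
    E t x + C₂ / C₁ ≤ Real.exp (C₁ * (t - s)) * (E s x + C₂ / C₁) ∧
      E s x + C₂ / C₁ ≤ Real.exp (C₁ * (t - s)) * (E t x + C₂ / C₁) := by
  have hc : ContinuousOn (fun τ => E τ x) (Icc 0 T) := (hreg.differentiableOn x).continuousOn
  have hd : ∀ (a τ : ℝ), τ ∈ interior (Icc 0 T) →
      HasDerivAt (fun τ => Real.exp (a * τ) * (E τ x + C₂ / C₁))
        (Real.exp (a * τ) * (a * 1) * (E τ x + C₂ / C₁) +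
          Real.exp (a * τ) * timeDeriv T E τ x) τ := by
    intro a τ hτ
    rw [interior_Icc] at hτ
    exact ((hasDerivAt_id τ).const_mul a).exp.mul ((hreg.hasDerivAt hτ x).add_const _)
  have hb : ∀ τ ∈ interior (Icc 0 T), |timeDeriv T E τ x| ≤ C₁ * (E τ x + C₂ / C₁) := by
    intro τ hτ
    have := h τ (interior_subset hτ) x
    rwa [mul_add, mul_div_cancel₀ _ hC₁.ne']
  have hcont : ∀ a : ℝ, ContinuousOn (fun τ => Real.exp (a * τ) * (E τ x + C₂ / C₁)) (Icc 0 T) :=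
    fun a => (by fun_prop : Continuous fun τ : ℝ => Real.exp (a * τ)).continuousOn.mul
      (hc.add continuousOn_const)
  have hanti : AntitoneOn (fun τ => Real.exp (-C₁ * τ) * (E τ x + C₂ / C₁)) (Icc 0 T) := by
    refine antitoneOn_of_deriv_nonpos (convex_Icc 0 T) (hcont _)
      (fun τ hτ => (hd _ τ hτ).differentiableAt.differentiableWithinAt) fun τ hτ => ?_
    rw [(hd _ τ hτ).deriv, mul_assoc, ← mul_add]
    refine mul_nonpos_of_nonneg_of_nonpos (Real.exp_pos _).le ?_
    linarith [le_of_abs_le (hb τ hτ)]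
  have hmono : MonotoneOn (fun τ => Real.exp (C₁ * τ) * (E τ x + C₂ / C₁)) (Icc 0 T) := by
    refine monotoneOn_of_deriv_nonneg (convex_Icc 0 T) (hcont _)
      (fun τ hτ => (hd _ τ hτ).differentiableAt.differentiableWithinAt) fun τ hτ => ?_
    rw [(hd _ τ hτ).deriv, mul_assoc, ← mul_add]
    refine mul_nonneg (Real.exp_pos _).le ?_
    linarith [neg_le_of_abs_le (hb τ hτ)]
  have h1 := hanti hs ht hst
  have h2 := hmono hs ht hst
  simp only at h1 h2
  constructor
  · have := mul_le_mul_of_nonneg_left h1 (Real.exp_pos (C₁ * t)).le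
    rw [← mul_assoc, ← mul_assoc, ← Real.exp_add, ← Real.exp_add] at this
    ring_nf at this ⊢
    simpa using this
  · have := mul_le_mul_of_nonneg_left h2 (Real.exp_pos (-C₁ * s)).le
    rw [← mul_assoc, ← mul_assoc, ← Real.exp_add, ← Real.exp_add] at this
    ring_nf at this ⊢
    simpa using this

/-- The supremum is not a junk value: energies are continuous on the compact set of times. -/
theorem le_of_mem_sublevel (hreg : EnergyRegular T E) {C : ℝ} {x : X}
    (hx : ⨆ t : Icc (0 : ℝ) T, |E t x| ≤ C) (t : Icc (0 : ℝ) T) : |E t x| ≤ C := by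
  refine le_trans (le_ciSup (f := fun t : Icc (0 : ℝ) T => |E t x|) ?_ t) hx
  have hc : Continuous fun t : Icc (0 : ℝ) T => |E t x| :=
    ((continuous_energy hreg).comp (f := fun t : Icc (0 : ℝ) T => (t, x)) (by fun_prop)).abs
  exact (isCompact_range hc).bddAbove

end Energy

/-! ### The quotient space is Hausdorff -/

section Quotient

variable {X : Type*} [MetricSpace X] {T : ℝ} {E : ℝ → X → ℝ}

theorem cls_eq_iff {s t : Icc (0 : ℝ) T} {x y : X} :
    cls T E s x = cls T E t y ↔ s = t ∧ (x = y ∨ JoinedIn (crit E t) x y) := by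
  refine Quotient.eq.trans ?_
  constructor
  · rintro (h | ⟨h, h'⟩)
    · rw [Prod.mk.injEq] at h
      exact ⟨h.1, Or.inl h.2⟩
    · obtain rfl : s = t := h
      exact ⟨rfl, Or.inr h'⟩
  · rintro ⟨rfl, rfl | h⟩
    · exact Or.inl rfl
    · exact Or.inr ⟨rfl, h⟩

theorem cls_eq_iff_of_mem {t : Icc (0 : ℝ) T} {x y : X} (hx : x ∈ crit E t) :
    cls T E t x = cls T E t y ↔ JoinedIn (crit E t) x y := by
  rw [cls_eq_iff]
  constructor
  · rintro ⟨-, rfl | h⟩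
    · exact JoinedIn.refl hx
    · exact h
  · exact fun h => ⟨rfl, Or.inr h⟩

theorem continuous_cls : Continuous fun p : Icc (0 : ℝ) T × X => cls T E p.1 p.2 :=
  continuous_quotient_mk'

theorem tendsto_cls {ι : Type*} {l : Filter ι} {s : ι → Icc (0 : ℝ) T} {y : ι → X}
    {t : Icc (0 : ℝ) T} {x : X} (hs : Tendsto s l (𝓝 t)) (hy : Tendsto y l (𝓝 x)) :
    Tendsto (fun i => cls T E (s i) (y i)) l (𝓝 (cls T E t x)) :=
  continuous_cls.continuousAt.tendsto.comp (hs.prodMk_nhds hy)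

/-- A component of critical points has an open neighbourhood whose boundary contains no critical
points, also at nearby times. -/
theorem CriticalComponents.exists_isolating [LocallyCompactSpace X] (hcomp : CriticalComponents T E)
    (hreg : EnergyRegular T E) {t : Icc (0 : ℝ) T} {x : X} (hx : x ∈ crit E t) :
    ∃ U : Set X, IsOpen U ∧ critClass E t x ⊆ U ∧ closure U ∩ crit E t ⊆ critClass E t x ∧
      ∀ᶠ s : Icc (0 : ℝ) T in 𝓝 t, ∀ y ∈ frontier U, y ∉ crit E s := by
  obtain ⟨hK, ⟨r, hr, hsep⟩, -⟩ := hcomp.exists_separation t.2 hx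
  obtain ⟨U, hU, hKU, hUth, hUc⟩ := exists_open_between_and_isCompact_closure hK
    Metric.isOpen_thickening (Metric.self_subset_thickening hr _)
  have hcl : closure U ∩ crit E t ⊆ critClass E t x := by
    rintro z ⟨hz, hzc⟩
    obtain ⟨y, hy, hyz⟩ := Metric.mem_thickening_iff.1 (hUth hz)
    exact hsep y hy z hzc (by rwa [dist_comm])
  refine ⟨U, hU, hKU, hcl, ?_⟩
  have hfr : IsCompact (frontier U) := hUc.of_isClosed_subset isClosed_frontier
    frontier_subset_closure
  refine hfr.eventually_forall_of_forall_eventually (x₀ := t)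
    (P := fun (s : Icc (0 : ℝ) T) y => y ∉ crit E s) fun y hy => ?_
  have hne : (descSlope E t y).toReal ≠ 0 := by
    intro h0
    have h1 := hcl ⟨frontier_subset_closure hy, (mem_crit_iff_toReal hreg t.2).2 h0⟩
    rw [hU.frontier_eq] at hy
    exact hy.2 (hKU h1)
  filter_upwards [(continuous_slope hreg).continuousAt.eventually_ne (x := (t, y)) hne] with p hp h
  exact hp ((mem_crit_iff_toReal hreg p.1.2).1 h)

/-- A path in `F` cannot leave a set whose boundary does not meet `F`. -/
theorem JoinedIn.mem_iff_of_frontier {F U : Set X} {y z : X} (h : JoinedIn F y z)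
    (hU : ∀ w ∈ frontier U, w ∉ F) (hy : y ∈ U) : z ∈ U := by
  have hpre := isPreconnected_range h.somePath.continuous
  have hmem : ∀ w ∈ F, w ∈ interior U ∨ w ∈ (closure U)ᶜ := by
    intro w hw
    by_cases hwc : w ∈ closure U
    · left
      by_contra hwi
      exact hU w ⟨hwc, hwi⟩ hw
    · exact Or.inr hwc
  by_contra hz
  have hyi : y ∈ interior U := (hmem y h.source_mem).resolve_right fun h' => h' (subset_closure hy)
  have hzc : z ∈ (closure U)ᶜ :=
    (hmem z h.target_mem).resolve_left fun h' => hz (interior_subset h')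
  obtain ⟨w, -, hwi, hwc⟩ := hpre (interior U) (closure U)ᶜ isOpen_interior
    isClosed_closure.isOpen_compl (by rintro _ ⟨s, rfl⟩; exact hmem _ (h.somePath_mem s))
    ⟨y, ⟨0, h.somePath.source⟩, hyi⟩ ⟨z, ⟨1, h.somePath.target⟩, hzc⟩
  exact hwc (subset_closure (interior_subset hwi))

/-- Open saturated sets have open images in the quotient space. -/
theorem isOpen_image_cls {A : Set (Icc (0 : ℝ) T × X)} (hA : IsOpen A)
    (hsat : ∀ s y z, (s, y) ∈ A → JoinedIn (crit E s) y z → (s, z) ∈ A) :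
    IsOpen ((fun p : Icc (0 : ℝ) T × X => cls T E p.1 p.2) '' A) := by
  refine isOpen_coinduced.2 ?_
  convert hA
  ext ⟨s, y⟩
  constructor
  · rintro ⟨⟨s', y'⟩, h, h'⟩
    obtain ⟨rfl, rfl | h''⟩ := cls_eq_iff.1 h'
    · exact h
    · exact hsat _ _ _ h h''
  · exact fun h => ⟨_, h, rfl⟩

/-- Points of different times, or of different slopes, are separated by the time and the slope, which
are continuous on the quotient; noncritical points are separated in `X`, and different components at
the same time by isolating neighbourhoods. -/
theorem t2Space_quotSpace [LocallyCompactSpace X] (hcomp : CriticalComponents T E)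
    (hreg : EnergyRegular T E) : T2Space (QuotSpace T E) := by
  -- it suffices to find disjoint open saturated sets
  have key : ∀ (t t' : Icc (0 : ℝ) T) (x x' : X), (∃ A B : Set (Icc (0 : ℝ) T × X),
      IsOpen A ∧ IsOpen B ∧ (t, x) ∈ A ∧ (t', x') ∈ B ∧ Disjoint A B ∧
      (∀ s y z, (s, y) ∈ A → JoinedIn (crit E s) y z → (s, z) ∈ A) ∧
      (∀ s y z, (s, y) ∈ B → JoinedIn (crit E s) y z → (s, z) ∈ B)) →
      ∃ u v : Set (QuotSpace T E), IsOpen u ∧ IsOpen v ∧ cls T E t x ∈ u ∧ cls T E t' x' ∈ v ∧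
        Disjoint u v := by
    rintro t t' x x' ⟨A, B, hA, hB, hxA, hxB, hAB, hsA, hsB⟩
    refine ⟨_, _, isOpen_image_cls hA hsA, isOpen_image_cls hB hsB, ⟨_, hxA, rfl⟩, ⟨_, hxB, rfl⟩,
      ?_⟩
    rw [Set.disjoint_left]
    rintro _ ⟨⟨s, y⟩, hy, rfl⟩ ⟨⟨s', y'⟩, hy', h⟩
    obtain ⟨rfl, rfl | h'⟩ := cls_eq_iff.1 h
    · exact Set.disjoint_left.1 hAB hy hy'
    · exact Set.disjoint_left.1 hAB hy (hsB _ _ _ hy' h')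
  have hslope := continuous_slope hreg
  have hinv : ∀ (s : Icc (0 : ℝ) T) (y z : X), JoinedIn (crit E s) y z →
      (descSlope E s y).toReal = (descSlope E s z).toReal := fun s y z h =>
    ((mem_crit_iff_toReal hreg s.2).1 h.source_mem).trans
      ((mem_crit_iff_toReal hreg s.2).1 h.target_mem).symm
  refine ⟨fun p q => ?_⟩
  induction p using Quotient.inductionOn with | _ p
  induction q using Quotient.inductionOn with | _ q
  obtain ⟨t, x⟩ := p
  obtain ⟨t', x'⟩ := q
  intro hne
  refine key t t' x x' ?_
  by_cases htt : t = t'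
  swap
  · obtain ⟨u, v, hu, hv, htu, htv, huv⟩ := t2_separation htt
    exact ⟨Prod.fst ⁻¹' u, Prod.fst ⁻¹' v, hu.preimage continuous_fst, hv.preimage continuous_fst,
      htu, htv, huv.preimage _, fun _ _ _ h _ => h, fun _ _ _ h _ => h⟩
  subst htt
  by_cases hsl : (descSlope E t x).toReal = (descSlope E t x').toReal
  swap
  · obtain ⟨u, v, hu, hv, htu, htv, huv⟩ := t2_separation hsl
    refine ⟨_, _, hu.preimage hslope, hv.preimage hslope, htu, htv, huv.preimage _, ?_, ?_⟩
    · intro s y z h hyz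
      simpa only [mem_preimage, hinv s y z hyz] using h
    · intro s y z h hyz
      simpa only [mem_preimage, hinv s y z hyz] using h
  have hne' : cls T E t x ≠ cls T E t x' := hne
  by_cases hx : x ∈ crit E t
  · have hx' : x' ∈ crit E t := by
      rw [mem_crit_iff_toReal hreg t.2] at hx ⊢
      rw [← hsl, hx]
    obtain ⟨U, hU, hKU, hcl, hev⟩ := hcomp.exists_isolating hreg hx
    obtain ⟨V, hV, hVo, htV⟩ := eventually_nhds_iff.1 hev
    have hev' : ∀ s ∈ V, ∀ y ∈ frontier (closure U)ᶜ, y ∉ crit E s := by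
      intro s hs y hy
      rw [frontier_compl] at hy
      exact hV s hs y (frontier_closure_subset hy)
    refine ⟨V ×ˢ U, V ×ˢ (closure U)ᶜ, hVo.prod hU, hVo.prod isClosed_closure.isOpen_compl,
      ⟨htV, hKU (mem_critClass_self hx)⟩, ⟨htV, fun h => ?_⟩, ?_, ?_, ?_⟩
    · exact hne' ((cls_eq_iff_of_mem hx).2 (hcl ⟨h, hx'⟩))
    · rw [Set.disjoint_left]
      rintro ⟨s, y⟩ h h'
      exact h'.2 (subset_closure h.2)
    · exact fun s y z h hyz => ⟨h.1, JoinedIn.mem_iff_of_frontier hyz (hV s h.1) h.2⟩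
    · exact fun s y z h hyz => ⟨h.1, JoinedIn.mem_iff_of_frontier hyz (hev' s h.1) h.2⟩
  · have hx' : x' ∉ crit E t := by
      rw [mem_crit_iff_toReal hreg t.2] at hx ⊢
      rwa [← hsl]
    have hxx : x ≠ x' := fun h => hne' (by rw [h])
    obtain ⟨u, v, hu, hv, htu, htv, huv⟩ := t2_separation hxx
    have hopen : IsOpen {p : Icc (0 : ℝ) T × X | p.2 ∉ crit E p.1} := by
      have : {p : Icc (0 : ℝ) T × X | p.2 ∉ crit E p.1} =
          {p : Icc (0 : ℝ) T × X | (descSlope E p.1 p.2).toReal ≠ 0} := by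
        ext p
        exact not_congr (mem_crit_iff_toReal hreg p.1.2)
      rw [this]
      exact isOpen_ne_fun hslope continuous_const
    refine ⟨_, _, (hu.preimage continuous_snd).inter hopen, (hv.preimage continuous_snd).inter hopen,
      ⟨htu, hx⟩, ⟨htv, hx'⟩, ?_, ?_, ?_⟩
    · exact (huv.preimage _).mono inter_subset_left inter_subset_left
    · exact fun s y z h hyz => absurd hyz.source_mem h.2
    · exact fun s y z h hyz => absurd hyz.source_mem h.2

end Quotient

/-! ### Discrete evolutions -/

section Discrete

/-- The index of the state of the discrete evolution at time `t`. -/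
noncomputable def stepIndex (T δ t : ℝ) : ℕ := min ⌊t / δ⌋₊ (numSteps T δ)

theorem numSteps_mul_lt {T δ : ℝ} (hT : 0 < T) (hδ : 0 < δ) : numSteps T δ * δ < T := by
  rw [← lt_div_iff₀ hδ, numSteps]
  have hpos : 0 < T / δ := div_pos hT hδ
  split_ifs with h
  · have h1 : 1 ≤ ⌊T / δ⌋₊ := by
      by_contra hlt
      have : ⌊T / δ⌋₊ = 0 := by omega
      rw [this, Nat.cast_zero] at h
      exact hpos.ne h
    rw [Nat.cast_sub h1, Nat.cast_one, h]
    linarith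
  · exact lt_of_le_of_ne (Nat.floor_le hpos.le) h

theorem le_numSteps_add_one_mul {T δ : ℝ} (hδ : 0 < δ) : T ≤ (numSteps T δ + 1) * δ := by
  rw [← div_le_iff₀ hδ, numSteps]
  split_ifs with h
  · calc T / δ = (⌊T / δ⌋₊ : ℝ) := h.symm
      _ ≤ ((⌊T / δ⌋₊ - 1 + 1 : ℕ) : ℝ) := Nat.cast_le.2 (by omega)
      _ = _ := by push_cast; ring
  · exact (Nat.lt_floor_add_one _).le

theorem stepIndex_le_numSteps (T δ t : ℝ) : stepIndex T δ t ≤ numSteps T δ := min_le_right _ _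

theorem stepIndex_mul_le {T δ t : ℝ} (hδ : 0 < δ) (ht : 0 ≤ t) : stepIndex T δ t * δ ≤ t := by
  rw [← le_div_iff₀ hδ]
  exact (Nat.cast_le.2 (min_le_left _ _)).trans (Nat.floor_le (div_nonneg ht hδ.le))

theorem le_stepIndex_iff {T δ t : ℝ} (hδ : 0 < δ) (ht : 0 ≤ t) {k : ℕ} :
    k ≤ stepIndex T δ t ↔ k ≤ numSteps T δ ∧ k * δ ≤ t := by
  rw [stepIndex, le_min_iff, and_comm, Nat.le_floor_iff (div_nonneg ht hδ.le), le_div_iff₀ hδ]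

theorem le_stepIndex_add_one_mul {T δ t : ℝ} (hδ : 0 < δ) (htT : t ≤ T) :
    t ≤ (stepIndex T δ t + 1) * δ := by
  rcases min_choice ⌊t / δ⌋₊ (numSteps T δ) with h | h
  · rw [stepIndex, h, ← div_le_iff₀ hδ]
    exact (Nat.lt_floor_add_one _).le
  · rw [stepIndex, h]
    exact htT.trans (le_numSteps_add_one_mul hδ)

theorem stepIndex_mono {T δ : ℝ} (hδ : 0 < δ) {s t : ℝ} (hst : s ≤ t) :
    stepIndex T δ s ≤ stepIndex T δ t :=
  min_le_min_right _ (Nat.floor_mono (div_le_div_of_nonneg_right hst hδ.le))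

theorem stepIndex_eq {T δ t : ℝ} (hδ : 0 < δ) {k : ℕ} (hk : k ≤ numSteps T δ) (h : k * δ ≤ t)
    (h' : t < (k + 1) * δ) : stepIndex T δ t = k := by
  have : ⌊t / δ⌋₊ = k := by
    rw [Nat.floor_eq_iff (div_nonneg ((mul_nonneg k.cast_nonneg hδ.le).trans h) hδ.le)]
    exact ⟨(le_div_iff₀ hδ).2 h, (div_lt_iff₀ hδ).2 h'⟩
  rw [stepIndex, this, min_eq_left hk]

variable {X : Type*} {T : ℝ} {E : ℝ → X → ℝ} {ω : ℝ → X → X} {x₀ : X}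

theorem evolution_eq (δ : ℝ) (t : Icc (0 : ℝ) T) :
    evolution T ω x₀ δ t = states ω δ x₀ (stepIndex T δ t) := rfl

theorem step_mem_Icc (hT : 0 < T) {δ : ℝ} (hδ : 0 < δ) {k : ℕ} (hk : k ≤ numSteps T δ) :
    (k : ℝ) * δ ∈ Icc 0 T :=
  ⟨by positivity, (mul_le_mul_of_nonneg_right (Nat.cast_le.2 hk) hδ.le).trans
    (numSteps_mul_lt hT hδ).le⟩

/-- The energy drop of the discrete evolution at time `(k + 1) * δ`. -/
def drop (E : ℝ → X → ℝ) (ω : ℝ → X → X) (x₀ : X) (δ : ℝ) (k : ℕ) : ℝ :=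
  E ((k + 1 : ℕ) * δ) (states ω δ x₀ k) - E ((k + 1 : ℕ) * δ) (states ω δ x₀ (k + 1))

theorem drop_nonneg (hω : AxiomDecreasing T E ω) (hT : 0 < T) {δ : ℝ} (hδ : 0 < δ) {k : ℕ}
    (hk : k < numSteps T δ) : 0 ≤ drop E ω x₀ δ k :=
  sub_nonneg.2 (hω _ (step_mem_Icc hT hδ hk) _)

variable [MetricSpace X]

theorem states_mem_crit (hω : AxiomCritical T E ω) (hx₀ : x₀ ∈ crit E 0) (hT : 0 < T) {δ : ℝ}
    (hδ : 0 < δ) {k : ℕ} (hk : k ≤ numSteps T δ) : states ω δ x₀ k ∈ crit E (k * δ) := by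
  cases k with
  | zero => simpa [states] using hx₀
  | succ k => exact hω _ (step_mem_Icc hT hδ hk) _

/-- The discrete evolution is critical at the last step before `t`. -/
theorem exists_evolution_mem_crit (hω : AxiomCritical T E ω) (hx₀ : x₀ ∈ crit E 0) (hT : 0 < T)
    {δ : ℝ} (hδ : 0 < δ) (t : Icc (0 : ℝ) T) :
    ∃ s : Icc (0 : ℝ) T, dist s t ≤ δ ∧ evolution T ω x₀ δ t ∈ crit E s := by
  refine ⟨⟨_, step_mem_Icc hT hδ (stepIndex_le_numSteps T δ t)⟩, ?_,
    states_mem_crit hω hx₀ hT hδ (stepIndex_le_numSteps T δ t)⟩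
  rw [Subtype.dist_eq, Real.dist_eq, abs_sub_comm, abs_of_nonneg]
  · have := le_stepIndex_add_one_mul hδ t.2.2
    simp only
    linarith
  · have := stepIndex_mul_le (T := T) hδ t.2.1
    simp only
    linarith

/-- All states of all discrete evolutions lie in one compact set, by Grönwall's inequality. -/
theorem exists_isCompact_evolution_mem (hT : 0 < T) (hreg : EnergyRegular T E)
    (hpow : PowerControl T E) (hcoer : Coercive T E) (hω : AxiomDecreasing T E ω) (x₀ : X) :
    ∃ K : Set X, IsCompact K ∧ (∀ δ > 0, ∀ t, evolution T ω x₀ δ t ∈ K) ∧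
      ∃ B > 0, ∀ t ∈ Icc 0 T, ∀ x ∈ K, |timeDeriv T E t x| ≤ B ∧ |E t x| ≤ B := by
  obtain ⟨C₁, hC₁, C₂, hC₂, hle⟩ := hpow
  set k := C₂ / C₁ with hk
  have hkpos : 0 < k := div_pos hC₂ hC₁
  have hnn : ∀ t ∈ Icc 0 T, ∀ x, 0 ≤ E t x + k := by
    intro t ht x
    have h1 := (abs_nonneg _).trans (hle t ht x)
    have h2 : C₁ * E t x + C₂ = C₁ * (E t x + k) := by rw [mul_add, hk, mul_div_cancel₀ _ hC₁.ne']
    rw [h2] at h1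
    exact nonneg_of_mul_nonneg_right h1 hC₁
  have h0 : (0 : ℝ) ∈ Icc 0 T := ⟨le_rfl, hT.le⟩
  set R := Real.exp (C₁ * T) * (Real.exp (C₁ * T) * (E 0 x₀ + k)) + k with hR
  have hstates : ∀ δ > 0, ∀ i ≤ numSteps T δ,
      E (i * δ) (states ω δ x₀ i) + k ≤ Real.exp (C₁ * (i * δ)) * (E 0 x₀ + k) := by
    intro δ hδ i
    induction i with
    | zero => simp [states]
    | succ i ih =>
      intro hi
      have hi' := step_mem_Icc hT hδ (Nat.le_of_succ_le hi)
      have hi1 := step_mem_Icc hT hδ hi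
      have hlt : (i : ℝ) * δ ≤ (i + 1 : ℕ) * δ := by gcongr; exact i.le_succ
      have h1 := (energy_gronwall hreg hC₁ hle hi' hi1 hlt (states ω δ x₀ i)).1
      have h2 : E ((i + 1 : ℕ) * δ) (states ω δ x₀ (i + 1)) ≤
        E ((i + 1 : ℕ) * δ) (states ω δ x₀ i) := hω _ hi1 _
      calc _ ≤ E ((i + 1 : ℕ) * δ) (states ω δ x₀ i) + k := by linarith
        _ ≤ _ := h1
        _ ≤ Real.exp (C₁ * ((i + 1 : ℕ) * δ - i * δ)) *
            (Real.exp (C₁ * (i * δ)) * (E 0 x₀ + k)) := by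
          gcongr; exact ih (Nat.le_of_succ_le hi)
        _ = _ := by rw [← mul_assoc, ← Real.exp_add]; ring_nf
  refine ⟨{x | ⨆ t : Icc (0 : ℝ) T, |E t x| ≤ R}, hcoer R, fun δ hδ t => ?_,
    max (C₁ * R + C₂) R, ?_, fun t ht x hx => ?_⟩
  · rw [evolution_eq]
    have hi := stepIndex_le_numSteps T δ t
    have hmem := step_mem_Icc hT hδ hi
    have : Nonempty (Icc (0 : ℝ) T) := ⟨⟨0, h0⟩⟩
    refine ciSup_le (α := ℝ)
      (f := fun s : Icc (0 : ℝ) T => |E s (states ω δ x₀ (stepIndex T δ t))|) fun s => ?_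
    have hstep : E (stepIndex T δ t * δ) (states ω δ x₀ (stepIndex T δ t)) + k ≤
        Real.exp (C₁ * T) * (E 0 x₀ + k) := by
      refine (hstates δ hδ _ hi).trans ?_
      gcongr
      · exact hnn 0 h0 x₀
      · exact hmem.2
    have hgr : E s (states ω δ x₀ (stepIndex T δ t)) + k ≤ Real.exp (C₁ * T) *
        (E (stepIndex T δ t * δ) (states ω δ x₀ (stepIndex T δ t)) + k) := by
      rcases le_total (s : ℝ) (stepIndex T δ t * δ) with h | h
      · refine (energy_gronwall hreg hC₁ hle s.2 hmem h _).2.trans ?_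
        gcongr
        · exact hnn _ hmem _
        · linarith [s.2.1, hmem.2]
      · refine (energy_gronwall hreg hC₁ hle hmem s.2 h _).1.trans ?_
        gcongr
        · exact hnn _ hmem _
        · linarith [s.2.2, hmem.1]
    have hfin := hgr.trans (mul_le_mul_of_nonneg_left hstep (Real.exp_pos _).le)
    have h00 : 0 ≤ Real.exp (C₁ * T) * (Real.exp (C₁ * T) * (E 0 x₀ + k)) := by
      have := hnn 0 h0 x₀
      positivity
    rw [abs_le, hR]
    constructor
    · linarith [hnn s s.2 (states ω δ x₀ (stepIndex T δ t))]
    · linarith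
  · refine lt_max_of_lt_right ?_
    have := hnn 0 h0 x₀
    positivity
  · have hE := le_of_mem_sublevel hreg hx ⟨t, ht⟩
    refine ⟨((hle t ht x).trans ?_).trans (le_max_left _ _), hE.trans (le_max_right _ _)⟩
    gcongr
    exact (le_abs_self _).trans hE

/-- The power along the discrete evolution, as a function of a real time. -/
noncomputable def realPower (T : ℝ) (E : ℝ → X → ℝ) (ω : ℝ → X → X) (x₀ : X) (δ τ : ℝ) : ℝ :=
  timeDeriv T E τ (states ω δ x₀ (stepIndex T δ τ))

theorem integral_realPower_step (hT : 0 < T) (hreg : EnergyRegular T E) {δ : ℝ} (hδ : 0 < δ)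
    {k : ℕ} (hk : k ≤ numSteps T δ) {b : ℝ} (hb : k * δ ≤ b) (hb' : b ≤ (k + 1) * δ)
    (hbT : b ≤ T) :
    IntervalIntegrable (realPower T E ω x₀ δ) volume (k * δ) b ∧
      ∫ τ in (k * δ)..b, realPower T E ω x₀ δ τ =
        E b (states ω δ x₀ k) - E (k * δ) (states ω δ x₀ k) := by
  obtain ⟨hi, hint⟩ := hreg.integral_timeDeriv (step_mem_Icc hT hδ hk).1 hb hbT (states ω δ x₀ k)
  have hae : ∀ᵐ τ ∂volume, τ ∈ uIoc (k * δ) b →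
      timeDeriv T E τ (states ω δ x₀ k) = realPower T E ω x₀ δ τ := by
    filter_upwards [compl_mem_ae_iff.2 (measure_singleton b)] with τ hτ hmem
    rw [uIoc_of_le hb] at hmem
    have : τ < b := hmem.2.lt_of_ne hτ
    rw [realPower, stepIndex_eq hδ hk hmem.1.le (this.trans_le hb')]
  refine ⟨?_, ?_⟩
  · exact hi.congr_ae ((ae_restrict_iff' measurableSet_uIoc).2 hae)
  · rw [← hint]
    exact (intervalIntegral.integral_congr_ae hae).symm

theorem integral_realPower (hT : 0 < T) (hreg : EnergyRegular T E) {δ : ℝ} (hδ : 0 < δ)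
    {t : ℝ} (ht : t ∈ Icc 0 T) :
    E t (states ω δ x₀ (stepIndex T δ t)) = E 0 x₀ + (∫ τ in (0 : ℝ)..t, realPower T E ω x₀ δ τ) -
      ∑ k ∈ Finset.range (stepIndex T δ t), drop E ω x₀ δ k := by
  have hstep : ∀ k ≤ numSteps T δ,
      IntervalIntegrable (realPower T E ω x₀ δ) volume 0 (k * δ) ∧
      E (k * δ) (states ω δ x₀ k) = E 0 x₀ + (∫ τ in (0 : ℝ)..(k * δ), realPower T E ω x₀ δ τ) -
        ∑ k ∈ Finset.range k, drop E ω x₀ δ k := by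
    intro k
    induction k with
    | zero => simp [states]
    | succ k ih =>
      intro hk
      obtain ⟨h1, h2⟩ := ih (Nat.le_of_succ_le hk)
      obtain ⟨h3, h4⟩ := integral_realPower_step (ω := ω) (x₀ := x₀) hT hreg hδ
        (Nat.le_of_succ_le hk) (b := (k + 1 : ℕ) * δ)
        (by gcongr; exact k.le_succ) (by push_cast; rfl) (step_mem_Icc hT hδ hk).2
      refine ⟨h1.trans h3, ?_⟩
      rw [← intervalIntegral.integral_add_adjacent_intervals h1 h3, h4, Finset.sum_range_succ, drop]
      linarith
  obtain ⟨h1, h2⟩ := hstep _ (stepIndex_le_numSteps T δ t)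
  obtain ⟨h3, h4⟩ := integral_realPower_step (ω := ω) (x₀ := x₀) hT hreg hδ
    (stepIndex_le_numSteps T δ t) (stepIndex_mul_le hδ ht.1) (le_stepIndex_add_one_mul hδ ht.2) ht.2
  rw [← intervalIntegral.integral_add_adjacent_intervals h1 h3, h4]
  linarith

end Discrete

/-! ### Lebesgue measure on `[0, T]` -/

section Leb

variable {T : ℝ}

theorem map_val_leb (T : ℝ) : (leb T).map Subtype.val = volume.restrict (Icc 0 T) := by
  rw [leb, (MeasurableEmbedding.subtype_coe measurableSet_Icc).map_comap, Subtype.range_coe]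

theorem leb_preimage {s : Set ℝ} (hs : MeasurableSet s) :
    leb T (Subtype.val ⁻¹' s) = volume (s ∩ Icc 0 T) := by
  rw [← Measure.map_apply measurable_subtype_coe hs, map_val_leb, Measure.restrict_apply hs]

instance : IsFiniteMeasure (leb T) := by
  refine ⟨?_⟩
  rw [← preimage_univ, leb_preimage MeasurableSet.univ, univ_inter, Real.volume_Icc]
  exact ENNReal.ofReal_lt_top

theorem leb_real_Ioc {s t : Icc (0 : ℝ) T} (hst : s ≤ t) : (leb T).real (Ioc s t) = t - s := by
  have h : (Ioc s t) = Subtype.val ⁻¹' Ioc (s : ℝ) t := rfl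
  rw [Measure.real, h, leb_preimage measurableSet_Ioc, inter_eq_left.2, Real.volume_Ioc,
    ENNReal.toReal_ofReal (sub_nonneg.2 hst)]
  exact fun x hx => ⟨s.2.1.trans hx.1.le, hx.2.trans t.2.2⟩

instance : NullSingletonClass (leb T) := by
  refine ⟨fun t => ?_⟩
  have h : ({t} : Set (Icc (0 : ℝ) T)) = Subtype.val ⁻¹' {(t : ℝ)} := by
    ext s; simp [Subtype.ext_iff]
  rw [h, leb_preimage (measurableSet_singleton _)]
  exact measure_mono_null inter_subset_left Real.volume_singleton

theorem setIntegral_leb_Iic (F : ℝ → ℝ) (t : Icc (0 : ℝ) T) :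
    ∫ τ in Iic t, F τ ∂(leb T) = ∫ τ in (0 : ℝ)..t, F τ := by
  have h : (Iic t) = Subtype.val ⁻¹' Iic (t : ℝ) := rfl
  rw [h, ← (MeasurableEmbedding.subtype_coe measurableSet_Icc).setIntegral_map, map_val_leb,
    Measure.restrict_restrict measurableSet_Iic, intervalIntegral.integral_of_le t.2.1,
    ← integral_Icc_eq_integral_Ioc]
  congr 2
  ext x
  exact ⟨fun h => ⟨h.2.1, h.1⟩, fun h => ⟨h.2, h.1, h.2.trans t.2.2⟩⟩

end Leb

section Power

variable {X : Type*} [MetricSpace X] {T : ℝ} {E : ℝ → X → ℝ} {ω : ℝ → X → X} {x₀ : X}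

theorem measurable_powerAlong (hreg : EnergyRegular T E) (δ : ℝ) :
    Measurable (powerAlong E (evolution T ω x₀ δ)) := by
  have h1 : Measurable fun p : Icc (0 : ℝ) T × ℕ => timeDeriv T E p.1 (states ω δ x₀ p.2) :=
    measurable_from_prod_countable_left fun k => ((continuous_timeDeriv hreg).comp
      (f := fun t : Icc (0 : ℝ) T => (t, states ω δ x₀ k)) (by fun_prop)).measurable
  have h2 : Measurable fun t : Icc (0 : ℝ) T => (t, stepIndex T δ t) := by
    refine measurable_id.prodMk ?_
    exact (Nat.measurable_floor.comp (measurable_subtype_coe.div_const δ)).min measurable_const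
  exact h1.comp h2

/-- The discrete energy balance, with the energy drops as a sum. -/
theorem energyAlong_evolution (hT : 0 < T) (hreg : EnergyRegular T E) {δ : ℝ} (hδ : 0 < δ)
    (t : Icc (0 : ℝ) T) :
    energyAlong E (evolution T ω x₀ δ) t =
      E 0 x₀ + (∫ τ in Iic t, powerAlong E (evolution T ω x₀ δ) τ ∂(leb T)) -
        ∑ k ∈ Finset.range (stepIndex T δ t), drop E ω x₀ δ k := by
  have h := setIntegral_leb_Iic (realPower T E ω x₀ δ) t
  exact (integral_realPower hT hreg hδ t.2).trans (by rw [← h]; rfl)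

theorem integrable_powerAlong (hreg : EnergyRegular T E) {δ B : ℝ}
    (hB : ∀ t, |powerAlong E (evolution T ω x₀ δ) t| ≤ B) :
    Integrable (powerAlong E (evolution T ω x₀ δ)) (leb T) :=
  Integrable.of_bound (measurable_powerAlong hreg δ).aestronglyMeasurable B
    (Eventually.of_forall hB)

theorem setIntegral_Iic_sub {f : Icc (0 : ℝ) T → ℝ} (hf : Integrable f (leb T))
    {s t : Icc (0 : ℝ) T} (hst : s ≤ t) :
    (∫ τ in Iic t, f τ ∂(leb T)) - (∫ τ in Iic s, f τ ∂(leb T)) = ∫ τ in Ioc s t, f τ ∂(leb T) := by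
  rw [← Iic_union_Ioc_eq_Iic hst, setIntegral_union _ measurableSet_Ioc hf.integrableOn
    hf.integrableOn, add_sub_cancel_left]
  exact Set.disjoint_left.2 fun u hu hu' => (hu'.1.trans_le hu).false

theorem abs_setIntegral_Ioc_le {f : Icc (0 : ℝ) T → ℝ} {B : ℝ} (hB : ∀ᵐ t ∂(leb T), |f t| ≤ B)
    {s t : Icc (0 : ℝ) T} (hst : s ≤ t) : |∫ τ in Ioc s t, f τ ∂(leb T)| ≤ B * (t - s) := by
  rw [← leb_real_Ioc hst, ← Real.norm_eq_abs]
  refine norm_setIntegral_le_of_norm_le_const_ae (measure_lt_top _ _) ?_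
  filter_upwards [ae_restrict_of_ae hB] with τ hτ using hτ

/-- The total energy drop between two times is the loss of energy up to the work done. -/
theorem abs_sum_drop_sub_le (hT : 0 < T) (hreg : EnergyRegular T E) {δ B : ℝ} (hδ : 0 < δ)
    (hB : ∀ t, |powerAlong E (evolution T ω x₀ δ) t| ≤ B) {s t : Icc (0 : ℝ) T} (hst : s ≤ t) :
    |∑ k ∈ Finset.Ico (stepIndex T δ s) (stepIndex T δ t), drop E ω x₀ δ k -
      (energyAlong E (evolution T ω x₀ δ) s - energyAlong E (evolution T ω x₀ δ) t)| ≤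
      B * (t - s) := by
  have h1 := setIntegral_Iic_sub (integrable_powerAlong hreg hB) hst
  have h2 := abs_setIntegral_Ioc_le (Eventually.of_forall hB) hst
  rw [Finset.sum_Ico_eq_sub _ (stepIndex_mono hδ hst), energyAlong_evolution hT hreg hδ s,
    energyAlong_evolution hT hreg hδ t]
  rw [← h1] at h2
  convert h2 using 2
  ring

/-- Up to a linear function, the energy along the discrete evolution is nonincreasing. -/
theorem energyAlong_sub_le (hT : 0 < T) (hreg : EnergyRegular T E) (hω : AxiomDecreasing T E ω)
    {δ B : ℝ} (hδ : 0 < δ) (hB : ∀ t, |powerAlong E (evolution T ω x₀ δ) t| ≤ B)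
    {s t : Icc (0 : ℝ) T} (hst : s ≤ t) : energyAlong E (evolution T ω x₀ δ) t -
      energyAlong E (evolution T ω x₀ δ) s ≤ B * (t - s) := by
  have h := neg_le_of_abs_le (abs_sum_drop_sub_le hT hreg hδ hB hst)
  have h2 : 0 ≤ ∑ k ∈ Finset.Ico (stepIndex T δ s) (stepIndex T δ t), drop E ω x₀ δ k :=
    Finset.sum_nonneg fun k hk => drop_nonneg hω hT hδ
      ((Finset.mem_Ico.1 hk).2.trans_le (stepIndex_le_numSteps _ _ _))
  have h3 := le_of_abs_le (abs_sum_drop_sub_le (ω := ω) (x₀ := x₀) hT hreg hδ hB hst)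
  linarith

end Power

/-! ### The measure of energy drops -/

section DropMeasure

variable {X : Type*} [MetricSpace X] {T : ℝ} {E : ℝ → X → ℝ} {ω : ℝ → X → X} {x₀ : X}

/-- The time `(k + 1) * δ` as a point of `[0, T]`, for `k < numSteps T δ`. -/
noncomputable def jumpTime (hT : 0 < T) (δ : ℝ) (k : ℕ) : Icc (0 : ℝ) T :=
  projIcc 0 T hT.le ((k + 1 : ℕ) * δ)

theorem coe_jumpTime (hT : 0 < T) {δ : ℝ} (hδ : 0 < δ) {k : ℕ} (hk : k < numSteps T δ) :
    (jumpTime hT δ k : ℝ) = (k + 1 : ℕ) * δ := by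
  rw [jumpTime, projIcc_of_mem hT.le (step_mem_Icc hT hδ hk)]

theorem jumpTime_le_iff (hT : 0 < T) {δ : ℝ} (hδ : 0 < δ) {k : ℕ} (hk : k < numSteps T δ)
    (t : Icc (0 : ℝ) T) : jumpTime hT δ k ≤ t ↔ k < stepIndex T δ t := by
  rw [← Subtype.coe_le_coe, coe_jumpTime hT hδ hk, ← Nat.succ_le_iff, le_stepIndex_iff hδ t.2.1]
  exact ⟨fun h => ⟨hk, h⟩, fun h => h.2⟩

theorem jumpTime_mem_Ioc (hT : 0 < T) {δ : ℝ} (hδ : 0 < δ) {s t : Icc (0 : ℝ) T} {k : ℕ}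
    (hk : k ∈ Finset.Ico (stepIndex T δ s) (stepIndex T δ t)) :
    k < numSteps T δ ∧ jumpTime hT δ k ∈ Ioc s t := by
  rw [Finset.mem_Ico] at hk
  have hk' := hk.2.trans_le (stepIndex_le_numSteps T δ t)
  refine ⟨hk', ?_, (jumpTime_le_iff hT hδ hk' t).2 hk.2⟩
  rw [← not_le, jumpTime_le_iff hT hδ hk' s]
  exact not_lt.2 hk.1

theorem leftLim_energyAlong (hT : 0 < T) (hreg : EnergyRegular T E) {δ : ℝ} (hδ : 0 < δ) {k : ℕ}
    (hk : k < numSteps T δ) :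
    Function.leftLim (energyAlong E (evolution T ω x₀ δ)) (jumpTime hT δ k) =
      E ((k + 1 : ℕ) * δ) (states ω δ x₀ k) := by
  have hpos : (⟨0, le_rfl, hT.le⟩ : Icc (0 : ℝ) T) < jumpTime hT δ k := by
    rw [← Subtype.coe_lt_coe, coe_jumpTime hT hδ hk]
    have : (0 : ℝ) < (k + 1 : ℕ) := by positivity
    exact mul_pos this hδ
  have hne : (𝓝[<] (jumpTime hT δ k)).NeBot := nhdsLT_neBot_of_exists_lt ⟨_, hpos⟩
  apply leftLim_eq_of_tendsto
  have hc : Tendsto (fun s : Icc (0 : ℝ) T => E s (states ω δ x₀ k)) (𝓝[<] (jumpTime hT δ k))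
      (𝓝 (E (jumpTime hT δ k) (states ω δ x₀ k))) :=
    (((continuous_energy hreg).comp (f := fun s : Icc (0 : ℝ) T => (s, states ω δ x₀ k))
      (by fun_prop)).tendsto _).mono_left nhdsWithin_le_nhds
  rw [coe_jumpTime hT hδ hk] at hc
  refine hc.congr' ?_
  have hlt : ∀ᶠ s : Icc (0 : ℝ) T in 𝓝 (jumpTime hT δ k), (k : ℝ) * δ < s := by
    refine continuous_subtype_val.continuousAt.eventually (lt_mem_nhds ?_)
    rw [coe_jumpTime hT hδ hk]
    gcongr
    exact k.lt_succ_self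
  filter_upwards [self_mem_nhdsWithin, mem_nhdsWithin_of_mem_nhds hlt] with s hs hs'
  have hs1 : (s : ℝ) < (k + 1) * δ := by
    have := Subtype.coe_lt_coe.2 (show s < jumpTime hT δ k from hs)
    rwa [coe_jumpTime hT hδ hk, Nat.cast_succ] at this
  rw [energyAlong, evolution_eq, stepIndex_eq hδ hk.le hs'.le hs1]

theorem rightLim_energyAlong (hT : 0 < T) (hreg : EnergyRegular T E) {δ : ℝ} (hδ : 0 < δ) {k : ℕ}
    (hk : k < numSteps T δ) :
    Function.rightLim (energyAlong E (evolution T ω x₀ δ)) (jumpTime hT δ k) =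
      E ((k + 1 : ℕ) * δ) (states ω δ x₀ (k + 1)) := by
  have hpos : jumpTime hT δ k < (⟨T, hT.le, le_rfl⟩ : Icc (0 : ℝ) T) := by
    rw [← Subtype.coe_lt_coe, coe_jumpTime hT hδ hk]
    exact (mul_le_mul_of_nonneg_right (Nat.cast_le.2 hk) hδ.le).trans_lt (numSteps_mul_lt hT hδ)
  have hne : (𝓝[>] (jumpTime hT δ k)).NeBot := nhdsGT_neBot_of_exists_gt ⟨_, hpos⟩
  apply rightLim_eq_of_tendsto
  have hc : Tendsto (fun s : Icc (0 : ℝ) T => E s (states ω δ x₀ (k + 1)))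
      (𝓝[>] (jumpTime hT δ k)) (𝓝 (E (jumpTime hT δ k) (states ω δ x₀ (k + 1)))) :=
    (((continuous_energy hreg).comp (f := fun s : Icc (0 : ℝ) T => (s, states ω δ x₀ (k + 1)))
      (by fun_prop)).tendsto _).mono_left nhdsWithin_le_nhds
  rw [coe_jumpTime hT hδ hk] at hc
  refine hc.congr' ?_
  have hlt : ∀ᶠ s : Icc (0 : ℝ) T in 𝓝 (jumpTime hT δ k), (s : ℝ) < ((k + 1 : ℕ) + 1) * δ := by
    refine continuous_subtype_val.continuousAt.eventually (gt_mem_nhds ?_)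
    rw [coe_jumpTime hT hδ hk]
    gcongr
    exact lt_add_one _
  filter_upwards [self_mem_nhdsWithin, mem_nhdsWithin_of_mem_nhds hlt] with s hs hs'
  have hs1 : (k + 1 : ℕ) * δ ≤ s := by
    have := Subtype.coe_le_coe.2 (show jumpTime hT δ k < s from hs).le
    rwa [coe_jumpTime hT hδ hk] at this
  rw [energyAlong, evolution_eq, stepIndex_eq hδ hk hs1 hs']

theorem dropMeasure_eq (hT : 0 < T) (hreg : EnergyRegular T E) {δ : ℝ} (hδ : 0 < δ) :
    dropMeasure T E ω x₀ δ = ∑ k ∈ Finset.range (numSteps T δ),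
      ENNReal.ofReal (drop E ω x₀ δ k) • Measure.dirac (jumpTime hT δ k) := by
  let f : Fin (numSteps T δ) → jumpTimes T δ := fun k =>
    ⟨jumpTime hT δ k, k + 1, by omega, k.2, coe_jumpTime hT hδ k.2⟩
  have hf : Function.Bijective f := by
    constructor
    · intro j k hjk
      have h : (jumpTime hT δ j : ℝ) = jumpTime hT δ k :=
        congrArg (fun z : jumpTimes T δ => ((z : Icc (0 : ℝ) T) : ℝ)) hjk
      rw [coe_jumpTime hT hδ j.2, coe_jumpTime hT hδ k.2] at h
      have := Nat.cast_injective (R := ℝ) (mul_right_cancel₀ hδ.ne' h)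
      exact Fin.ext (by omega)
    · rintro ⟨t, i, hi, hiM, ht⟩
      refine ⟨⟨i - 1, by omega⟩, Subtype.ext (Subtype.ext ?_)⟩
      simp only [f]
      rw [coe_jumpTime hT hδ (by omega), ht, Nat.sub_add_cancel hi]
  ext s hs
  rw [dropMeasure, Measure.sum_apply _ hs, ← (Equiv.ofBijective f hf).tsum_eq, tsum_fintype,
    Measure.coe_finsetSum, Finset.sum_apply, Finset.sum_range]
  refine Finset.sum_congr rfl fun k _ => ?_
  simp only [Equiv.ofBijective_apply, f]
  rw [leftLim_energyAlong hT hreg hδ k.2, rightLim_energyAlong hT hreg hδ k.2, drop]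

theorem isFiniteMeasure_dropMeasure (hT : 0 < T) (hreg : EnergyRegular T E) {δ : ℝ} (hδ : 0 < δ) :
    IsFiniteMeasure (dropMeasure T E ω x₀ δ) := by
  rw [dropMeasure_eq hT hreg hδ]
  refine ⟨?_⟩
  rw [Measure.coe_finsetSum, Finset.sum_apply]
  refine ENNReal.sum_lt_top.2 fun k _ => ?_
  simp

theorem integral_dropMeasure (hT : 0 < T) (hreg : EnergyRegular T E) (hω : AxiomDecreasing T E ω)
    {δ : ℝ} (hδ : 0 < δ) (f : Icc (0 : ℝ) T → ℝ) :
    ∫ t, f t ∂(dropMeasure T E ω x₀ δ) =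
      ∑ k ∈ Finset.range (numSteps T δ), drop E ω x₀ δ k * f (jumpTime hT δ k) := by
  rw [dropMeasure_eq hT hreg hδ, integral_finsetSum_measure]
  · refine Finset.sum_congr rfl fun k hk => ?_
    rw [integral_smul_measure, integral_dirac,
      ENNReal.toReal_ofReal (drop_nonneg hω hT hδ (Finset.mem_range.1 hk)), smul_eq_mul]
  · intro k _
    exact (integrable_dirac (by simp)).smul_measure ENNReal.ofReal_ne_top

theorem dropMeasure_real_Iic (hT : 0 < T) (hreg : EnergyRegular T E) (hω : AxiomDecreasing T E ω)
    {δ : ℝ} (hδ : 0 < δ) (t : Icc (0 : ℝ) T) :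
    (dropMeasure T E ω x₀ δ).real (Iic t) =
      ∑ k ∈ Finset.range (stepIndex T δ t), drop E ω x₀ δ k := by
  rw [← integral_indicator_one measurableSet_Iic, integral_dropMeasure hT hreg hω hδ]
  have hsub : Finset.range (stepIndex T δ t) ⊆ Finset.range (numSteps T δ) :=
    Finset.range_mono (stepIndex_le_numSteps T δ t)
  symm
  refine Finset.sum_subset_zero_on_sdiff hsub (fun k hk => ?_) fun k hk => ?_
  · rw [Finset.mem_sdiff, Finset.mem_range, Finset.mem_range] at hk
    rw [indicator_of_notMem, mul_zero]
    exact fun h => hk.2 ((jumpTime_le_iff hT hδ hk.1 t).1 h)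
  · have hk' := Finset.mem_range.1 hk
    rw [indicator_of_mem, Pi.one_apply, mul_one]
    exact (jumpTime_le_iff hT hδ (hk'.trans_le (stepIndex_le_numSteps T δ t)) t).2 hk'

/-- The discrete energy balance, with the energy drops as a measure. -/
theorem energyAlong_eq (hT : 0 < T) (hreg : EnergyRegular T E) (hω : AxiomDecreasing T E ω)
    {δ : ℝ} (hδ : 0 < δ) (t : Icc (0 : ℝ) T) :
    energyAlong E (evolution T ω x₀ δ) t =
      E 0 x₀ + (∫ τ in Iic t, powerAlong E (evolution T ω x₀ δ) τ ∂(leb T)) -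
        (dropMeasure T E ω x₀ δ).real (Iic t) := by
  rw [energyAlong_evolution hT hreg hδ, dropMeasure_real_Iic hT hreg hω hδ]

/-- The drops at the steps in `(s, t]` are counted by any test function that is at least `1` there. -/
theorem sum_drop_le_integral (hT : 0 < T) (hreg : EnergyRegular T E) (hω : AxiomDecreasing T E ω)
    {δ : ℝ} (hδ : 0 < δ) {s t : Icc (0 : ℝ) T} {f : Icc (0 : ℝ) T → ℝ} (h0 : ∀ u, 0 ≤ f u)
    (h1 : ∀ u ∈ Ioc s t, 1 ≤ f u) :
    ∑ k ∈ Finset.Ico (stepIndex T δ s) (stepIndex T δ t), drop E ω x₀ δ k ≤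
      ∫ u, f u ∂(dropMeasure T E ω x₀ δ) := by
  rw [integral_dropMeasure hT hreg hω hδ]
  have hsub : Finset.Ico (stepIndex T δ s) (stepIndex T δ t) ⊆ Finset.range (numSteps T δ) :=
    fun k hk => Finset.mem_range.2 (jumpTime_mem_Ioc hT hδ hk).1
  refine le_trans (Finset.sum_le_sum fun k hk => ?_) (Finset.sum_le_sum_of_subset_of_nonneg hsub
    fun k hk _ => mul_nonneg (drop_nonneg hω hT hδ (Finset.mem_range.1 hk)) (h0 _))
  obtain ⟨hk1, hk2⟩ := jumpTime_mem_Ioc hT hδ hk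
  exact le_mul_of_one_le_right (drop_nonneg hω hT hδ hk1) (h1 _ hk2)

end DropMeasure

/-! ### Weak-* convergence of measures on `[0, T]` -/

section WeakStar

variable {T : ℝ}

theorem WeakStarMeasure.tendsto_real_univ {μ : ℕ → Measure (Icc (0 : ℝ) T)}
    {μbar : Measure (Icc (0 : ℝ) T)} (h : WeakStarMeasure μ μbar) :
    Tendsto (fun n => (μ n).real univ) atTop (𝓝 (μbar.real univ)) := by
  simpa using h (ContinuousMap.const _ 1)

theorem integrable_continuousMap {μ : Measure (Icc (0 : ℝ) T)} [IsFiniteMeasure μ]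
    (f : C(Icc (0 : ℝ) T, ℝ)) : Integrable f μ := by
  obtain ⟨C, hC⟩ := isCompact_univ.exists_bound_of_continuousOn f.continuous.continuousOn
  exact Integrable.of_bound f.continuous.aestronglyMeasurable C
    (Eventually.of_forall fun t => hC t (mem_univ t))

/-- A continuous function that is `1` on `(-∞, a]` and `0` on `[b, ∞)`. -/
noncomputable def ramp (T a b : ℝ) : C(Icc (0 : ℝ) T, ℝ) :=
  ⟨fun s => max 0 (min 1 ((b - s) / (b - a))), by fun_prop⟩

theorem ramp_bounds {a b : ℝ} (hab : a < b) {μ : Measure (Icc (0 : ℝ) T)} [IsFiniteMeasure μ] :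
    μ.real {s | (s : ℝ) ≤ a} ≤ ∫ s, ramp T a b s ∂μ ∧
      ∫ s, ramp T a b s ∂μ ≤ μ.real {s | (s : ℝ) ≤ b} := by
  have hmeas : ∀ c : ℝ, MeasurableSet {s : Icc (0 : ℝ) T | (s : ℝ) ≤ c} := fun c =>
    measurableSet_le measurable_subtype_coe measurable_const
  have hind : ∀ c : ℝ, Integrable ({s : Icc (0 : ℝ) T | (s : ℝ) ≤ c}.indicator
      (1 : Icc (0 : ℝ) T → ℝ)) μ :=
    fun c => (integrable_const (1 : ℝ)).indicator (hmeas c)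
  have hba : 0 < b - a := sub_pos.2 hab
  constructor
  · rw [← integral_indicator_one (hmeas a)]
    refine integral_mono (hind a) (integrable_continuousMap _) fun s => ?_
    by_cases hs : (s : ℝ) ≤ a
    · rw [indicator_of_mem (show s ∈ {s : Icc (0 : ℝ) T | (s : ℝ) ≤ a} from hs)]
      refine le_max_of_le_right (le_min le_rfl ?_)
      rw [Pi.one_apply, one_le_div hba]
      linarith
    · rw [indicator_of_notMem (show s ∉ {s : Icc (0 : ℝ) T | (s : ℝ) ≤ a} from hs)]
      exact le_max_left _ _
  · rw [← integral_indicator_one (hmeas b)]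
    refine integral_mono (integrable_continuousMap _) (hind b) fun s => ?_
    by_cases hs : (s : ℝ) ≤ b
    · rw [indicator_of_mem (show s ∈ {s : Icc (0 : ℝ) T | (s : ℝ) ≤ b} from hs)]
      exact max_le zero_le_one (min_le_left _ _)
    · rw [indicator_of_notMem (show s ∉ {s : Icc (0 : ℝ) T | (s : ℝ) ≤ b} from hs)]
      refine max_le le_rfl ((min_le_right _ _).trans ?_)
      exact div_nonpos_of_nonpos_of_nonneg (by linarith) hba.le

theorem tendsto_real_Iic_right {μ : Measure (Icc (0 : ℝ) T)} [IsFiniteMeasure μ]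
    (t : Icc (0 : ℝ) T) :
    Tendsto (fun n : ℕ => μ.real {s | (s : ℝ) ≤ t + 1 / (n + 1)}) atTop (𝓝 (μ.real (Iic t))) := by
  have hmeas : ∀ c : ℝ, MeasurableSet {s : Icc (0 : ℝ) T | (s : ℝ) ≤ c} := fun c =>
    measurableSet_le measurable_subtype_coe measurable_const
  have h : Tendsto (fun n : ℕ => μ {s | (s : ℝ) ≤ t + 1 / (n + 1)}) atTop (𝓝 (μ (Iic t))) := by
    convert! tendsto_measure_iInter_atTop (μ := μ)
      (s := fun n : ℕ => {s : Icc (0 : ℝ) T | (s : ℝ) ≤ t + 1 / (n + 1)})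
      (fun n => (hmeas _).nullMeasurableSet) ?_ ⟨0, measure_ne_top _ _⟩ using 3
    · ext s
      rw [mem_iInter, mem_Iic, ← Subtype.coe_le_coe]
      refine ⟨fun hs n => hs.trans ?_, fun hs => ?_⟩
      · have : (0 : ℝ) < 1 / (n + 1) := by positivity
        linarith
      · refine ge_of_tendsto' (x := atTop) ?_ hs
        simpa using (tendsto_one_div_add_atTop_nhds_zero_nat (𝕜 := ℝ)).const_add (t : ℝ)
    · intro m n hmn s hs
      have h1 : (1 : ℝ) / (n + 1) ≤ 1 / (m + 1) := by gcongr
      have h2 : (s : ℝ) ≤ t + 1 / (n + 1) := hs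
      exact show (s : ℝ) ≤ t + 1 / (m + 1) by linarith
  exact (ENNReal.tendsto_toReal (measure_ne_top _ _)).comp h

theorem tendsto_real_Iic_left {μ : Measure (Icc (0 : ℝ) T)} [IsFiniteMeasure μ]
    (t : Icc (0 : ℝ) T) :
    Tendsto (fun n : ℕ => μ.real {s | (s : ℝ) ≤ t - 1 / (n + 1)}) atTop (𝓝 (μ.real (Iio t))) := by
  have h : Tendsto (fun n : ℕ => μ {s | (s : ℝ) ≤ t - 1 / (n + 1)}) atTop (𝓝 (μ (Iio t))) := by
    convert! tendsto_measure_iUnion_atTop (μ := μ)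
      (s := fun n : ℕ => {s : Icc (0 : ℝ) T | (s : ℝ) ≤ t - 1 / (n + 1)}) ?_ using 3
    · ext s
      rw [mem_iUnion, mem_Iio, ← Subtype.coe_lt_coe]
      refine ⟨fun hs => ?_, fun ⟨n, hs⟩ => ?_⟩
      · obtain ⟨n, hn⟩ := exists_nat_one_div_lt (sub_pos.2 hs)
        exact ⟨n, by simp only [mem_ofPred_eq]; linarith⟩
      · have : (0 : ℝ) < 1 / (n + 1) := by positivity
        have hs' : (s : ℝ) ≤ t - 1 / (n + 1) := hs
        linarith
    · intro m n hmn s hs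
      have h1 : (1 : ℝ) / (n + 1) ≤ 1 / (m + 1) := by gcongr
      have h2 : (s : ℝ) ≤ t - 1 / (m + 1) := hs
      exact show (s : ℝ) ≤ t - 1 / (n + 1) by linarith
  exact (ENNReal.tendsto_toReal (measure_ne_top _ _)).comp h

/-- Weak-* convergence implies convergence of the distribution functions off the atoms, by comparison
with piecewise affine functions. -/
theorem WeakStarMeasure.tendsto_real_Iic {μ : ℕ → Measure (Icc (0 : ℝ) T)}
    [∀ n, IsFiniteMeasure (μ n)] {μbar : Measure (Icc (0 : ℝ) T)} [IsFiniteMeasure μbar]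
    (h : WeakStarMeasure μ μbar) {t : Icc (0 : ℝ) T} (ht : μbar {t} = 0) :
    Tendsto (fun n => (μ n).real (Iic t)) atTop (𝓝 (μbar.real (Iic t))) := by
  have hIio : μbar.real (Iio t) = μbar.real (Iic t) := by
    rw [Measure.real, Measure.real, ← Iio_insert, insert_eq]
    congr 1
    refine le_antisymm (measure_mono subset_union_right) ((measure_union_le _ _).trans ?_)
    rw [ht, zero_add]
  rw [tendsto_order]
  constructor
  · intro a ha
    rw [← hIio] at ha
    obtain ⟨k, hk⟩ := ((tendsto_real_Iic_left t).eventually (lt_mem_nhds ha)).exists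
    have hpos : (0 : ℝ) < 1 / (k + 1) := by positivity
    have hlt : (t : ℝ) - 1 / (k + 1) < t := by linarith
    filter_upwards [(h (ramp T (t - 1 / (k + 1)) t)).eventually
      (lt_mem_nhds (hk.trans_le (ramp_bounds hlt).1))] with n hn
    exact hn.trans_le (ramp_bounds hlt).2
  · intro a ha
    obtain ⟨k, hk⟩ := ((tendsto_real_Iic_right t).eventually (gt_mem_nhds ha)).exists
    have hpos : (0 : ℝ) < 1 / (k + 1) := by positivity
    have hlt : (t : ℝ) < t + 1 / (k + 1) := by linarith
    filter_upwards [(h (ramp T t (t + 1 / (k + 1)))).eventually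
      (gt_mem_nhds ((ramp_bounds hlt).2.trans_lt hk))] with n hn
    exact (ramp_bounds hlt).1.trans_lt hn

/-- A continuous function that is `1` at distance at most `κ` from `t` and `0` at distance at least
`2 * κ`. -/
noncomputable def tent (t : Icc (0 : ℝ) T) (κ : ℝ) : C(Icc (0 : ℝ) T, ℝ) :=
  ⟨fun s => max 0 (min 1 (2 - dist s t / κ)), by fun_prop⟩

theorem integral_tent_le {μ : Measure (Icc (0 : ℝ) T)} [IsFiniteMeasure μ] (t : Icc (0 : ℝ) T)
    {κ : ℝ} (hκ : 0 < κ) : ∫ s, tent t κ s ∂μ ≤ μ.real (Metric.cthickening (2 * κ) {t}) := by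
  have hm : MeasurableSet (Metric.cthickening (2 * κ) {t}) := Metric.isClosed_cthickening.measurableSet
  rw [← integral_indicator_one hm]
  refine integral_mono (integrable_continuousMap _) ((integrable_const (1 : ℝ)).indicator hm)
    fun s => ?_
  by_cases hs : dist s t ≤ 2 * κ
  · have hmem : s ∈ Metric.cthickening (2 * κ) {t} :=
      Metric.mem_cthickening_of_dist_le s t _ _ (mem_singleton t) hs
    rw [indicator_of_mem hmem]
    exact max_le zero_le_one (min_le_left _ _)
  · refine le_trans (max_le le_rfl ((min_le_right _ _).trans ?_))
      (indicator_nonneg (fun _ _ => zero_le_one) s)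
    rw [sub_nonpos, le_div_iff₀ hκ]
    exact (not_le.1 hs).le

end WeakStar

/-! ### Time-stable actions control the limits of discrete evolutions -/

section Action

variable {X : Type*} [MetricSpace X] {T : ℝ} {E : ℝ → X → ℝ} {ω : ℝ → X → X} {x₀ : X}
variable {c : ℝ → X → X → ℝ}

theorem AxiomTimeStable.decreasing (h : AxiomTimeStable T E ω c) : AxiomDecreasing T E ω := by
  intro t ht x
  have h1 := h.compatible t ht x
  have h2 := h.action.nonneg t ht x (ω t x)
  linarith

theorem tendsto_energyAlong (hreg : EnergyRegular T E) {η : ℕ → Icc (0 : ℝ) T → X}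
    {s : ℕ → Icc (0 : ℝ) T} {t : Icc (0 : ℝ) T} {x : X} (hs : Tendsto s atTop (𝓝 t))
    (hx : Tendsto (fun n => η n (s n)) atTop (𝓝 x)) :
    Tendsto (fun n => energyAlong E (η n) (s n)) atTop (𝓝 (E t x)) :=
  (continuous_energy hreg).continuousAt.tendsto.comp (hs.prodMk_nhds hx)

/-- The total energy drop along collapsing time intervals converges to the energy difference of the
limits. -/
theorem tendsto_sum_drop (hT : 0 < T) (hreg : EnergyRegular T E) {δ : ℕ → ℝ} (hδ : ∀ n, 0 < δ n)
    {B : ℝ} (hB : ∀ n t, |powerAlong E (evolution T ω x₀ (δ n)) t| ≤ B)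
    {t : Icc (0 : ℝ) T} {t₁ t₂ : ℕ → Icc (0 : ℝ) T} {x₁ x₂ : X} (h₁ : Tendsto t₁ atTop (𝓝 t))
    (h₂ : Tendsto t₂ atTop (𝓝 t)) (h₁₂ : ∀ n, t₁ n ≤ t₂ n)
    (hx₁ : Tendsto (fun n => evolution T ω x₀ (δ n) (t₁ n)) atTop (𝓝 x₁))
    (hx₂ : Tendsto (fun n => evolution T ω x₀ (δ n) (t₂ n)) atTop (𝓝 x₂)) :
    Tendsto (fun n => ∑ k ∈ Finset.Ico (stepIndex T (δ n) (t₁ n)) (stepIndex T (δ n) (t₂ n)),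
      drop E ω x₀ (δ n) k) atTop (𝓝 (E t x₁ - E t x₂)) := by
  have he := (tendsto_energyAlong hreg h₁ hx₁).sub (tendsto_energyAlong hreg h₂ hx₂)
  have h0 : Tendsto (fun n => B * ((t₂ n : ℝ) - t₁ n)) atTop (𝓝 0) := by
    have := (((continuous_subtype_val.tendsto t).comp h₂).sub
      ((continuous_subtype_val.tendsto t).comp h₁)).const_mul B
    simpa using this
  have hd := squeeze_zero_norm (fun n => (Real.norm_eq_abs _).trans_le
    (abs_sum_drop_sub_le hT hreg (hδ n) (hB n) (h₁₂ n))) h0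
  simpa using hd.add he

/-- The limits of the discrete evolution along collapsing times are connected at no other cost than
the energy that is lost. -/
theorem AxiomTimeStable.action_le (h : AxiomTimeStable T E ω c) (hT : 0 < T)
    (hreg : EnergyRegular T E) {δ : ℕ → ℝ} (hδ : ∀ n, 0 < δ n)
    {K : Set X} (hK : IsCompact K) (hmem : ∀ δ > 0, ∀ t, evolution T ω x₀ δ t ∈ K)
    {B : ℝ} (hB : ∀ n t, |powerAlong E (evolution T ω x₀ (δ n)) t| ≤ B)
    {t : Icc (0 : ℝ) T} {t₁ t₂ : ℕ → Icc (0 : ℝ) T} {x₁ x₂ : X} (h₁ : Tendsto t₁ atTop (𝓝 t))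
    (h₂ : Tendsto t₂ atTop (𝓝 t)) (h₁₂ : ∀ n, t₁ n ≤ t₂ n)
    (hx₁ : Tendsto (fun n => evolution T ω x₀ (δ n) (t₁ n)) atTop (𝓝 x₁))
    (hx₂ : Tendsto (fun n => evolution T ω x₀ (δ n) (t₂ n)) atTop (𝓝 x₂))
    (hcrit : x₁ ∈ crit E t) : c t x₁ x₂ ≤ E t x₁ - E t x₂ := by
  rcases eq_or_ne x₁ x₂ with rfl | hne
  · rw [sub_self, (h.zero_iff t t.2 _ hcrit _ hcrit).2 (JoinedIn.refl hcrit)]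
  have hsum := tendsto_sum_drop hT hreg hδ hB h₁ h₂ h₁₂ hx₁ hx₂
  refine le_of_forall_pos_le_add fun ε hε => ?_
  by_contra! hlt
  obtain ⟨Δ, hΔ, hst⟩ := h.stable (ε / 2) (half_pos hε) (|E t x₁ - E t x₂| + 1) (by positivity)
    t t.2 K hK
  have hlsc := h.action.lsc t t.2 (x₁, x₂) _ hlt
  have hne' := (hx₁.prodMk_nhds hx₂).eventually (isOpen_ne_fun (continuous_fst (X := X) (Y := X))
    continuous_snd |>.mem_nhds hne)
  have hlt1 : E t x₁ - E t x₂ < E t x₁ - E t x₂ + ε / 2 := by linarith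
  have hlt2 : E t x₁ - E t x₂ < |E t x₁ - E t x₂| + 1 := by
    linarith [le_abs_self (E t x₁ - E t x₂)]
  obtain ⟨n, hn1, hn2, hn3, hn4, hn5, hn6⟩ := (((hx₁.prodMk_nhds hx₂).eventually hlsc).and
    (hne'.and ((h₁.eventually (Metric.ball_mem_nhds t hΔ)).and
    ((h₂.eventually (Metric.ball_mem_nhds t hΔ)).and
    ((hsum.eventually (gt_mem_nhds hlt1)).and (hsum.eventually (gt_mem_nhds hlt2))))))).exists
  set k := stepIndex T (δ n) (t₁ n) with hk
  set l := stepIndex T (δ n) (t₂ n) with hl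
  have hkl : k ≤ l := stepIndex_mono (hδ n) (h₁₂ n)
  have hkl' : k ≠ l := fun heq => hn2 (by
    change states ω (δ n) x₀ (stepIndex T (δ n) (t₁ n)) =
      states ω (δ n) x₀ (stepIndex T (δ n) (t₂ n))
    rw [← hk, ← hl, heq])
  have hlM : l ≤ numSteps T (δ n) := stepIndex_le_numSteps _ _ _
  have hmemK : ∀ i ≤ l, states ω (δ n) x₀ i ∈ K := by
    intro i hi
    have hi' := hi.trans hlM
    have := hmem (δ n) (hδ n) ⟨i * δ n, step_mem_Icc hT (hδ n) hi'⟩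
    rwa [evolution_eq, stepIndex_eq (hδ n) hi' le_rfl (by
      rw [add_one_mul]; linarith [hδ n])] at this
  have hchain : ∑ i ∈ Finset.range (l - k), c ((k + i + 1 : ℕ) * δ n)
      (states ω (δ n) x₀ (k + i)) (states ω (δ n) x₀ (k + (i + 1))) =
      ∑ i ∈ Finset.Ico k l, drop E ω x₀ (δ n) i := by
    rw [Finset.sum_Ico_eq_sum_range]
    refine Finset.sum_congr rfl fun i hi => ?_
    have hi' : k + i + 1 ≤ numSteps T (δ n) := by
      have := Finset.mem_range.1 hi
      omega
    exact (h.compatible _ (step_mem_Icc hT (hδ n) hi') _).symm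
  have key := hst (l - k) (fun i => states ω (δ n) x₀ (k + i)) (fun i => (k + i + 1 : ℕ) * δ n)
    (by omega) (fun i hi => hmemK _ (by omega)) (fun i hi => by
      have hi' : k + i + 1 ≤ numSteps T (δ n) := by omega
      refine ⟨step_mem_Icc hT (hδ n) hi', ?_⟩
      have hj := (jumpTime_mem_Ioc hT (hδ n) (s := t₁ n) (t := t₂ n) (k := k + i)
        (Finset.mem_Ico.2 ⟨by omega, by omega⟩)).2
      have hj1 := Subtype.coe_le_coe.2 hj.1.le
      have hj2 := Subtype.coe_le_coe.2 hj.2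
      rw [coe_jumpTime hT (hδ n) hi'] at hj1 hj2
      rw [Subtype.dist_eq, Real.dist_eq, abs_lt] at hn3 hn4
      exact ⟨by linarith [hn3.1], by linarith [hn4.2]⟩)
    (hchain.trans_le hn6.le)
  have hkey : c t (states ω (δ n) x₀ k) (states ω (δ n) x₀ (k + (l - k))) ≤
      ∑ i ∈ Finset.Ico k l, drop E ω x₀ (δ n) i + ε / 2 := hchain ▸ key
  rw [Nat.add_sub_cancel' hkl] at hkey
  have hn1' : E t x₁ - E t x₂ + ε < c t (states ω (δ n) x₀ k) (states ω (δ n) x₀ l) := hn1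
  linarith

/-- The energy that is lost along collapsing times is charged by the limit measure. -/
theorem WeakStarMeasure.energy_sub_le (hT : 0 < T) (hreg : EnergyRegular T E)
    (hω : AxiomDecreasing T E ω) {δ : ℕ → ℝ} (hδ : ∀ n, 0 < δ n)
    {B : ℝ} (hB : ∀ n t, |powerAlong E (evolution T ω x₀ (δ n)) t| ≤ B)
    {μbar : Measure (Icc (0 : ℝ) T)} [IsFiniteMeasure μbar]
    (hμ : WeakStarMeasure (fun n => dropMeasure T E ω x₀ (δ n)) μbar)
    {t : Icc (0 : ℝ) T} {t₁ t₂ : ℕ → Icc (0 : ℝ) T} {x₁ x₂ : X} (h₁ : Tendsto t₁ atTop (𝓝 t))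
    (h₂ : Tendsto t₂ atTop (𝓝 t)) (h₁₂ : ∀ n, t₁ n ≤ t₂ n)
    (hx₁ : Tendsto (fun n => evolution T ω x₀ (δ n) (t₁ n)) atTop (𝓝 x₁))
    (hx₂ : Tendsto (fun n => evolution T ω x₀ (δ n) (t₂ n)) atTop (𝓝 x₂)) :
    E t x₁ - E t x₂ ≤ μbar.real {t} := by
  have hsum := tendsto_sum_drop hT hreg hδ hB h₁ h₂ h₁₂ hx₁ hx₂
  have hle : ∀ κ > 0, E t x₁ - E t x₂ ≤ μbar.real (Metric.cthickening (2 * κ) {t}) := by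
    intro κ hκ
    refine le_trans ?_ (integral_tent_le t hκ)
    refine le_of_tendsto_of_tendsto hsum (hμ (tent t κ)) ?_
    filter_upwards [h₁.eventually (Metric.ball_mem_nhds t hκ),
      h₂.eventually (Metric.ball_mem_nhds t hκ)] with n hn1 hn2
    refine sum_drop_le_integral hT hreg hω (hδ n) (fun u => le_max_left _ _) fun u hu => ?_
    refine le_max_of_le_right (le_min le_rfl ?_)
    have hd : dist u t ≤ κ := by
      rw [Subtype.dist_eq, Real.dist_eq, abs_lt] at hn1 hn2
      rw [Subtype.dist_eq, Real.dist_eq, abs_le]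
      have h3 := Subtype.coe_le_coe.2 hu.1.le
      have h4 := Subtype.coe_le_coe.2 hu.2
      exact ⟨by linarith [hn1.1], by linarith [hn2.2]⟩
    have := (div_le_one hκ).2 hd
    linarith
  have hlim : Tendsto (fun κ : ℝ => μbar.real (Metric.cthickening (2 * κ) {t})) (𝓝[>] 0)
      (𝓝 (μbar.real {t})) := by
    have h1 := tendsto_measure_cthickening_of_isClosed (μ := μbar) (s := {t})
      ⟨1, one_pos, measure_ne_top _ _⟩ isClosed_singleton
    have h2 : Tendsto (fun κ : ℝ => 2 * κ) (𝓝[>] 0) (𝓝 0) := by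
      have : Tendsto (fun κ : ℝ => 2 * κ) (𝓝 0) (𝓝 (2 * 0)) := tendsto_id.const_mul 2
      rw [mul_zero] at this
      exact this.mono_left nhdsWithin_le_nhds
    exact (ENNReal.tendsto_toReal (measure_ne_top _ _)).comp (h1.comp h2)
  refine ge_of_tendsto hlim ?_
  filter_upwards [self_mem_nhdsWithin] with κ hκ using hle κ hκ

/-- The action of the two limit points serves as the constant in the axiom: it is positive because they
lie in different components. -/
theorem AxiomTimeStable.axiomLimits (h : AxiomTimeStable T E ω c) (hT : 0 < T)
    (hreg : EnergyRegular T E) (hpow : PowerControl T E) (hcoer : Coercive T E) (x₀ : X) :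
    AxiomLimits T E ω x₀ := by
  intro δ hδ _ _ μbar Ebar D hconv t t₁ t₂ x₁ x₂ h₁ h₂ h₁₂ hx₁ hx₂ hc₁ hc₂ hJ
  obtain ⟨K, hK, hmem, B, -, hB⟩ :=
    exists_isCompact_evolution_mem hT hreg hpow hcoer h.decreasing x₀
  have hB' : ∀ n t, |powerAlong E (evolution T ω x₀ (δ n)) t| ≤ B :=
    fun n t => (hB t t.2 _ (hmem _ (hδ n) t)).1
  have := hconv.finite
  have hle := h.action_le hT hreg hδ hK hmem hB' h₁ h₂ h₁₂ hx₁ hx₂ hc₁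
  refine ⟨c t x₁ x₂, ?_, hle.trans (hconv.measure.energy_sub_le hT hreg h.decreasing hδ hB'
    h₁ h₂ h₁₂ hx₁ hx₂), hle⟩
  exact (h.action.nonneg t t.2 x₁ x₂).lt_of_ne' fun h0 => hJ ((h.zero_iff t t.2 _ hc₁ _ hc₂).1 h0)

end Action

/-! ### Weak-* compactness -/

section Compactness

variable {T : ℝ}

/-- Measures of bounded mass are sequentially weak-* compact: normalize, and use the compactness of the
space of probability measures. -/
theorem exists_subseq_weakStarMeasure (hT : 0 < T) (μ : ℕ → Measure (Icc (0 : ℝ) T))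
    [∀ n, IsFiniteMeasure (μ n)] {C : ℝ} (hC : ∀ n, (μ n).real univ ≤ C) :
    ∃ φ : ℕ → ℕ, StrictMono φ ∧ ∃ μbar : Measure (Icc (0 : ℝ) T), IsFiniteMeasure μbar ∧
      WeakStarMeasure (fun n => μ (φ n)) μbar := by
  have : Nonempty (Icc (0 : ℝ) T) := ⟨⟨0, le_rfl, hT.le⟩⟩
  let m : ℕ → FiniteMeasure (Icc (0 : ℝ) T) := fun n => ⟨μ n, inferInstance⟩
  obtain ⟨P, φ₁, hφ₁, hP⟩ := CompactSpace.tendsto_subseq fun n => (m n).normalize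
  have hmem : ∀ n, (μ (φ₁ n)).real univ ∈ Icc 0 C := fun n => ⟨measureReal_nonneg, hC _⟩
  obtain ⟨M, hM, φ₂, hφ₂, hMlim⟩ := isCompact_Icc.tendsto_subseq hmem
  refine ⟨φ₁ ∘ φ₂, hφ₁.comp hφ₂, ENNReal.ofReal M • (P : Measure (Icc (0 : ℝ) T)), ?_, ?_⟩
  · exact Measure.smul_finite _ ENNReal.ofReal_ne_top
  · intro f
    have h1 := ProbabilityMeasure.tendsto_iff_forall_integral_tendsto.1 hP
      (BoundedContinuousFunction.mkOfCompact f)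
    have h2 := hMlim.mul (h1.comp hφ₂.tendsto_atTop)
    rw [integral_smul_measure, ENNReal.toReal_ofReal hM.1, smul_eq_mul]
    refine h2.congr fun n => ?_
    have h3 : μ (φ₁ (φ₂ n)) = (μ (φ₁ (φ₂ n)) univ) •
        ((m (φ₁ (φ₂ n))).normalize : Measure (Icc (0 : ℝ) T)) := by
      have := congrArg (fun z : FiniteMeasure (Icc (0 : ℝ) T) => (z : Measure (Icc (0 : ℝ) T)))
        (m (φ₁ (φ₂ n))).self_eq_mass_smul_normalize
      have h4 : (((m (φ₁ (φ₂ n))).mass : NNReal) : ENNReal) = μ (φ₁ (φ₂ n)) univ :=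
        FiniteMeasure.ennreal_mass
      rw [← h4]
      exact this
    simp only [Function.comp_apply]
    conv_rhs => rw [h3, integral_smul_measure, smul_eq_mul]
    rfl

theorem memLp_two_of_bound {f : Icc (0 : ℝ) T → ℝ} (hf : AEStronglyMeasurable f (leb T)) {B : ℝ}
    (hB : ∀ᵐ t ∂(leb T), |f t| ≤ B) : MemLp f 2 (leb T) :=
  MemLp.of_bound hf B hB

/-- Weak-* convergence of bounded functions may be tested on square integrable functions. -/
theorem weakStarLinfty_of_forall_memLp_two {f : ℕ → Icc (0 : ℝ) T → ℝ} {D : Icc (0 : ℝ) T → ℝ}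
    (hf : ∀ n, AEStronglyMeasurable (f n) (leb T)) (hD : AEStronglyMeasurable D (leb T)) {B : ℝ}
    (hB0 : 0 < B) (hB : ∀ n, ∀ᵐ t ∂(leb T), |f n t| ≤ B) (hDB : ∀ᵐ t ∂(leb T), |D t| ≤ B)
    (h : ∀ g : Icc (0 : ℝ) T → ℝ, MemLp g 2 (leb T) →
      Tendsto (fun n => ∫ t, f n t * g t ∂(leb T)) atTop (𝓝 (∫ t, D t * g t ∂(leb T)))) :
    WeakStarLinfty f D := by
  intro g hg
  rw [Metric.tendsto_atTop]
  intro ε hε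
  obtain ⟨g', hgg', hg'⟩ := hg.exists_boundedContinuous_integral_sub_le
    (show 0 < ε / (4 * B) by positivity)
  have hest : ∀ F : Icc (0 : ℝ) T → ℝ, AEStronglyMeasurable F (leb T) →
      (∀ᵐ t ∂(leb T), |F t| ≤ B) →
      |∫ t, F t * g t ∂(leb T) - ∫ t, F t * g' t ∂(leb T)| ≤ ε / 4 := by
    intro F hF hFB
    have hi : Integrable (fun t => F t * g t) (leb T) := hg.bdd_mul hF hFB
    have hi' : Integrable (fun t => F t * g' t) (leb T) := hg'.bdd_mul hF hFB
    rw [← integral_sub hi hi', ← Real.norm_eq_abs]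
    calc ‖∫ t, F t * g t - F t * g' t ∂(leb T)‖ ≤ ∫ t, B * ‖g t - g' t‖ ∂(leb T) := by
          refine norm_integral_le_of_norm_le ((hg.sub hg').norm.const_mul B) ?_
          filter_upwards [hFB] with t ht
          rw [← mul_sub, norm_mul]
          exact mul_le_mul_of_nonneg_right ht (norm_nonneg _)
      _ ≤ B * (ε / (4 * B)) := by
          rw [integral_const_mul]
          exact mul_le_mul_of_nonneg_left hgg' hB0.le
      _ = ε / 4 := by field_simp
  have hg2 : MemLp g' 2 (leb T) := memLp_two_of_bound hg'.aestronglyMeasurable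
    (Eventually.of_forall fun t => g'.norm_coe_le_norm t)
  obtain ⟨N, hN⟩ := Metric.tendsto_atTop.1 (h g' hg2) (ε / 4) (by positivity)
  refine ⟨N, fun n hn => ?_⟩
  have h1 := hest (f n) (hf n) (hB n)
  have h2 := hest D hD hDB
  have h3 := hN n hn
  rw [Real.dist_eq] at h3 ⊢
  rw [abs_le] at h1 h2
  rw [abs_lt] at h3 ⊢
  constructor <;> linarith [h1.1, h1.2, h2.1, h2.2, h3.1, h3.2]

/-- Bounded functions are sequentially weak-* compact. Compactness is taken from the Hilbert space `L²`,
where the bound passes to the limit by testing on sets. -/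
theorem exists_subseq_weakStarLinfty (f : ℕ → Icc (0 : ℝ) T → ℝ) (hf : ∀ n, Measurable (f n))
    {B : ℝ} (hB0 : 0 < B) (hB : ∀ n t, |f n t| ≤ B) :
    ∃ φ : ℕ → ℕ, StrictMono φ ∧ ∃ D : Icc (0 : ℝ) T → ℝ, AEStronglyMeasurable D (leb T) ∧
      (∀ᵐ t ∂(leb T), |D t| ≤ B) ∧ WeakStarLinfty (fun n => f (φ n)) D := by
  have : Fact ((2 : ENNReal) ≠ ⊤) := ⟨ENNReal.ofNat_ne_top⟩
  have hf2 : ∀ n, MemLp (f n) 2 (leb T) := fun n =>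
    memLp_two_of_bound (hf n).aestronglyMeasurable (Eventually.of_forall (hB n))
  let u : ℕ → Lp ℝ 2 (leb T) := fun n => (hf2 n).toLp
  obtain ⟨R, hR⟩ : ∃ R, ∀ n, ‖u n‖ ≤ R := by
    refine ⟨_, fun n => Lp.norm_le_of_ae_bound hB0.le ?_⟩
    filter_upwards [(hf2 n).coeFn_toLp] with t ht
    rw [ht]
    exact hB n t
  obtain ⟨L, -, φ, hφ, hL⟩ := WeakDual.isSeqCompact_closedBall ℝ (Lp ℝ 2 (leb T)) 0 R
    (x := fun n => StrongDual.toWeakDual (InnerProductSpace.toDual ℝ _ (u n))) (fun n => by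
      change InnerProductSpace.toDual ℝ _ (u n) ∈ Metric.closedBall 0 R
      rw [mem_closedBall_zero_iff, LinearIsometryEquiv.norm_map]
      exact hR n)
  set w : Lp ℝ 2 (leb T) := (InnerProductSpace.toDual ℝ _).symm (WeakDual.toStrongDual L) with hw
  have hinner : ∀ (v : Lp ℝ 2 (leb T)) {g : Icc (0 : ℝ) T → ℝ} (hg : MemLp g 2 (leb T)),
      inner ℝ v hg.toLp = ∫ t, v t * g t ∂(leb T) := by
    intro v g hg
    rw [L2.inner_def]
    refine integral_congr_ae ?_
    filter_upwards [hg.coeFn_toLp] with t ht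
    rw [ht, real_inner_eq_re_inner, RCLike.inner_apply]
    simp [mul_comm]
  have hlim : ∀ g : Icc (0 : ℝ) T → ℝ, MemLp g 2 (leb T) →
      Tendsto (fun n => ∫ t, f (φ n) t * g t ∂(leb T)) atTop (𝓝 (∫ t, w t * g t ∂(leb T))) := by
    intro g hg
    have h1 := ((WeakDual.eval_continuous hg.toLp).tendsto L).comp hL
    have h2 : L hg.toLp = ∫ t, w t * g t ∂(leb T) := by
      rw [← hinner w hg, ← InnerProductSpace.toDual_apply_apply, hw,
        LinearIsometryEquiv.apply_symm_apply]
      rfl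
    rw [h2] at h1
    refine h1.congr fun n => ?_
    have h3 : (fun n => StrongDual.toWeakDual (InnerProductSpace.toDual ℝ _ (u n))) (φ n)
        hg.toLp = inner ℝ (u (φ n)) hg.toLp := InnerProductSpace.toDual_apply_apply
    refine h3.trans ((hinner _ hg).trans (integral_congr_ae ?_))
    filter_upwards [(hf2 (φ n)).coeFn_toLp] with t ht
    rw [ht]
  have hwint : Integrable w (leb T) := (Lp.memLp w).integrable (by norm_num)
  have hset : ∀ s : Set (Icc (0 : ℝ) T), MeasurableSet s →
      Tendsto (fun n => ∫ t in s, f (φ n) t ∂(leb T)) atTop (𝓝 (∫ t in s, w t ∂(leb T))) := by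
    intro s hs
    have h1 : MemLp (s.indicator (fun _ => (1 : ℝ))) 2 (leb T) := (memLp_const 1).indicator hs
    have h2 : ∀ F : Icc (0 : ℝ) T → ℝ, ∫ t, F t * s.indicator (fun _ => (1 : ℝ)) t ∂(leb T) =
        ∫ t in s, F t ∂(leb T) := by
      intro F
      rw [← integral_indicator hs]
      congr 1
      ext t
      by_cases ht : t ∈ s <;> simp [ht]
    simpa only [h2] using hlim _ h1
  have hfi : ∀ n, Integrable (f n) (leb T) := fun n =>
    Integrable.of_bound (hf n).aestronglyMeasurable B (Eventually.of_forall (hB n))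
  have hup : ∀ᵐ t ∂(leb T), w t ≤ B := by
    refine ae_le_of_forall_setIntegral_le (g := fun _ => B) hwint (integrable_const B)
      fun s hs _ => le_of_tendsto' (hset s hs) fun n => ?_
    exact integral_mono (hfi _).integrableOn (integrable_const B) fun t => le_of_abs_le (hB _ t)
  have hdown : ∀ᵐ t ∂(leb T), -B ≤ w t := by
    refine ae_le_of_forall_setIntegral_le (f := fun _ => -B) (integrable_const (-B)) hwint
      fun s hs _ => ge_of_tendsto' (hset s hs) fun n => ?_
    exact integral_mono (integrable_const (-B)) (hfi _).integrableOn
      fun t => neg_le_of_abs_le (hB _ t)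
  have hwB : ∀ᵐ t ∂(leb T), |w t| ≤ B := by
    filter_upwards [hup, hdown] with t h1 h2 using abs_le.2 ⟨h2, h1⟩
  exact ⟨φ, hφ, w, hwint.aestronglyMeasurable, hwB, weakStarLinfty_of_forall_memLp_two
    (fun n => (hf _).aestronglyMeasurable) hwint.aestronglyMeasurable hB0
    (fun n => Eventually.of_forall (hB _)) hwB hlim⟩

theorem WeakStarLinfty.tendsto_setIntegral {f : ℕ → Icc (0 : ℝ) T → ℝ} {D : Icc (0 : ℝ) T → ℝ}
    (h : WeakStarLinfty f D) {s : Set (Icc (0 : ℝ) T)} (hs : MeasurableSet s) :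
    Tendsto (fun n => ∫ t in s, f n t ∂(leb T)) atTop (𝓝 (∫ t in s, D t ∂(leb T))) := by
  have h2 : ∀ F : Icc (0 : ℝ) T → ℝ, ∫ t, F t * s.indicator (fun _ => (1 : ℝ)) t ∂(leb T) =
      ∫ t in s, F t ∂(leb T) := by
    intro F
    rw [← integral_indicator hs]
    congr 1
    ext t
    by_cases ht : t ∈ s <;> simp [ht]
  simpa only [h2] using h _ ((integrable_const (1 : ℝ)).indicator hs)

/-- A bounded sequence that converges pointwise almost everywhere has no other weak-* limit. -/
theorem WeakStarLinfty.ae_eq_of_tendsto {f : ℕ → Icc (0 : ℝ) T → ℝ} {D G : Icc (0 : ℝ) T → ℝ}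
    (h : WeakStarLinfty f D) (hf : ∀ n, Measurable (f n)) {B : ℝ} (hB : ∀ n t, |f n t| ≤ B)
    (hD : Integrable D (leb T))
    (hG : ∀ᵐ t ∂(leb T), Tendsto (fun n => f n t) atTop (𝓝 (G t))) :
    Integrable G (leb T) ∧ G =ᵐ[leb T] D := by
  have hGm : AEStronglyMeasurable G (leb T) :=
    aestronglyMeasurable_of_tendsto_ae atTop (fun n => (hf n).aestronglyMeasurable) hG
  have hGB : ∀ᵐ t ∂(leb T), ‖G t‖ ≤ B := by
    filter_upwards [hG] with t ht
    exact le_of_tendsto' ht.norm fun n => hB n t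
  have hGi : Integrable G (leb T) := Integrable.of_bound hGm B hGB
  refine ⟨hGi, hGi.ae_eq_of_forall_setIntegral_eq G D hD fun s hs _ => ?_⟩
  refine tendsto_nhds_unique ?_ (h.tendsto_setIntegral hs)
  exact tendsto_integral_of_dominated_convergence (fun _ => B)
    (fun n => (hf n).aestronglyMeasurable) (integrable_const B)
    (fun n => Eventually.of_forall (hB n)) (ae_restrict_of_ae hG)

end Compactness

/-! ### Selection of a convergent sequence of discrete evolutions -/

section Selection

variable {X : Type*} {T : ℝ} {E : ℝ → X → ℝ} {ω : ℝ → X → X} {x₀ : X}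

theorem countable_atoms (μ : Measure (Icc (0 : ℝ) T)) [IsFiniteMeasure μ] :
    {t | 0 < μ {t}}.Countable :=
  Measure.countable_meas_pos_of_disjoint_iUnion (fun t => measurableSet_singleton t)
    fun s t hst => by simpa using hst

theorem WeakStarMeasure.comp {μ : ℕ → Measure (Icc (0 : ℝ) T)} {μbar : Measure (Icc (0 : ℝ) T)}
    (h : WeakStarMeasure μ μbar) {φ : ℕ → ℕ} (hφ : Tendsto φ atTop atTop) :
    WeakStarMeasure (fun n => μ (φ n)) μbar :=
  fun f => (h f).comp hφ

theorem WeakStarLinfty.comp {f : ℕ → Icc (0 : ℝ) T → ℝ} {D : Icc (0 : ℝ) T → ℝ}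
    (h : WeakStarLinfty f D) {φ : ℕ → ℕ} (hφ : Tendsto φ atTop atTop) :
    WeakStarLinfty (fun n => f (φ n)) D :=
  fun g hg => (h g hg).comp hφ

theorem EnergyConvergence.comp {δ : ℕ → ℝ} {μbar : Measure (Icc (0 : ℝ) T)}
    {Ebar D : Icc (0 : ℝ) T → ℝ} (h : EnergyConvergence T E ω x₀ δ μbar Ebar D) {φ : ℕ → ℕ}
    (hφ : Tendsto φ atTop atTop) : EnergyConvergence T E ω x₀ (δ ∘ φ) μbar Ebar D where
  finite := h.finite
  bounded_variation := h.bounded_variation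
  memLp := h.memLp
  measure := h.measure.comp hφ
  energy t := (h.energy t).comp hφ
  power := h.power.comp hφ

variable [MetricSpace X]

/-- The output of the compactness arguments: along the step sizes `δ n`, which decrease to `0`, the
measures, energies and powers of the discrete evolutions converge, and the evolutions themselves,
which stay in the compact set `K`, converge pointwise on a dense set `A` that contains all atoms of
the limit measure. -/
structure IsSelected (T : ℝ) (E : ℝ → X → ℝ) (ω : ℝ → X → X) (x₀ : X) (δ : ℕ → ℝ)
    (μbar : Measure (Icc (0 : ℝ) T)) (Ebar D : Icc (0 : ℝ) T → ℝ) (K : Set X) (B : ℝ)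
    (A : Set (Icc (0 : ℝ) T)) : Prop where
  pos : ∀ n, 0 < δ n
  anti : StrictAnti δ
  tendsto : Tendsto δ atTop (𝓝 0)
  conv : EnergyConvergence T E ω x₀ δ μbar Ebar D
  compact : IsCompact K
  mem : ∀ δ > 0, ∀ t, evolution T ω x₀ δ t ∈ K
  bound : ∀ t ∈ Icc 0 T, ∀ x ∈ K, |timeDeriv T E t x| ≤ B
  power_bound : ∀ᵐ t ∂(leb T), |D t| ≤ B
  dense : Dense A
  atom_mem : ∀ t, μbar {t} ≠ 0 → t ∈ A
  conv_dense : ∀ t ∈ A, ∃ x, Tendsto (fun n => evolution T ω x₀ (δ n) t) atTop (𝓝 x)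

theorem dropMeasure_real_univ_le (hT : 0 < T) (hreg : EnergyRegular T E)
    (hω : AxiomDecreasing T E ω) {δ B : ℝ} (hδ : 0 < δ)
    (hB : ∀ t, |powerAlong E (evolution T ω x₀ δ) t| ≤ B)
    (hB' : ∀ t, |energyAlong E (evolution T ω x₀ δ) t| ≤ B) :
    (dropMeasure T E ω x₀ δ).real univ ≤ |E 0 x₀| + B * (leb T).real univ + B := by
  have hu : (Iic ⟨T, hT.le, le_rfl⟩ : Set (Icc (0 : ℝ) T)) = univ :=
    eq_univ_of_forall fun s => s.2.2
  have h := energyAlong_eq (x₀ := x₀) hT hreg hω hδ ⟨T, hT.le, le_rfl⟩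
  rw [hu, setIntegral_univ] at h
  have h1 := norm_integral_le_of_norm_le_const (μ := leb T)
    (f := powerAlong E (evolution T ω x₀ δ)) (Eventually.of_forall hB)
  rw [Real.norm_eq_abs] at h1
  have h2 := neg_abs_le (energyAlong E (evolution T ω x₀ δ) ⟨T, hT.le, le_rfl⟩)
  have h3 := hB' ⟨T, hT.le, le_rfl⟩
  have h4 := le_abs_self (E 0 x₀)
  have h5 := le_abs_self (∫ t, powerAlong E (evolution T ω x₀ δ) t ∂(leb T))
  linarith

/-- A function with one-sided bounded difference quotients is the difference of two monotone functions. -/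
theorem boundedVariationOn_of_sub_le {f : Icc (0 : ℝ) T → ℝ} {B : ℝ} (hT : 0 < T)
    (h : ∀ s t, s ≤ t → f t - f s ≤ B * (t - s)) : BoundedVariationOn f univ := by
  have key : ∀ g : Icc (0 : ℝ) T → ℝ, Monotone g → BoundedVariationOn g univ := by
    intro g hg
    have := (hg.monotoneOn univ).eVariationOn_eq (mem_univ ⟨0, le_rfl, hT.le⟩)
      (mem_univ ⟨T, hT.le, le_rfl⟩)
    have hu : (Icc ⟨0, le_rfl, hT.le⟩ ⟨T, hT.le, le_rfl⟩ : Set (Icc (0 : ℝ) T)) = univ :=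
      eq_univ_of_forall fun s => ⟨s.2.1, s.2.2⟩
    rw [hu, univ_inter] at this
    exact ne_top_of_le_ne_top ENNReal.ofReal_ne_top this.le
  have h1 := key (fun t => |B| * t) fun s t hst =>
    mul_le_mul_of_nonneg_left (Subtype.coe_le_coe.2 hst) (abs_nonneg B)
  have h2 := key (fun t => |B| * t - f t) fun s t hst => by
    have h3 := h s t hst
    have h4 : B * ((t : ℝ) - s) ≤ |B| * (t - s) :=
      mul_le_mul_of_nonneg_right (le_abs_self B) (sub_nonneg.2 hst)
    show |B| * (s : ℝ) - f s ≤ |B| * t - f t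
    linarith
  refine ne_top_of_le_ne_top (ENNReal.add_ne_top.2 ⟨h1, h2⟩) (iSup_le ?_)
  rintro ⟨n, u, hu, us⟩
  refine le_trans ?_ (add_le_add (eVariationOn.sum_le (n := n) hu us)
    (eVariationOn.sum_le (n := n) hu us))
  rw [← Finset.sum_add_distrib]
  refine Finset.sum_le_sum fun i _ => ?_
  rw [edist_dist, edist_dist, edist_dist, ← ENNReal.ofReal_add dist_nonneg dist_nonneg]
  refine ENNReal.ofReal_le_ofReal ?_
  have h3 := dist_sub_sub_le (|B| * (u (i + 1) : ℝ)) (|B| * (u (i + 1) : ℝ) - f (u (i + 1)))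
    (|B| * (u i : ℝ)) (|B| * (u i : ℝ) - f (u i))
  rwa [sub_sub_cancel, sub_sub_cancel] at h3

/-- Every sequence of step sizes tending to `0` has a subsequence along which the discrete evolutions
converge in the sense of `IsSelected`. At times outside the dense set the energies converge by the
energy balance, since these times are not atoms. -/
theorem exists_isSelected (hT : 0 < T) (hreg : EnergyRegular T E)
    (hpow : PowerControl T E) (hcoer : Coercive T E) (hω : AxiomDecreasing T E ω) (x₀ : X)
    {δ : ℕ → ℝ} (hpos : ∀ n, 0 < δ n) (hδ : Tendsto δ atTop (𝓝 0)) :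
    ∃ φ : ℕ → ℕ, StrictMono φ ∧ ∃ (μbar : Measure (Icc (0 : ℝ) T)) (Ebar D : Icc (0 : ℝ) T → ℝ)
      (K : Set X) (B : ℝ) (A : Set (Icc (0 : ℝ) T)),
      IsSelected T E ω x₀ (δ ∘ φ) μbar Ebar D K B A := by
  obtain ⟨K, hK, hmem, B, hB, hbound⟩ := exists_isCompact_evolution_mem hT hreg hpow hcoer hω x₀
  have hp : ∀ δ > 0, ∀ t, |powerAlong E (evolution T ω x₀ δ) t| ≤ B :=
    fun δ hδ t => (hbound t t.2 _ (hmem δ hδ t)).1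
  have he : ∀ δ > 0, ∀ t, |energyAlong E (evolution T ω x₀ δ) t| ≤ B :=
    fun δ hδ t => (hbound t t.2 _ (hmem δ hδ t)).2
  have hinv : Tendsto (fun n => (δ n)⁻¹) atTop atTop :=
    (tendsto_nhdsWithin_iff.2 ⟨hδ, Eventually.of_forall hpos⟩).inv_tendsto_nhdsGT_zero
  obtain ⟨φ₁, hφ₁, hmono⟩ := strictMono_subseq_of_tendsto_atTop hinv
  have hanti : StrictAnti (δ ∘ φ₁) := fun m n hmn =>
    (inv_lt_inv₀ (hpos _) (hpos _)).1 (hmono hmn)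
  have : ∀ n, IsFiniteMeasure (dropMeasure T E ω x₀ (δ (φ₁ n))) :=
    fun n => isFiniteMeasure_dropMeasure hT hreg (hpos _)
  obtain ⟨φ₂, hφ₂, μbar, hfin, hμ⟩ := exists_subseq_weakStarMeasure hT
    (fun n => dropMeasure T E ω x₀ (δ (φ₁ n)))
    fun n => dropMeasure_real_univ_le hT hreg hω (hpos _) (hp _ (hpos _)) (he _ (hpos _))
  obtain ⟨φ₃, hφ₃, D, hDm, hDB, hD⟩ := exists_subseq_weakStarLinfty
    (fun n => powerAlong E (evolution T ω x₀ (δ (φ₁ (φ₂ n)))))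
    (fun n => measurable_powerAlong hreg _) hB (fun n t => hp _ (hpos _) t)
  obtain ⟨S, hS, hSd⟩ := TopologicalSpace.exists_countable_dense (Icc (0 : ℝ) T)
  set A : Set (Icc (0 : ℝ) T) := {t | 0 < μbar {t}} ∪ S with hA
  have hAc : A.Countable := (countable_atoms μbar).union hS
  have := hAc.to_subtype
  have := isCompact_iff_compactSpace.1 hK
  obtain ⟨ξ, φ₄, hφ₄, hξ⟩ := CompactSpace.tendsto_subseq
    (fun n => fun a : A => (⟨evolution T ω x₀ (δ (φ₁ (φ₂ (φ₃ n)))) a, hmem _ (hpos _) _⟩ : K))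
  set φ := φ₁ ∘ φ₂ ∘ φ₃ ∘ φ₄ with hφdef
  have hφ : StrictMono φ := hφ₁.comp (hφ₂.comp (hφ₃.comp hφ₄))
  have hμ' : WeakStarMeasure (fun n => dropMeasure T E ω x₀ ((δ ∘ φ) n)) μbar :=
    hμ.comp (hφ₃.comp hφ₄).tendsto_atTop
  have hD' : WeakStarLinfty (fun n => powerAlong E (evolution T ω x₀ ((δ ∘ φ) n))) D :=
    hD.comp hφ₄.tendsto_atTop
  have hconv : ∀ t ∈ A, ∃ x, Tendsto (fun n => evolution T ω x₀ ((δ ∘ φ) n) t) atTop (𝓝 x) := by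
    intro t ht
    refine ⟨ξ ⟨t, ht⟩, ?_⟩
    exact (continuous_subtype_val.tendsto _).comp (tendsto_pi_nhds.1 hξ ⟨t, ht⟩)
  have hex : ∀ t, ∃ e, Tendsto (fun n => energyAlong E (evolution T ω x₀ ((δ ∘ φ) n)) t) atTop
      (𝓝 e) := by
    intro t
    by_cases ht : t ∈ A
    · obtain ⟨x, hx⟩ := hconv t ht
      exact ⟨_, tendsto_energyAlong hreg tendsto_const_nhds hx⟩
    · have ht0 : μbar {t} = 0 := by
        by_contra h
        exact ht (Or.inl (pos_iff_ne_zero.2 h))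
      have : ∀ n, IsFiniteMeasure (dropMeasure T E ω x₀ ((δ ∘ φ) n)) :=
        fun n => isFiniteMeasure_dropMeasure hT hreg (hpos _)
      exact ⟨_, ((tendsto_const_nhds.add (hD'.tendsto_setIntegral measurableSet_Iic)).sub
        (hμ'.tendsto_real_Iic ht0)).congr fun n =>
          (energyAlong_eq hT hreg hω (hpos (φ n)) t).symm⟩
  choose Ebar hEbar using hex
  have hsub : ∀ s t, s ≤ t → Ebar t - Ebar s ≤ B * ((t : ℝ) - s) := fun s t hst =>
    le_of_tendsto ((hEbar t).sub (hEbar s)) (Eventually.of_forall fun n =>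
      energyAlong_sub_le hT hreg hω (hpos (φ n)) (hp _ (hpos (φ n))) hst)
  exact ⟨φ, hφ, μbar, Ebar, D, K, B, A,
    { pos := fun n => hpos _
      anti := fun m n hmn => hanti ((hφ₂.comp (hφ₃.comp hφ₄)) hmn)
      tendsto := hδ.comp hφ.tendsto_atTop
      conv :=
        { finite := hfin
          bounded_variation := boundedVariationOn_of_sub_le hT hsub
          memLp := MemLp.of_bound hDm B (by simpa only [Real.norm_eq_abs] using hDB)
          measure := hμ'
          energy := hEbar
          power := hD' }
      compact := hK
      mem := hmem
      bound := fun t ht x hx => (hbound t ht x hx).1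
      power_bound := hDB
      dense := hSd.mono subset_union_right
      atom_mem := fun t ht => Or.inl (pos_iff_ne_zero.2 ht)
      conv_dense := hconv }⟩

end Selection

/-! ### Limits of evolutions in the quotient space -/

section Limits

variable {X : Type*} [MetricSpace X] {T : ℝ} {E : ℝ → X → ℝ}

/-- The properties of a sequence of evolutions `η n` that produce a limit in the quotient space: it
stays in the compact set `K`, its limits along converging times are critical, two such limits at the
same time `t` belong to the same component if `t` is not an atom of `μbar` or if they have the same
energy, and on a dense set of times that contains the atoms the evolutions converge. -/
structure HasComponentLimits (T : ℝ) (E : ℝ → X → ℝ) (η : ℕ → Icc (0 : ℝ) T → X)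
    (μbar : Measure (Icc (0 : ℝ) T)) (Ebar : Icc (0 : ℝ) T → ℝ) (K : Set X)
    (A : Set (Icc (0 : ℝ) T)) : Prop where
  compact : IsCompact K
  mem : ∀ n t, η n t ∈ K
  mem_crit : ∀ (m : ℕ → ℕ) (s : ℕ → Icc (0 : ℝ) T) (t : Icc (0 : ℝ) T) (x : X),
    Tendsto m atTop atTop → Tendsto s atTop (𝓝 t) →
    Tendsto (fun k => η (m k) (s k)) atTop (𝓝 x) → x ∈ crit E t
  joinedIn : ∀ (m : ℕ → ℕ) (s₁ s₂ : ℕ → Icc (0 : ℝ) T) (t : Icc (0 : ℝ) T) (x₁ x₂ : X),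
    Tendsto m atTop atTop → Tendsto s₁ atTop (𝓝 t) → Tendsto s₂ atTop (𝓝 t) →
    Tendsto (fun k => η (m k) (s₁ k)) atTop (𝓝 x₁) →
    Tendsto (fun k => η (m k) (s₂ k)) atTop (𝓝 x₂) →
    (μbar {t} = 0 ∨ E t x₁ = E t x₂) → JoinedIn (crit E t) x₁ x₂
  energy : ∀ t, Tendsto (fun n => energyAlong E (η n) t) atTop (𝓝 (Ebar t))
  dense : Dense A
  atom_mem : ∀ t, μbar {t} ≠ 0 → t ∈ A
  conv_dense : ∀ t ∈ A, ∃ x, Tendsto (fun n => η n t) atTop (𝓝 x)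

/-- The axiom on limits, which is about ordered pairs of times and about the whole sequence, holds for
all pairs and all subsequences after extraction of a subsequence with a fixed order. -/
theorem IsSelected.hasComponentLimits {ω : ℝ → X → X} {x₀ : X} {δ : ℕ → ℝ}
    {μbar : Measure (Icc (0 : ℝ) T)} {Ebar D : Icc (0 : ℝ) T → ℝ} {K : Set X} {B : ℝ}
    {A : Set (Icc (0 : ℝ) T)} (h : IsSelected T E ω x₀ δ μbar Ebar D K B A) (hT : 0 < T)
    (hreg : EnergyRegular T E) (hω : AxiomCritical T E ω) (hx₀ : x₀ ∈ crit E 0)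
    (hlim : AxiomLimits T E ω x₀) :
    HasComponentLimits T E (fun n => evolution T ω x₀ (δ n)) μbar Ebar K A := by
  have hcrit : ∀ (m : ℕ → ℕ) (s : ℕ → Icc (0 : ℝ) T) (t : Icc (0 : ℝ) T) (x : X),
      Tendsto m atTop atTop → Tendsto s atTop (𝓝 t) →
      Tendsto (fun k => evolution T ω x₀ (δ (m k)) (s k)) atTop (𝓝 x) → x ∈ crit E t := by
    intro m s t x hm hs hx
    choose u hu hu' using fun k => exists_evolution_mem_crit hω hx₀ hT (h.pos (m k)) (s k)
    refine mem_crit_of_tendsto hreg (s := u) ?_ hx (Eventually.of_forall hu')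
    refine (tendsto_iff_of_dist ?_).2 hs
    exact squeeze_zero (fun _ => dist_nonneg) hu (h.tendsto.comp hm)
  have haux : ∀ (m : ℕ → ℕ) (s₁ s₂ : ℕ → Icc (0 : ℝ) T) (t : Icc (0 : ℝ) T) (x₁ x₂ : X),
      Tendsto m atTop atTop → Tendsto s₁ atTop (𝓝 t) → Tendsto s₂ atTop (𝓝 t) →
      Tendsto (fun k => evolution T ω x₀ (δ (m k)) (s₁ k)) atTop (𝓝 x₁) →
      Tendsto (fun k => evolution T ω x₀ (δ (m k)) (s₂ k)) atTop (𝓝 x₂) →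
      (μbar {t} = 0 ∨ E t x₁ = E t x₂) → (∃ᶠ k in atTop, s₁ k ≤ s₂ k) →
      JoinedIn (crit E t) x₁ x₂ := by
    intro m s₁ s₂ t x₁ x₂ hm h₁ h₂ hx₁ hx₂ hor hfreq
    by_contra hJ
    obtain ⟨φ, hφ, hle⟩ := extraction_of_frequently_atTop hfreq
    obtain ⟨ψ, hψ, hmono⟩ := strictMono_subseq_of_tendsto_atTop (hm.comp hφ.tendsto_atTop)
    have ht := (hφ.comp hψ).tendsto_atTop
    obtain ⟨c, hc, hc₁, hc₂⟩ := hlim (δ ∘ (m ∘ φ ∘ ψ)) (fun n => h.pos _)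
      (fun i j hij => h.anti (hmono hij)) (h.tendsto.comp (hm.comp ht)) μbar Ebar D
      (h.conv.comp (hm.comp ht)) t (s₁ ∘ φ ∘ ψ) (s₂ ∘ φ ∘ ψ) x₁ x₂ (h₁.comp ht) (h₂.comp ht)
      (fun n => hle _) (hx₁.comp ht) (hx₂.comp ht) (hcrit m s₁ t x₁ hm h₁ hx₁)
      (hcrit m s₂ t x₂ hm h₂ hx₂) hJ
    rcases hor with h0 | h0
    · rw [measureReal_def, h0, ENNReal.toReal_zero] at hc₁
      linarith
    · linarith
  refine { compact := h.compact
           mem := fun n => h.mem _ (h.pos n)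
           mem_crit := hcrit
           joinedIn := ?_
           energy := h.conv.energy
           dense := h.dense
           atom_mem := h.atom_mem
           conv_dense := h.conv_dense }
  intro m s₁ s₂ t x₁ x₂ hm h₁ h₂ hx₁ hx₂ hor
  have hfreq : ∃ᶠ k in atTop, s₁ k ≤ s₂ k ∨ s₂ k ≤ s₁ k :=
    (Eventually.of_forall fun k => le_total _ _).frequently
  rcases frequently_or_distrib.1 hfreq with hf | hf
  · exact haux m s₁ s₂ t x₁ x₂ hm h₁ h₂ hx₁ hx₂ hor hf
  · exact (haux m s₂ s₁ t x₂ x₁ hm h₂ h₁ hx₂ hx₁ (hor.imp_right Eq.symm) hf).symm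

variable {η : ℕ → Icc (0 : ℝ) T → X} {μbar : Measure (Icc (0 : ℝ) T)} {Ebar : Icc (0 : ℝ) T → ℝ}
  {K : Set X} {A : Set (Icc (0 : ℝ) T)}

namespace HasComponentLimits

theorem energy_eq (h : HasComponentLimits T E η μbar Ebar K A) (hreg : EnergyRegular T E)
    {m : ℕ → ℕ} (hm : Tendsto m atTop atTop) {t : Icc (0 : ℝ) T} {x : X}
    (hx : Tendsto (fun k => η (m k) t) atTop (𝓝 x)) : E t x = Ebar t :=
  tendsto_nhds_unique (tendsto_energyAlong hreg (η := fun k => η (m k)) tendsto_const_nhds hx)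
    ((h.energy t).comp hm)

/-- At a fixed time all limits of subsequences belong to one component. At a time outside the dense
set `A`, which is not an atom, the limits are compared with the limits at nearby times of `A`, where
the whole sequence converges. -/
theorem exists_joinedIn (h : HasComponentLimits T E η μbar Ebar K A) (t : Icc (0 : ℝ) T) :
    ∃ z, ∀ x, ∀ m : ℕ → ℕ, Tendsto m atTop atTop → Tendsto (fun k => η (m k) t) atTop (𝓝 x) →
      JoinedIn (crit E t) z x := by
  by_cases ht : t ∈ A
  · obtain ⟨z, hz⟩ := h.conv_dense t ht
    refine ⟨z, fun x m hm hx => ?_⟩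
    obtain rfl := tendsto_nhds_unique hx (hz.comp hm)
    exact JoinedIn.refl (h.mem_crit m (fun _ => t) t x hm tendsto_const_nhds hx)
  · have h0 : μbar {t} = 0 := by
      by_contra hne
      exact ht (h.atom_mem t hne)
    obtain ⟨a, haA, ha⟩ := mem_closure_iff_seq_limit.1 (h.dense t)
    choose y hy using fun j => h.conv_dense (a j) (haA j)
    have hyK : ∀ j, y j ∈ K := fun j =>
      h.compact.isClosed.mem_of_tendsto (hy j) (Eventually.of_forall fun n => h.mem n _)
    obtain ⟨z, -, φ, hφ, hz⟩ := h.compact.tendsto_subseq hyK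
    refine ⟨z, fun x m hm hx => ?_⟩
    have hex : ∀ j, ∃ k, j ≤ k ∧ dist (η (m k) (a (φ j))) (y (φ j)) < 1 / ((j : ℝ) + 1) := by
      intro j
      have h1 := (Metric.tendsto_nhds.1 ((hy (φ j)).comp hm)) (1 / ((j : ℝ) + 1)) (by positivity)
      obtain ⟨k, hk⟩ := ((eventually_ge_atTop j).and h1).exists
      exact ⟨k, hk.1, hk.2⟩
    choose k hjk hk using hex
    have hkt : Tendsto k atTop atTop := tendsto_atTop_mono hjk tendsto_id
    refine h.joinedIn (m ∘ k) (a ∘ φ) (fun _ => t) t z x (hm.comp hkt) (ha.comp hφ.tendsto_atTop)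
      tendsto_const_nhds ?_ (hx.comp hkt) (Or.inl h0)
    refine (tendsto_iff_of_dist ?_).2 hz
    exact squeeze_zero (fun _ => dist_nonneg) (fun j => (hk j).le)
      tendsto_one_div_add_atTop_nhds_zero_nat

theorem exists_limit (h : HasComponentLimits T E η μbar Ebar K A) :
    ∃ ξ : Icc (0 : ℝ) T → X, (∀ t, ξ t ∈ K) ∧
      ∀ t, ∃ φ : ℕ → ℕ, StrictMono φ ∧ Tendsto (fun n => η (φ n) t) atTop (𝓝 (ξ t)) := by
  choose ξ hK φ hφ hξ using fun t => h.compact.tendsto_subseq fun n => h.mem n t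
  exact ⟨ξ, hK, fun t => ⟨φ t, hφ t, hξ t⟩⟩

variable {ξ : Icc (0 : ℝ) T → X}

theorem joinedIn_limit (h : HasComponentLimits T E η μbar Ebar K A)
    (hξ : ∀ t, ∃ φ : ℕ → ℕ, StrictMono φ ∧ Tendsto (fun n => η (φ n) t) atTop (𝓝 (ξ t)))
    {t : Icc (0 : ℝ) T} {x : X} {m : ℕ → ℕ} (hm : Tendsto m atTop atTop)
    (hx : Tendsto (fun k => η (m k) t) atTop (𝓝 x)) : JoinedIn (crit E t) (ξ t) x := by
  obtain ⟨z, hz⟩ := h.exists_joinedIn t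
  obtain ⟨φ, hφ, hφt⟩ := hξ t
  exact (hz _ φ hφ.tendsto_atTop hφt).symm.trans (hz x m hm hx)

theorem limit_mem_crit (h : HasComponentLimits T E η μbar Ebar K A)
    (hξ : ∀ t, ∃ φ : ℕ → ℕ, StrictMono φ ∧ Tendsto (fun n => η (φ n) t) atTop (𝓝 (ξ t)))
    (t : Icc (0 : ℝ) T) : ξ t ∈ crit E t := by
  obtain ⟨φ, hφ, hφt⟩ := hξ t
  exact h.mem_crit φ (fun _ => t) t _ hφ.tendsto_atTop tendsto_const_nhds hφt

theorem energy_limit (h : HasComponentLimits T E η μbar Ebar K A) (hreg : EnergyRegular T E)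
    (hξ : ∀ t, ∃ φ : ℕ → ℕ, StrictMono φ ∧ Tendsto (fun n => η (φ n) t) atTop (𝓝 (ξ t)))
    (t : Icc (0 : ℝ) T) : E t (ξ t) = Ebar t := by
  obtain ⟨φ, hφ, hφt⟩ := hξ t
  exact h.energy_eq hreg hφ.tendsto_atTop hφt

theorem tendsto_cls_limit (h : HasComponentLimits T E η μbar Ebar K A)
    (hξ : ∀ t, ∃ φ : ℕ → ℕ, StrictMono φ ∧ Tendsto (fun n => η (φ n) t) atTop (𝓝 (ξ t)))
    (t : Icc (0 : ℝ) T) :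
    Tendsto (fun n => cls T E t (η n t)) atTop (𝓝 (cls T E t (ξ t))) := by
  refine tendsto_of_subseq_tendsto fun ns hns => ?_
  obtain ⟨x, -, φ, hφ, hx⟩ := h.compact.tendsto_subseq fun n => h.mem (ns n) t
  refine ⟨φ, ?_⟩
  rw [(cls_eq_iff_of_mem (h.limit_mem_crit hξ t)).2
    (h.joinedIn_limit hξ (hns.comp hφ.tendsto_atTop) hx)]
  exact tendsto_cls tendsto_const_nhds hx

/-- The evolutions approach the limiting component uniformly. -/
theorem eventually_exists_dist_lt (h : HasComponentLimits T E η μbar Ebar K A)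
    (hξ : ∀ t, ∃ φ : ℕ → ℕ, StrictMono φ ∧ Tendsto (fun n => η (φ n) t) atTop (𝓝 (ξ t)))
    (t : Icc (0 : ℝ) T) {ε : ℝ} (hε : 0 < ε) :
    ∀ᶠ n in atTop, ∃ ζ, JoinedIn (crit E t) (ξ t) ζ ∧ dist (η n t) ζ < ε := by
  by_contra hcon
  obtain ⟨φ, hφ, hfail⟩ := extraction_of_frequently_atTop (not_eventually.1 hcon)
  obtain ⟨x, -, ψ, hψ, hx⟩ := h.compact.tendsto_subseq fun n => h.mem (φ n) t
  obtain ⟨n, hn⟩ := ((Metric.tendsto_nhds.1 hx) ε hε).exists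
  exact hfail (ψ n) ⟨x, h.joinedIn_limit hξ (hφ.comp hψ).tendsto_atTop hx, hn⟩

theorem limit_mem_crit_of_tendsto (h : HasComponentLimits T E η μbar Ebar K A)
    (hreg : EnergyRegular T E)
    (hξ : ∀ t, ∃ φ : ℕ → ℕ, StrictMono φ ∧ Tendsto (fun n => η (φ n) t) atTop (𝓝 (ξ t)))
    {t : Icc (0 : ℝ) T} {s : ℕ → Icc (0 : ℝ) T} {x : X} (hs : Tendsto s atTop (𝓝 t))
    (hx : Tendsto (fun k => ξ (s k)) atTop (𝓝 x)) : x ∈ crit E t :=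
  mem_crit_of_tendsto hreg hs hx (Eventually.of_forall fun _ => h.limit_mem_crit hξ _)

/-- Limits of the limit evolution `ξ` along two sequences of times are, up to the choice of points
in their components, diagonal limits of the evolutions `η n`. -/
theorem exists_diagonal [LocallyCompactSpace X] (h : HasComponentLimits T E η μbar Ebar K A)
    (hreg : EnergyRegular T E) (hcomp : CriticalComponents T E)
    (hξ : ∀ t, ∃ φ : ℕ → ℕ, StrictMono φ ∧ Tendsto (fun n => η (φ n) t) atTop (𝓝 (ξ t)))
    {t : Icc (0 : ℝ) T} {s₁ s₂ : ℕ → Icc (0 : ℝ) T} {x₁ x₂ : X} (hs₁ : Tendsto s₁ atTop (𝓝 t))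
    (hs₂ : Tendsto s₂ atTop (𝓝 t)) (hx₁ : Tendsto (fun k => ξ (s₁ k)) atTop (𝓝 x₁))
    (hx₂ : Tendsto (fun k => ξ (s₂ k)) atTop (𝓝 x₂)) :
    ∃ (m φ : ℕ → ℕ) (u₁ u₂ : X), Tendsto m atTop atTop ∧ Tendsto φ atTop atTop ∧
      Tendsto (fun k => η (m k) (s₁ (φ k))) atTop (𝓝 u₁) ∧
      Tendsto (fun k => η (m k) (s₂ (φ k))) atTop (𝓝 u₂) ∧
      JoinedIn (crit E t) u₁ x₁ ∧ JoinedIn (crit E t) u₂ x₂ := by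
  have := t2Space_quotSpace hcomp hreg
  have hex : ∀ k : ℕ, ∃ n, k ≤ n ∧
      (∃ ζ, JoinedIn (crit E (s₁ k)) (ξ (s₁ k)) ζ ∧ dist (η n (s₁ k)) ζ < 1 / ((k : ℝ) + 1)) ∧
      ∃ ζ, JoinedIn (crit E (s₂ k)) (ξ (s₂ k)) ζ ∧ dist (η n (s₂ k)) ζ < 1 / ((k : ℝ) + 1) := by
    intro k
    have hk : (0 : ℝ) < 1 / ((k : ℝ) + 1) := by positivity
    exact ((eventually_ge_atTop k).and ((h.eventually_exists_dist_lt hξ (s₁ k) hk).and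
      (h.eventually_exists_dist_lt hξ (s₂ k) hk))).exists
  choose m hm h₁ h₂ using hex
  choose ζ₁ hζ₁ hd₁ using h₁
  choose ζ₂ hζ₂ hd₂ using h₂
  have hmt : Tendsto m atTop atTop := tendsto_atTop_mono hm tendsto_id
  obtain ⟨⟨u₁, u₂⟩, -, φ, hφ, hu⟩ := (h.compact.prod h.compact).tendsto_subseq
    (x := fun k => (η (m k) (s₁ k), η (m k) (s₂ k))) fun k => ⟨h.mem _ _, h.mem _ _⟩
  have hφt := hφ.tendsto_atTop
  have key : ∀ (s : ℕ → Icc (0 : ℝ) T) (ζ : ℕ → X) (x u : X), Tendsto s atTop (𝓝 t) →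
      Tendsto (fun k => ξ (s k)) atTop (𝓝 x) →
      (∀ k, JoinedIn (crit E (s k)) (ξ (s k)) (ζ k)) →
      (∀ k, dist (η (m k) (s k)) (ζ k) < 1 / ((k : ℝ) + 1)) →
      Tendsto (fun k => η (m (φ k)) (s (φ k))) atTop (𝓝 u) → JoinedIn (crit E t) u x := by
    intro s ζ x u hs hx hζ hd hu
    have hζu : Tendsto (fun k => ζ (φ k)) atTop (𝓝 u) := by
      refine (tendsto_iff_of_dist ?_).1 hu
      exact squeeze_zero (fun _ => dist_nonneg) (fun k => (hd (φ k)).le)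
        (tendsto_one_div_add_atTop_nhds_zero_nat.comp hφt)
    have hcl := tendsto_cls (E := E) (hs.comp hφt) hζu
    have hcl' := tendsto_cls (E := E) (hs.comp hφt) (hx.comp hφt)
    have heq : ∀ k, cls T E (s (φ k)) (ζ (φ k)) = cls T E (s (φ k)) (ξ (s (φ k))) := fun k =>
      ((cls_eq_iff_of_mem (h.limit_mem_crit hξ _)).2 (hζ (φ k))).symm
    have hucrit := h.mem_crit (m ∘ φ) (s ∘ φ) t u (hmt.comp hφt) (hs.comp hφt) hu
    exact (cls_eq_iff_of_mem hucrit).1 (tendsto_nhds_unique (hcl.congr heq) hcl')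
  have hu₁ : Tendsto (fun k => η (m (φ k)) (s₁ (φ k))) atTop (𝓝 u₁) :=
    (continuous_fst.tendsto _).comp hu
  have hu₂ : Tendsto (fun k => η (m (φ k)) (s₂ (φ k))) atTop (𝓝 u₂) :=
    (continuous_snd.tendsto _).comp hu
  exact ⟨m ∘ φ, φ, u₁, u₂, hmt.comp hφt, hφt, hu₁, hu₂, key s₁ ζ₁ x₁ u₁ hs₁ hx₁ hζ₁ hd₁ hu₁,
    key s₂ ζ₂ x₂ u₂ hs₂ hx₂ hζ₂ hd₂ hu₂⟩

/-- Two limits of the limit evolution at the same time `t` lie in the same component if `t` is not an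
atom or if they have the same energy. -/
theorem joinedIn_of_tendsto [LocallyCompactSpace X] (h : HasComponentLimits T E η μbar Ebar K A)
    (hreg : EnergyRegular T E) (hcomp : CriticalComponents T E)
    (hξ : ∀ t, ∃ φ : ℕ → ℕ, StrictMono φ ∧ Tendsto (fun n => η (φ n) t) atTop (𝓝 (ξ t)))
    {t : Icc (0 : ℝ) T} {s₁ s₂ : ℕ → Icc (0 : ℝ) T} {x₁ x₂ : X} (hs₁ : Tendsto s₁ atTop (𝓝 t))
    (hs₂ : Tendsto s₂ atTop (𝓝 t)) (hx₁ : Tendsto (fun k => ξ (s₁ k)) atTop (𝓝 x₁))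
    (hx₂ : Tendsto (fun k => ξ (s₂ k)) atTop (𝓝 x₂)) (hor : μbar {t} = 0 ∨ E t x₁ = E t x₂) :
    JoinedIn (crit E t) x₁ x₂ := by
  obtain ⟨m, φ, u₁, u₂, hm, hφ, hu₁, hu₂, k₁, k₂⟩ :=
    h.exists_diagonal hreg hcomp hξ hs₁ hs₂ hx₁ hx₂
  exact k₁.symm.trans ((h.joinedIn m (s₁ ∘ φ) (s₂ ∘ φ) t u₁ u₂ hm (hs₁.comp hφ)
    (hs₂.comp hφ) hu₁ hu₂ (hor.imp_right fun he => by
      rw [hcomp.energy_eq t t.2 _ _ k₁, hcomp.energy_eq t t.2 _ _ k₂, he])).trans k₂)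

theorem continuousAt_limit [LocallyCompactSpace X] (h : HasComponentLimits T E η μbar Ebar K A)
    (hreg : EnergyRegular T E) (hcomp : CriticalComponents T E)
    (hξK : ∀ t, ξ t ∈ K)
    (hξ : ∀ t, ∃ φ : ℕ → ℕ, StrictMono φ ∧ Tendsto (fun n => η (φ n) t) atTop (𝓝 (ξ t)))
    {t : Icc (0 : ℝ) T} (ht : μbar {t} = 0) :
    ContinuousAt (fun s => cls T E s (ξ s)) t := by
  refine tendsto_of_seq_tendsto fun s hs => tendsto_of_subseq_tendsto fun ns hns => ?_
  obtain ⟨x, -, φ, hφ, hx⟩ := h.compact.tendsto_subseq fun n => hξK (s (ns n))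
  have hs' := hs.comp (hns.comp hφ.tendsto_atTop)
  refine ⟨φ, ?_⟩
  beta_reduce
  rw [(cls_eq_iff_of_mem (h.limit_mem_crit hξ t)).2 (h.joinedIn_of_tendsto hreg hcomp hξ
    tendsto_const_nhds hs' tendsto_const_nhds hx (Or.inl ht))]
  exact tendsto_cls hs' hx

/-- Convergence of the energies along a filter at `t` forces convergence in the quotient space. -/
theorem exists_tendsto_limit [LocallyCompactSpace X] (h : HasComponentLimits T E η μbar Ebar K A)
    (hreg : EnergyRegular T E) (hcomp : CriticalComponents T E)
    (hξK : ∀ t, ξ t ∈ K)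
    (hξ : ∀ t, ∃ φ : ℕ → ℕ, StrictMono φ ∧ Tendsto (fun n => η (φ n) t) atTop (𝓝 (ξ t)))
    {t : Icc (0 : ℝ) T} {l : Filter (Icc (0 : ℝ) T)} [l.NeBot] [l.IsCountablyGenerated]
    (hl : l ≤ 𝓝 t) {e : ℝ} (he : Tendsto Ebar l (𝓝 e)) :
    ∃ x, E t x = e ∧ Tendsto (fun s => cls T E s (ξ s)) l (𝓝 (cls T E t x)) ∧
      ∃ s : ℕ → Icc (0 : ℝ) T, Tendsto s atTop l ∧
        Tendsto (fun k => ξ (s k)) atTop (𝓝 x) := by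
  have hen : ∀ (s : ℕ → Icc (0 : ℝ) T) (x : X), Tendsto s atTop l →
      Tendsto (fun k => ξ (s k)) atTop (𝓝 x) → E t x = e := by
    intro s x hs hx
    refine tendsto_nhds_unique
      (tendsto_energyAlong hreg (η := fun _ => ξ) (hs.mono_right hl) hx) ?_
    exact (he.comp hs).congr fun k => (h.energy_limit hreg hξ (s k)).symm
  obtain ⟨r, hr⟩ := exists_seq_tendsto l
  obtain ⟨x, -, ψ, hψ, hx⟩ := h.compact.tendsto_subseq fun n => hξK (r n)
  have hr' := hr.comp hψ.tendsto_atTop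
  refine ⟨x, hen _ x hr' hx, tendsto_of_seq_tendsto fun s hs =>
    tendsto_of_subseq_tendsto fun ns hns => ?_, _, hr', hx⟩
  obtain ⟨y, -, φ, hφ, hy⟩ := h.compact.tendsto_subseq fun n => hξK (s (ns n))
  have hs' := hs.comp (hns.comp hφ.tendsto_atTop)
  refine ⟨φ, ?_⟩
  rw [(cls_eq_iff_of_mem (h.limit_mem_crit_of_tendsto hreg hξ (hr'.mono_right hl) hx)).2
    (h.joinedIn_of_tendsto hreg hcomp hξ (hr'.mono_right hl) (hs'.mono_right hl) hx hy
      (Or.inr ((hen _ x hr' hx).trans (hen _ y hs' hy).symm)))]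
  exact tendsto_cls (hs'.mono_right hl) hy

end HasComponentLimits

end Limits

/-! ### The energy balance of the limit -/

section Balance

variable {T : ℝ}

theorem exists_nonatom_between (μ : Measure (Icc (0 : ℝ) T)) [IsFiniteMeasure μ] {a b : ℝ}
    (ha : 0 ≤ a) (hab : a < b) (hb : b ≤ T) :
    ∃ s : Icc (0 : ℝ) T, μ {s} = 0 ∧ a < s ∧ (s : ℝ) < b := by
  have hc : (Subtype.val '' {t | 0 < μ {t}} : Set ℝ).Countable := (countable_atoms μ).image _
  obtain ⟨z, hz, hz'⟩ := (hc.dense_compl ℝ).exists_between hab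
  refine ⟨⟨z, ha.trans hz'.1.le, hz'.2.le.trans hb⟩, ?_, hz'.1, hz'.2⟩
  by_contra hne
  exact hz ⟨_, pos_iff_ne_zero.2 hne, rfl⟩

theorem tendsto_setIntegral_Iic {f : Icc (0 : ℝ) T → ℝ} {B : ℝ} (hf : Integrable f (leb T))
    (hB : ∀ᵐ t ∂(leb T), |f t| ≤ B) {s : ℕ → Icc (0 : ℝ) T} {t : Icc (0 : ℝ) T}
    (hs : Tendsto s atTop (𝓝 t)) :
    Tendsto (fun k => ∫ τ in Iic (s k), f τ ∂(leb T)) atTop (𝓝 (∫ τ in Iic t, f τ ∂(leb T))) := by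
  have hle : ∀ a b : Icc (0 : ℝ) T, a ≤ b →
      dist (∫ τ in Iic a, f τ ∂(leb T)) (∫ τ in Iic b, f τ ∂(leb T)) ≤ B * dist a b := by
    intro a b hab
    rw [dist_comm, Real.dist_eq, setIntegral_Iic_sub hf hab, dist_comm, Subtype.dist_eq,
      Real.dist_eq, abs_of_nonneg (sub_nonneg.2 (Subtype.coe_le_coe.2 hab))]
    exact abs_setIntegral_Ioc_le hB hab
  have h0 : Tendsto (fun k => B * dist (s k) t) atTop (𝓝 0) := by
    have h1 := (tendsto_iff_dist_tendsto_zero.1 hs).const_mul B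
    rwa [mul_zero] at h1
  refine tendsto_iff_dist_tendsto_zero.2 (squeeze_zero (fun _ => dist_nonneg) (fun k => ?_) h0)
  rcases le_total (s k) t with h | h
  · exact hle _ _ h
  · rw [dist_comm, dist_comm (s k)]
    exact hle _ _ h

theorem tendsto_coe_add_inv {t : Icc (0 : ℝ) T} {s : ℕ → Icc (0 : ℝ) T}
    (hs : ∀ k, |(s k : ℝ) - t| ≤ 1 / ((k : ℝ) + 1)) : Tendsto s atTop (𝓝 t) :=
  tendsto_iff_dist_tendsto_zero.2 (squeeze_zero (fun _ => dist_nonneg) hs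
    tendsto_one_div_add_atTop_nhds_zero_nat)

variable {X : Type*} [MetricSpace X] {E : ℝ → X → ℝ} {ω : ℝ → X → X} {x₀ : X} {δ : ℕ → ℝ}
  {μbar : Measure (Icc (0 : ℝ) T)} {Ebar D : Icc (0 : ℝ) T → ℝ} {K : Set X} {B : ℝ}
  {A : Set (Icc (0 : ℝ) T)}

namespace IsSelected

theorem integrable (h : IsSelected T E ω x₀ δ μbar Ebar D K B A) : Integrable D (leb T) :=
  h.conv.memLp.integrable le_top

theorem abs_powerAlong_le (h : IsSelected T E ω x₀ δ μbar Ebar D K B A) (n : ℕ)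
    (t : Icc (0 : ℝ) T) : |powerAlong E (evolution T ω x₀ (δ n)) t| ≤ B :=
  h.bound t t.2 _ (h.mem _ (h.pos n) t)

theorem energy_eq_of_tendsto (h : IsSelected T E ω x₀ δ μbar Ebar D K B A) (hT : 0 < T)
    (hreg : EnergyRegular T E) (hω : AxiomDecreasing T E ω) {t : Icc (0 : ℝ) T}
    (ht : Tendsto (fun n => (dropMeasure T E ω x₀ (δ n)).real (Iic t)) atTop
      (𝓝 (μbar.real (Iic t)))) :
    Ebar t = E 0 x₀ + (∫ τ in Iic t, D τ ∂(leb T)) - μbar.real (Iic t) := by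
  refine tendsto_nhds_unique (h.conv.energy t) ?_
  exact ((tendsto_const_nhds.add (h.conv.power.tendsto_setIntegral measurableSet_Iic)).sub
    ht).congr fun n => (energyAlong_eq hT hreg hω (h.pos n) t).symm

theorem energy_eq (h : IsSelected T E ω x₀ δ μbar Ebar D K B A) (hT : 0 < T)
    (hreg : EnergyRegular T E) (hω : AxiomDecreasing T E ω) {t : Icc (0 : ℝ) T}
    (ht : μbar {t} = 0) :
    Ebar t = E 0 x₀ + (∫ τ in Iic t, D τ ∂(leb T)) - μbar.real (Iic t) := by
  have := h.conv.finite
  have : ∀ n, IsFiniteMeasure (dropMeasure T E ω x₀ (δ n)) :=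
    fun n => isFiniteMeasure_dropMeasure hT hreg (h.pos n)
  exact h.energy_eq_of_tendsto hT hreg hω (h.conv.measure.tendsto_real_Iic ht)

theorem energy_last (h : IsSelected T E ω x₀ δ μbar Ebar D K B A) (hT : 0 < T)
    (hreg : EnergyRegular T E) (hω : AxiomDecreasing T E ω) {t : Icc (0 : ℝ) T}
    (ht : (t : ℝ) = T) :
    Ebar t = E 0 x₀ + (∫ τ in Iic t, D τ ∂(leb T)) - μbar.real (Iic t) := by
  refine h.energy_eq_of_tendsto hT hreg hω ?_
  have hu : (Iic t : Set (Icc (0 : ℝ) T)) = univ :=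
    eq_univ_of_forall fun s => s.2.2.trans ht.ge
  rw [hu]
  exact h.conv.measure.tendsto_real_univ

theorem setIntegral_Iic_first {t : Icc (0 : ℝ) T} (ht : (t : ℝ) = 0) (f : Icc (0 : ℝ) T → ℝ) :
    ∫ τ in Iic t, f τ ∂(leb T) = 0 := by
  have hu : (Iic t : Set (Icc (0 : ℝ) T)) = {t} := by
    ext s
    refine ⟨fun hs => le_antisymm hs ?_, fun hs => le_of_eq hs⟩
    exact Subtype.coe_le_coe.1 (ht.le.trans s.2.1)
  rw [hu]
  exact setIntegral_measure_zero _ (measure_singleton t)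

theorem energy_first (h : IsSelected T E ω x₀ δ μbar Ebar D K B A) {t : Icc (0 : ℝ) T}
    (ht : (t : ℝ) = 0) :
    Ebar t = E 0 x₀ + (∫ τ in Iic t, D τ ∂(leb T)) - μbar.real (Iio t) := by
  have hu : (Iio t : Set (Icc (0 : ℝ) T)) = ∅ :=
    eq_empty_of_forall_notMem fun s hs =>
      absurd (Subtype.coe_lt_coe.2 (show s < t from hs)) (by rw [ht]; exact not_lt.2 s.2.1)
  rw [setIntegral_Iic_first ht, hu, measureReal_empty, add_zero, sub_zero]
  refine tendsto_nhds_unique (h.conv.energy t) (tendsto_const_nhds.congr fun n => ?_)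
  rw [energyAlong, evolution, ht, zero_div, Nat.floor_zero, Nat.zero_min]
  rfl

/-- The right limit of the limit energy, computed along times that are not atoms. -/
theorem energy_right (h : IsSelected T E ω x₀ δ μbar Ebar D K B A) (hT : 0 < T)
    (hreg : EnergyRegular T E) (hω : AxiomDecreasing T E ω) {t : Icc (0 : ℝ) T}
    (ht : (t : ℝ) < T) {e : ℝ} (he : Tendsto Ebar (𝓝[>] t) (𝓝 e)) :
    e = E 0 x₀ + (∫ τ in Iic t, D τ ∂(leb T)) - μbar.real (Iic t) := by
  have := h.conv.finite
  have hlt : ∀ k : ℕ, (t : ℝ) < min T (t + 1 / ((k : ℝ) + 1)) := fun k =>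
    lt_min ht (lt_add_of_pos_right _ (by positivity))
  choose s hs0 hts hsk using fun k : ℕ =>
    exists_nonatom_between μbar t.2.1 (hlt k) (min_le_left _ _)
  have hst : Tendsto s atTop (𝓝 t) := tendsto_coe_add_inv fun k => by
    rw [abs_of_pos (sub_pos.2 (hts k)), sub_le_iff_le_add']
    exact (hsk k).le.trans (min_le_right _ _)
  have hμ : Tendsto (fun k => μbar.real (Iic (s k))) atTop (𝓝 (μbar.real (Iic t))) := by
    refine tendsto_of_tendsto_of_tendsto_of_le_of_le tendsto_const_nhds
      (tendsto_real_Iic_right (μ := μbar) t) (fun k => ?_) fun k => ?_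
    · exact measureReal_mono (Iic_subset_Iic.2 (hts k).le)
    · refine measureReal_mono fun u hu => ?_
      exact (Subtype.coe_le_coe.2 (show u ≤ s k from hu)).trans
        ((hsk k).le.trans (min_le_right _ _))
  have hs' : Tendsto s atTop (𝓝[>] t) :=
    tendsto_nhdsWithin_iff.2 ⟨hst, Eventually.of_forall fun k => Subtype.coe_lt_coe.1 (hts k)⟩
  refine tendsto_nhds_unique (he.comp hs') ?_
  exact ((tendsto_const_nhds.add (tendsto_setIntegral_Iic h.integrable h.power_bound hst)).sub
    hμ).congr fun k => (h.energy_eq hT hreg hω (hs0 k)).symm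

/-- The left limit of the limit energy, computed along times that are not atoms. -/
theorem energy_left (h : IsSelected T E ω x₀ δ μbar Ebar D K B A) (hT : 0 < T)
    (hreg : EnergyRegular T E) (hω : AxiomDecreasing T E ω) {t : Icc (0 : ℝ) T}
    (ht : 0 < (t : ℝ)) {e : ℝ} (he : Tendsto Ebar (𝓝[<] t) (𝓝 e)) :
    e = E 0 x₀ + (∫ τ in Iic t, D τ ∂(leb T)) - μbar.real (Iio t) := by
  have := h.conv.finite
  have hlt : ∀ k : ℕ, max 0 ((t : ℝ) - 1 / ((k : ℝ) + 1)) < t := fun k =>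
    max_lt ht (sub_lt_self _ (by positivity))
  choose s hs0 hsk hts using fun k : ℕ =>
    exists_nonatom_between μbar (le_max_left _ _) (hlt k) t.2.2
  have hst : Tendsto s atTop (𝓝 t) := tendsto_coe_add_inv fun k => by
    rw [abs_sub_comm, abs_of_pos (sub_pos.2 (hts k)), sub_le_comm]
    exact (le_max_right _ _).trans (hsk k).le
  have hμ : Tendsto (fun k => μbar.real (Iic (s k))) atTop (𝓝 (μbar.real (Iio t))) := by
    refine tendsto_of_tendsto_of_tendsto_of_le_of_le (tendsto_real_Iic_left (μ := μbar) t)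
      tendsto_const_nhds (fun k => ?_) fun k => ?_
    · refine measureReal_mono fun u hu => ?_
      have hu' : (u : ℝ) ≤ t - 1 / ((k : ℝ) + 1) := hu
      exact Subtype.coe_le_coe.1 (hu'.trans ((le_max_right _ _).trans (hsk k).le))
    · refine measureReal_mono fun u hu => ?_
      exact lt_of_le_of_lt (show u ≤ s k from hu) (Subtype.coe_lt_coe.1 (hts k))
  have hs' : Tendsto s atTop (𝓝[<] t) :=
    tendsto_nhdsWithin_iff.2 ⟨hst, Eventually.of_forall fun k => Subtype.coe_lt_coe.1 (hts k)⟩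
  refine tendsto_nhds_unique (he.comp hs') ?_
  exact ((tendsto_const_nhds.add (tendsto_setIntegral_Iic h.integrable h.power_bound hst)).sub
    hμ).congr fun k => (h.energy_eq hT hreg hω (hs0 k)).symm

variable [LocallyCompactSpace X] {ξ : Icc (0 : ℝ) T → X}

/-- The left limit of the limit evolution: its energy, and its attainment along times up to `t`. At
`t = 0` the left limit is the value. -/
theorem exists_leftLim (h : IsSelected T E ω x₀ δ μbar Ebar D K B A) (hT : 0 < T)
    (hreg : EnergyRegular T E) (hcomp : CriticalComponents T E) (hω : AxiomDecreasing T E ω)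
    (hlim : HasComponentLimits T E (fun n => evolution T ω x₀ (δ n)) μbar Ebar K A)
    (hξK : ∀ t, ξ t ∈ K) (hξ : ∀ t, ∃ φ : ℕ → ℕ, StrictMono φ ∧
      Tendsto (fun n => evolution T ω x₀ (δ (φ n)) t) atTop (𝓝 (ξ t)))
    (t : Icc (0 : ℝ) T) :
    ∃ x, Function.leftLim (fun s => cls T E s (ξ s)) t = cls T E t x ∧
      E t x = E 0 x₀ + (∫ τ in Iic t, D τ ∂(leb T)) - μbar.real (Iio t) ∧
      (0 < (t : ℝ) → Tendsto (fun s => cls T E s (ξ s)) (𝓝[<] t) (𝓝 (cls T E t x))) ∧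
      ∃ s : ℕ → Icc (0 : ℝ) T, (∀ k, s k ≤ t) ∧ Tendsto s atTop (𝓝 t) ∧
        Tendsto (fun k => ξ (s k)) atTop (𝓝 x) := by
  have := t2Space_quotSpace hcomp hreg
  rcases t.2.1.eq_or_lt with ht | ht
  · refine ⟨ξ t, leftLim_eq_of_isBot fun s => Subtype.coe_le_coe.1 (ht.ge.trans s.2.1), ?_,
      fun h' => absurd ht h'.ne, fun _ => t, fun _ => le_rfl, tendsto_const_nhds,
      tendsto_const_nhds⟩
    rw [hlim.energy_limit hreg hξ, h.energy_first ht.symm]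
  · have hne : (𝓝[<] t).NeBot :=
      nhdsLT_neBot_of_exists_lt ⟨⟨0, le_rfl, hT.le⟩, Subtype.coe_lt_coe.1 ht⟩
    obtain ⟨e, he⟩ := h.conv.bounded_variation.exists_tendsto_left t
    rw [univ_inter] at he
    obtain ⟨x, hxe, hx, s, hs, hsx⟩ :=
      hlim.exists_tendsto_limit hreg hcomp hξK hξ nhdsWithin_le_nhds he
    obtain ⟨N, hN⟩ := eventually_atTop.1 (tendsto_nhdsWithin_iff.1 hs).2
    exact ⟨x, leftLim_eq_of_tendsto hx, hxe.trans (h.energy_left hT hreg hω ht he), fun _ => hx,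
      fun k => s (k + N), fun k => (show s (k + N) < t from hN _ (Nat.le_add_left _ _)).le,
      (tendsto_nhdsWithin_iff.1 hs).1.comp (tendsto_add_atTop_nat N),
      hsx.comp (tendsto_add_atTop_nat N)⟩

/-- The right limit of the limit evolution: its energy, and its attainment along times from `t` on. At
`t = T` the right limit is the value. -/
theorem exists_rightLim (h : IsSelected T E ω x₀ δ μbar Ebar D K B A) (hT : 0 < T)
    (hreg : EnergyRegular T E) (hcomp : CriticalComponents T E) (hω : AxiomDecreasing T E ω)
    (hlim : HasComponentLimits T E (fun n => evolution T ω x₀ (δ n)) μbar Ebar K A)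
    (hξK : ∀ t, ξ t ∈ K) (hξ : ∀ t, ∃ φ : ℕ → ℕ, StrictMono φ ∧
      Tendsto (fun n => evolution T ω x₀ (δ (φ n)) t) atTop (𝓝 (ξ t)))
    (t : Icc (0 : ℝ) T) :
    ∃ x, Function.rightLim (fun s => cls T E s (ξ s)) t = cls T E t x ∧
      E t x = E 0 x₀ + (∫ τ in Iic t, D τ ∂(leb T)) - μbar.real (Iic t) ∧
      ((t : ℝ) < T → Tendsto (fun s => cls T E s (ξ s)) (𝓝[>] t) (𝓝 (cls T E t x))) ∧
      ∃ s : ℕ → Icc (0 : ℝ) T, (∀ k, t ≤ s k) ∧ Tendsto s atTop (𝓝 t) ∧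
        Tendsto (fun k => ξ (s k)) atTop (𝓝 x) := by
  have := t2Space_quotSpace hcomp hreg
  rcases t.2.2.eq_or_lt with ht | ht
  · refine ⟨ξ t, rightLim_eq_of_isTop fun s => Subtype.coe_le_coe.1 (s.2.2.trans ht.ge), ?_,
      fun h' => absurd ht h'.ne, fun _ => t, fun _ => le_rfl, tendsto_const_nhds,
      tendsto_const_nhds⟩
    rw [hlim.energy_limit hreg hξ, h.energy_last hT hreg hω ht]
  · have hne : (𝓝[>] t).NeBot :=
      nhdsGT_neBot_of_exists_gt ⟨⟨T, hT.le, le_rfl⟩, Subtype.coe_lt_coe.1 ht⟩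
    obtain ⟨e, he⟩ := h.conv.bounded_variation.exists_tendsto_right t
    rw [univ_inter] at he
    obtain ⟨x, hxe, hx, s, hs, hsx⟩ :=
      hlim.exists_tendsto_limit hreg hcomp hξK hξ nhdsWithin_le_nhds he
    obtain ⟨N, hN⟩ := eventually_atTop.1 (tendsto_nhdsWithin_iff.1 hs).2
    exact ⟨x, rightLim_eq_of_tendsto hx, hxe.trans (h.energy_right hT hreg hω ht he), fun _ => hx,
      fun k => s (k + N), fun k => (show t < s (k + N) from hN _ (Nat.le_add_left _ _)).le,
      (tendsto_nhdsWithin_iff.1 hs).1.comp (tendsto_add_atTop_nat N),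
      hsx.comp (tendsto_add_atTop_nat N)⟩

end IsSelected

/-- The difference of the right and left energies is the energy balance on a closed interval. -/
theorem setIntegral_sub_measure_Icc {f : Icc (0 : ℝ) T → ℝ} (hf : Integrable f (leb T))
    [IsFiniteMeasure μbar] {s t : Icc (0 : ℝ) T} (hst : s ≤ t) (e : ℝ) :
    (e + (∫ τ in Iic t, f τ ∂(leb T)) - μbar.real (Iic t)) -
      (e + (∫ τ in Iic s, f τ ∂(leb T)) - μbar.real (Iio s)) =
        (∫ τ in Icc s t, f τ ∂(leb T)) - μbar.real (Icc s t) := by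
  have h1 := setIntegral_Iic_sub hf hst
  have h2 : μbar.real (Iic t) = μbar.real (Iio s) + μbar.real (Icc s t) := by
    rw [← measureReal_union _ measurableSet_Icc, Iio_union_Icc_eq_Iic hst]
    exact disjoint_left.2 fun u hu hu' =>
      (lt_irrefl u) (lt_of_lt_of_le (show u < s from hu) hu'.1)
  rw [integral_Icc_eq_integral_Ioc]
  linarith

end Balance

/-! ### Jumps and the action -/

section Jumps

variable {T : ℝ} {X : Type*} [MetricSpace X] [LocallyCompactSpace X] {E : ℝ → X → ℝ}
  {ω : ℝ → X → X} {x₀ : X} {δ : ℕ → ℝ} {μbar : Measure (Icc (0 : ℝ) T)}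
  {Ebar D : Icc (0 : ℝ) T → ℝ} {K : Set X} {B : ℝ} {A : Set (Icc (0 : ℝ) T)}
  {ξ : Icc (0 : ℝ) T → X} {c : ℝ → X → X → ℝ}

/-- The two sides of a jump are connected at the cost of their energy difference. -/
theorem IsSelected.action_eq (h : IsSelected T E ω x₀ δ μbar Ebar D K B A) (hT : 0 < T)
    (hreg : EnergyRegular T E) (hcomp : CriticalComponents T E)
    (hlim : HasComponentLimits T E (fun n => evolution T ω x₀ (δ n)) μbar Ebar K A)
    (hξ : ∀ t, ∃ φ : ℕ → ℕ, StrictMono φ ∧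
      Tendsto (fun n => evolution T ω x₀ (δ (φ n)) t) atTop (𝓝 (ξ t)))
    (hc : AxiomTimeStable T E ω c) {t : Icc (0 : ℝ) T} {s₁ s₂ : ℕ → Icc (0 : ℝ) T} {x₁ x₂ : X}
    (hs₁ : Tendsto s₁ atTop (𝓝 t)) (hs₂ : Tendsto s₂ atTop (𝓝 t)) (h₁ : ∀ k, s₁ k ≤ t)
    (h₂ : ∀ k, t ≤ s₂ k) (hx₁ : Tendsto (fun k => ξ (s₁ k)) atTop (𝓝 x₁))
    (hx₂ : Tendsto (fun k => ξ (s₂ k)) atTop (𝓝 x₂)) : c t x₁ x₂ = E t x₁ - E t x₂ := by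
  obtain ⟨m, φ, u₁, u₂, hm, hφ, hu₁, hu₂, j₁, j₂⟩ :=
    hlim.exists_diagonal hreg hcomp hξ hs₁ hs₂ hx₁ hx₂
  have hle := hc.action_le hT hreg (δ := δ ∘ m) (fun n => h.pos _) h.compact h.mem
    (fun n t => h.abs_powerAlong_le (m n) t) (hs₁.comp hφ) (hs₂.comp hφ)
    (fun n => (h₁ _).trans (h₂ _)) hu₁ hu₂ j₁.source_mem
  rw [hc.congr t.2 (Or.inr j₁) (Or.inr j₂), hcomp.energy_eq t t.2 _ _ j₁,
    hcomp.energy_eq t t.2 _ _ j₂] at hle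
  exact le_antisymm hle (hc.action.drop_le t t.2 _ _)

end Jumps

/-! ### Difference quotients of the energy along the limit -/

section Quotients

variable {T : ℝ} {X : Type*} {E : ℝ → X → ℝ}

theorem energy_quotient_eq {s t : Icc (0 : ℝ) T} (x y : X) :
    (E s y - E t x) / ((s : ℝ) - t) =
      (E s y - E t y) / ((s : ℝ) - t) + (E t y - E t x) / ((s : ℝ) - t) := by
  rw [← add_div]
  ring

variable [MetricSpace X]

theorem secondCountableTopology_of_coercive (hcoer : Coercive T E) :
    SecondCountableTopology X := by
  have : SigmaCompactSpace X := by
    refine ⟨⟨fun n : ℕ => {x : X | ⨆ t : Icc (0 : ℝ) T, |E t x| ≤ n}, fun n => hcoer n, ?_⟩⟩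
    refine iUnion_eq_univ_iff.2 fun x => ?_
    exact exists_nat_ge (⨆ t : Icc (0 : ℝ) T, |E t x|)
  exact EMetric.secondCountable_of_sigmaCompact X

/-- An uncountable set in a separable metric space contains one of its accumulation points. -/
theorem exists_seq_tendsto_of_not_countable {Z : Type*} [MetricSpace Z]
    [SecondCountableTopology Z] {P : Set Z} (hP : ¬ P.Countable) :
    ∃ p ∈ P, ∃ z : ℕ → Z, (∀ n, z n ∈ P ∧ z n ≠ p) ∧ Tendsto z atTop (𝓝 p) := by
  by_contra! hcon
  have : DiscreteTopology P := by
    rw [discreteTopology_subtype_iff]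
    intro p hp
    by_contra hne
    have hmem : p ∈ closure (P \ {p}) := by
      rw [mem_closure_iff_nhdsWithin_neBot, sdiff_eq, inter_comm, nhdsWithin_inter']
      exact neBot_iff.2 hne
    obtain ⟨z, hz, hzp⟩ := mem_closure_iff_seq_limit.1 hmem
    exact hcon p hp z (fun n => ⟨(hz n).1, (hz n).2⟩) hzp
  exact hP (countable_coe_iff.1 countable_of_Lindelof_of_discrete)

/-- Along critical points the slope of `E t` is at most of the order of the time difference, so
that an error controlled by `o(1)` times the slope does not contribute to difference quotients. -/
theorem SlopeTimeLipschitz.tendsto_error (h : SlopeTimeLipschitz T E) (hreg : EnergyRegular T E)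
    {s : ℕ → Icc (0 : ℝ) T} {y : ℕ → X} {t : Icc (0 : ℝ) T} {x : X}
    (hy : Tendsto y atTop (𝓝 x)) (hne : ∀ k, s k ≠ t)
    (hcrit : ∀ k, y k ∈ crit E (s k)) {ε : ℝ → ℝ} (hpos : ∀ r, 0 ≤ r → 0 ≤ ε r) (h0 : ε 0 = 0)
    (hε : Tendsto ε (𝓝[>] 0) (𝓝 0)) :
    Tendsto (fun k => ε (dist x (y k)) * (descSlope E t (y k)).toReal / |(s k : ℝ) - t|) atTop
      (𝓝 0) := by
  obtain ⟨U, hU, C, hC⟩ := h x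
  have hε' : Tendsto ε (𝓝[≥] 0) (𝓝 0) := by
    rw [← Ioi_insert, nhdsWithin_insert]
    exact tendsto_sup.2 ⟨by simpa only [h0] using tendsto_pure_nhds ε 0, hε⟩
  have hd : Tendsto (fun k => dist x (y k)) atTop (𝓝[≥] 0) := by
    refine tendsto_nhdsWithin_iff.2 ⟨?_, Eventually.of_forall fun _ => dist_nonneg⟩
    have h1 := (tendsto_const_nhds (x := x)).dist hy
    rwa [dist_self] at h1
  have hlim : Tendsto (fun k => ε (dist x (y k)) * C) atTop (𝓝 0) := by
    have h1 := (hε'.comp hd).mul_const C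
    rwa [zero_mul] at h1
  refine squeeze_zero' (Eventually.of_forall fun k => ?_) ?_ hlim
  · exact div_nonneg (mul_nonneg (hpos _ dist_nonneg) ENNReal.toReal_nonneg) (abs_nonneg _)
  · filter_upwards [hy hU] with k hk
    have hpos' : 0 < |(s k : ℝ) - t| :=
      abs_pos.2 (sub_ne_zero.2 fun he => hne k (Subtype.ext he))
    have h1 := hC (y k) hk (s k) (s k).2 t t.2
    rw [(mem_crit_iff_toReal hreg (s k).2).1 (hcrit k), zero_sub, abs_neg,
      abs_of_nonneg ENNReal.toReal_nonneg] at h1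
    rw [div_le_iff₀ hpos', mul_assoc]
    exact mul_le_mul_of_nonneg_left h1 (hpos _ dist_nonneg)

theorem TwoSidedSlopeIneq.tendsto_quotient (h : TwoSidedSlopeIneq T E) (hreg : EnergyRegular T E)
    {s : ℕ → Icc (0 : ℝ) T} {y : ℕ → X} {t : Icc (0 : ℝ) T} {x : X} (hs : Tendsto s atTop (𝓝 t))
    (hy : Tendsto y atTop (𝓝 x)) (hne : ∀ k, s k ≠ t) (hcrit : ∀ k, y k ∈ crit E (s k)) :
    Tendsto (fun k => (E (s k) (y k) - E t x) / ((s k : ℝ) - t)) atTop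
      (𝓝 (timeDeriv T E t x)) := by
  have hx : x ∈ crit E t := mem_crit_of_tendsto hreg hs hy (Eventually.of_forall hcrit)
  obtain ⟨U, hU, ε, hpos, h0, hε, hineq⟩ := h.ineq t t.2 x hx
  have herr := h.lipschitz.tendsto_error hreg hy hne hcrit hpos h0 hε
  have h1 : Tendsto (fun k => (E t (y k) - E t x) / ((s k : ℝ) - t)) atTop (𝓝 0) := by
    refine squeeze_zero_norm' ?_ herr
    filter_upwards [hy hU] with k hk
    rw [Real.norm_eq_abs, abs_div]
    exact div_le_div_of_nonneg_right (hineq _ hk) (abs_nonneg _)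
  simp_rw [energy_quotient_eq x]
  have h2 := (hreg.tendsto_slope hs hy hne).add h1
  rwa [add_zero] at h2

/-- The lower right derivative of the energy along critical points is at least the power. -/
theorem OneSidedSlopeIneq.exists_le_quotient (h : OneSidedSlopeIneq T E)
    (hreg : EnergyRegular T E)
    {s : ℕ → Icc (0 : ℝ) T} {y : ℕ → X} {t : Icc (0 : ℝ) T} {x : X} (hs : Tendsto s atTop (𝓝 t))
    (hy : Tendsto y atTop (𝓝 x)) (hlt : ∀ k, t < s k) (hcrit : ∀ k, y k ∈ crit E (s k)) :
    ∃ a : ℕ → ℝ, Tendsto a atTop (𝓝 (timeDeriv T E t x)) ∧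
      ∀ᶠ k in atTop, a k ≤ (E (s k) (y k) - E t x) / ((s k : ℝ) - t) := by
  have hx : x ∈ crit E t := mem_crit_of_tendsto hreg hs hy (Eventually.of_forall hcrit)
  have hne : ∀ k, s k ≠ t := fun k => (hlt k).ne'
  obtain ⟨U, hU, ε, hpos, h0, hε, hineq⟩ := h.ineq t t.2 x hx
  have herr := h.lipschitz.tendsto_error hreg hy hne hcrit hpos h0 hε
  refine ⟨_, by simpa only [sub_zero] using (hreg.tendsto_slope hs hy hne).sub herr, ?_⟩
  filter_upwards [hy hU] with k hk
  have hk0 : (0 : ℝ) < s k - t := sub_pos.2 (Subtype.coe_lt_coe.2 (hlt k))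
  rw [energy_quotient_eq x, abs_of_pos hk0, sub_eq_add_neg, ← neg_div]
  exact add_le_add le_rfl (div_le_div_of_nonneg_right (hineq _ hk) hk0.le)

/-- The power is constant on the component of the limit, except at countably many times. Otherwise
there is an accumulation point of exceptional triples `(t, x, y)`, and the difference quotients of
`Ebar` at this `t` converge to the power at `x` as well as to the power at `y`. -/
theorem TwoSidedSlopeIneq.countable_timeDeriv_ne (h : TwoSidedSlopeIneq T E)
    (hreg : EnergyRegular T E) (hcoer : Coercive T E) (hcomp : CriticalComponents T E)
    (ξ : Icc (0 : ℝ) T → X) :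
    {t : Icc (0 : ℝ) T | ∃ y, JoinedIn (crit E t) (ξ t) y ∧
      timeDeriv T E t y ≠ timeDeriv T E t (ξ t)}.Countable := by
  have := secondCountableTopology_of_coercive hcoer
  by_contra hS
  set S := {t : Icc (0 : ℝ) T | ∃ y, JoinedIn (crit E t) (ξ t) y ∧
      timeDeriv T E t y ≠ timeDeriv T E t (ξ t)} with hSdef
  have hmem : ∀ t : S, ∃ y, JoinedIn (crit E t) (ξ t) y ∧
      timeDeriv T E t y ≠ timeDeriv T E t (ξ t) := fun t => t.2
  choose y hy hne using hmem
  let f : S → Icc (0 : ℝ) T × X × X := fun t => (t, ξ t, y t)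
  have hf : ∀ t u : S, f t = f u → t = u := fun t u he => Subtype.ext (congrArg Prod.fst he)
  have hP : ¬ (range f).Countable := by
    intro hc
    have : Countable (range f) := hc.to_subtype
    have hinj : Function.Injective (rangeFactorization f) := fun t u he =>
      hf t u (congrArg Subtype.val he)
    exact hS (countable_coe_iff.1 hinj.countable)
  obtain ⟨p, ⟨t, rfl⟩, z, hz, hzt⟩ := exists_seq_tendsto_of_not_countable hP
  choose u hu using fun n => (hz n).1
  have hut : Tendsto (fun n => f (u n)) atTop (𝓝 (f t)) := hzt.congr fun n => (hu n).symm
  have hune : ∀ n, (u n : Icc (0 : ℝ) T) ≠ t := fun n he => (hz n).2 (by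
    rw [← hu n, Subtype.ext he])
  have h1 : Tendsto (fun n => (u n : Icc (0 : ℝ) T)) atTop (𝓝 t) :=
    (continuous_fst.tendsto _).comp hut
  have h2 : Tendsto (fun n => ξ (u n)) atTop (𝓝 (ξ t)) :=
    ((continuous_fst.comp continuous_snd).tendsto _).comp hut
  have h3 : Tendsto (fun n => y (u n)) atTop (𝓝 (y t)) :=
    ((continuous_snd.comp continuous_snd).tendsto _).comp hut
  have h4 := h.tendsto_quotient hreg h1 h2 hune fun n => (hy (u n)).source_mem
  have h5 := h.tendsto_quotient hreg h1 h3 hune fun n => (hy (u n)).target_mem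
  refine hne t (tendsto_nhds_unique (h5.congr fun n => ?_) h4)
  rw [hcomp.energy_eq t t.1.2 _ _ (hy t), hcomp.energy_eq (u n) (u n).1.2 _ _ (hy (u n))]

end Quotients

/-! ### Measures with vanishing right density off their atoms -/

section Atomic

theorem eventually_measure_Ioc_le (m : Measure ℝ) [IsFiniteMeasure m] (x : ℝ) {a : ENNReal}
    (ha : 0 < a) : ∀ᶠ u in 𝓝[>] x, m (Ioc x u) ≤ a := by
  have hlim : Tendsto (fun k : ℕ => m (Ioc x (x + 1 / ((k : ℝ) + 1)))) atTop (𝓝 0) := by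
    have hempty : ⋂ k : ℕ, Ioc x (x + 1 / ((k : ℝ) + 1)) = ∅ := by
      refine eq_empty_of_forall_notMem fun u hu => ?_
      rw [mem_iInter] at hu
      obtain ⟨k, hk⟩ := exists_nat_one_div_lt (sub_pos.2 (hu 0).1)
      have := (hu k).2
      linarith
    rw [← measure_empty (μ := m), ← hempty]
    refine tendsto_measure_iInter_atTop (fun k => measurableSet_Ioc.nullMeasurableSet) ?_
      ⟨0, measure_ne_top _ _⟩
    intro j k hjk
    refine Ioc_subset_Ioc_right (add_le_add le_rfl ?_)
    exact one_div_le_one_div_of_le (by positivity) (by exact_mod_cast Nat.succ_le_succ hjk)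
  obtain ⟨k, hk⟩ := (hlim.eventually_lt_const ha).exists
  have hpos : (0 : ℝ) < 1 / ((k : ℝ) + 1) := by positivity
  filter_upwards [Ioc_mem_nhdsGT (lt_add_of_pos_right x hpos)] with u hu
  exact (measure_mono (Ioc_subset_Ioc_right hu.2)).trans hk.le

/-- A finite measure is carried by the set `J` of its atoms, if at every other point it has zero
right density. The part of the measure off `J` is compared, on `[0, u]`, with `ε` times `u` plus the
mass of the atoms before `u`; this comparison propagates to the right at the points off `J` by the
density assumption, and at the points of `J` because the comparison function jumps. -/
theorem measure_diff_atoms_eq_zero (m : Measure ℝ) [IsFiniteMeasure m] {T : ℝ} (hT : 0 ≤ T)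
    {J : Set ℝ} (hatom : ∀ x ∈ J, 0 < m {x})
    (hnot : ∀ x ∉ J, m {x} = 0)
    (hdens : ∀ x ∈ Ico 0 T, x ∉ J → ∀ ε > 0, ∀ᶠ u in 𝓝[>] x,
      m (Ioc x u) ≤ ENNReal.ofReal (ε * (u - x))) :
    m (Icc 0 T \ J) = 0 := by
  have key : ∀ ε : ℝ, 0 < ε → m (Icc 0 T \ J) ≤ ENNReal.ofReal ε * (ENNReal.ofReal T + m univ) := by
    intro ε hε
    let φ : ℝ → ENNReal := fun u => ENNReal.ofReal ε * (ENNReal.ofReal u + m (Ico 0 u ∩ J))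
    have hφ : Monotone φ := fun u v huv => by
      refine mul_le_mul_right ?_ _
      exact add_le_add (ENNReal.ofReal_le_ofReal huv)
        (measure_mono (inter_subset_inter_left _ (Ico_subset_Ico_right huv)))
    let s : Set ℝ := {t | ∀ u ∈ Icc 0 t, m (Icc 0 u \ J) ≤ φ u}
    have hadd : ∀ x ∈ Ico 0 T, ∀ u, x < u → m (Icc 0 u \ J) ≤ m (Icc 0 x \ J) + m (Ioc x u) := by
      intro x hx u hxu
      refine (measure_mono ?_).trans (measure_union_le _ _)
      rintro v ⟨hv, hvJ⟩
      rcases le_or_gt v x with h | h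
      · exact Or.inl ⟨⟨hv.1, h⟩, hvJ⟩
      · exact Or.inr ⟨h, hv.2⟩
    have hsub : Icc 0 T ⊆ s := by
      refine IsClosed.Icc_subset_of_forall_mem_nhdsWithin ?_ ?_ ?_
      · refine isClosed_of_closure_subset fun t ht => ?_
        obtain ⟨v, hv, hvt⟩ := mem_closure_iff_seq_limit.1 ht
        have htT : t ∈ Icc 0 T :=
          isClosed_Icc.mem_of_tendsto hvt (Eventually.of_forall fun n => (hv n).2)
        refine ⟨fun u hu => ?_, htT⟩
        by_cases hex : ∃ n, u ≤ v n
        · obtain ⟨n, hn⟩ := hex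
          exact (hv n).1 u ⟨hu.1, hn⟩
        · push Not at hex
          -- here `u` is a limit from the left, and it carries no mass off `J`
          have hlt : ∀ w < u, m (Icc 0 w \ J) ≤ φ u := by
            intro w hw
            obtain ⟨n, hn⟩ := (hvt.eventually_const_lt (hw.trans_le hu.2)).exists
            rcases le_or_gt 0 w with h0 | h0
            · exact ((hv n).1 w ⟨h0, hn.le⟩).trans (hφ hw.le)
            · rw [Icc_eq_empty (not_le.2 h0), empty_sdiff, measure_empty]
              exact zero_le
          obtain ⟨w, hwm, hwu, hwt⟩ := exists_seq_strictMono_tendsto u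
          have hcover : Icc 0 u \ J ⊆ (⋃ n, Icc 0 (w n) \ J) ∪ ({u} \ J) := by
            rintro z ⟨hz, hzJ⟩
            rcases hz.2.eq_or_lt with h | h
            · exact Or.inr ⟨h, hzJ⟩
            · obtain ⟨n, hn⟩ := (hwt.eventually_const_lt h).exists
              exact Or.inl (mem_iUnion.2 ⟨n, ⟨hz.1, hn.le⟩, hzJ⟩)
          have hu0 : m ({u} \ J) = 0 := by
            by_cases huJ : u ∈ J
            · rw [sdiff_eq_bot_iff.2 (singleton_subset_iff.2 huJ)]
              exact measure_empty
            · exact measure_mono_null sdiff_subset (hnot u huJ)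
          refine (measure_mono hcover).trans ((measure_union_le _ _).trans ?_)
          rw [hu0, add_zero, Monotone.measure_iUnion]
          · exact iSup_le fun n => hlt _ (hwu n)
          · intro i j hij
            exact sdiff_subset_sdiff_left (Icc_subset_Icc_right (hwm.monotone hij))
      · intro u hu
        rw [Icc_self, mem_singleton_iff] at hu
        subst hu
        by_cases h0 : (0 : ℝ) ∈ J
        · rw [Icc_self, sdiff_eq_bot_iff.2 (singleton_subset_iff.2 h0)]
          exact measure_empty.trans_le zero_le
        · rw [Icc_self]
          exact (measure_mono_null sdiff_subset (hnot 0 h0)).trans_le zero_le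
      · rintro x ⟨hxs, hx⟩
        have hstep : ∀ᶠ u in 𝓝[>] x, φ x + m (Ioc x u) ≤ φ u := by
          by_cases hxJ : x ∈ J
          · have hpos : 0 < ENNReal.ofReal ε * m {x} :=
              ENNReal.mul_pos (ENNReal.ofReal_pos.2 hε).ne' (hatom x hxJ).ne'
            filter_upwards [eventually_measure_Ioc_le m x hpos, self_mem_nhdsWithin] with u hu hxu
            refine (add_le_add le_rfl hu).trans ?_
            rw [← mul_add, add_assoc]
            refine mul_le_mul_right (add_le_add (ENNReal.ofReal_le_ofReal (le_of_lt hxu)) ?_) _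
            rw [← measure_union _ (measurableSet_singleton x)]
            · refine measure_mono ?_
              rintro v (⟨hv, hvJ⟩ | hv)
              · exact ⟨⟨hv.1, hv.2.trans hxu⟩, hvJ⟩
              · rw [mem_singleton_iff] at hv
                subst hv
                exact ⟨⟨hx.1, hxu⟩, hxJ⟩
            · exact disjoint_singleton_right.2 fun hv => lt_irrefl _ hv.1.2
          · filter_upwards [hdens x hx hxJ ε hε, self_mem_nhdsWithin] with u hu hxu
            refine (add_le_add le_rfl hu).trans ?_
            rw [ENNReal.ofReal_mul hε.le, ← mul_add, add_right_comm,
              ← ENNReal.ofReal_add hx.1 (sub_nonneg.2 (le_of_lt hxu)), add_sub_cancel]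
            refine mul_le_mul_right (add_le_add le_rfl (measure_mono ?_)) _
            exact inter_subset_inter_left _ (Ico_subset_Ico_right (le_of_lt hxu))
        obtain ⟨z, hz, hzs⟩ := mem_nhdsGT_iff_exists_Ioo_subset.1 hstep
        refine mem_nhdsGT_iff_exists_Ioo_subset.2 ⟨z, hz, fun w hw u hu => ?_⟩
        rcases le_or_gt u x with h | h
        · exact hxs u ⟨hu.1, h⟩
        · exact (hadd x hx u h).trans ((add_le_add (hxs x ⟨hx.1, le_rfl⟩) le_rfl).trans
            (hzs ⟨h, hu.2.trans_lt hw.2⟩))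
    refine (hsub ⟨hT, le_rfl⟩ T ⟨hT, le_rfl⟩).trans ?_
    exact mul_le_mul_right (add_le_add le_rfl (measure_mono (subset_univ _))) _
  have hC : ENNReal.ofReal T + m univ ≠ ⊤ :=
    ENNReal.add_ne_top.2 ⟨ENNReal.ofReal_ne_top, measure_ne_top _ _⟩
  have hlim : Tendsto (fun ε : ℝ => ENNReal.ofReal ε * (ENNReal.ofReal T + m univ)) (𝓝[>] 0)
      (𝓝 0) := by
    have h1 : Tendsto (fun ε : ℝ => ENNReal.ofReal ε) (𝓝[>] 0) (𝓝 0) := by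
      have h2 := (ENNReal.continuous_ofReal.tendsto 0).mono_left
        (nhdsWithin_le_nhds (s := Ioi 0))
      rwa [ENNReal.ofReal_zero] at h2
    have h3 := ENNReal.Tendsto.mul_const h1 (Or.inr hC)
    rwa [zero_mul] at h3
  exact le_antisymm (ge_of_tendsto hlim (eventually_mem_nhdsWithin.mono fun ε hε => key ε hε))
    zero_le

end Atomic

/-! ### Pure atomicity -/

section Density

variable {T : ℝ}

/-- Right averages converge at points of continuity. -/
theorem tendsto_average {g : Icc (0 : ℝ) T → ℝ} (hg : Integrable g (leb T)) {t : Icc (0 : ℝ) T}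
    (hc : ContinuousAt g t) {s : ℕ → Icc (0 : ℝ) T} (hs : Tendsto s atTop (𝓝 t))
    (hlt : ∀ k, t < s k) :
    Tendsto (fun k => (∫ τ in Ioc t (s k), g τ ∂(leb T)) / ((s k : ℝ) - t)) atTop (𝓝 (g t)) := by
  refine Metric.tendsto_nhds.2 fun ε hε => ?_
  obtain ⟨r, hr, hball⟩ := Metric.continuousAt_iff.1 hc (ε / 2) (half_pos hε)
  filter_upwards [Metric.tendsto_nhds.1 hs r hr] with k hk
  have hk0 : (0 : ℝ) < s k - t := sub_pos.2 (Subtype.coe_lt_coe.2 (hlt k))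
  have hsub : (∫ τ in Ioc t (s k), g τ ∂(leb T)) - g t * (s k - t) =
      ∫ τ in Ioc t (s k), (g τ - g t) ∂(leb T) := by
    rw [integral_sub hg.integrableOn (integrable_const _), setIntegral_const,
      leb_real_Ioc (hlt k).le, smul_eq_mul, mul_comm]
  have hle : ‖∫ τ in Ioc t (s k), (g τ - g t) ∂(leb T)‖ ≤ ε / 2 * (leb T).real (Ioc t (s k)) := by
    refine norm_setIntegral_le_of_norm_le_const (measure_lt_top _ _) fun τ hτ => ?_
    refine (hball ?_).le
    rw [Subtype.dist_eq, Real.dist_eq] at hk ⊢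
    rw [abs_of_pos hk0] at hk
    have h1 : (t : ℝ) < τ := Subtype.coe_lt_coe.2 hτ.1
    have h2 : (τ : ℝ) ≤ s k := Subtype.coe_le_coe.2 hτ.2
    rw [abs_of_pos (sub_pos.2 h1)]
    linarith
  rw [leb_real_Ioc (hlt k).le, ← hsub, Real.norm_eq_abs] at hle
  rw [Real.dist_eq, div_sub' hk0.ne', abs_div, abs_of_pos hk0, div_lt_iff₀ hk0, mul_comm _ (g t)]
  exact hle.trans_lt (mul_lt_mul_of_pos_right (half_lt_self hε) hk0)

/-- A measure on `[0, T]` is carried by its atoms if its right density vanishes off the atoms; the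
density is only tested on intervals whose right end is not an atom. -/
theorem measure_compl_atoms_eq_zero (hT : 0 < T) (μ : Measure (Icc (0 : ℝ) T)) [IsFiniteMeasure μ]
    (h : ∀ t : Icc (0 : ℝ) T, μ {t} = 0 → ∀ s : ℕ → Icc (0 : ℝ) T, Tendsto s atTop (𝓝 t) →
      (∀ k, t < s k) → (∀ k, μ {s k} = 0) → ∀ ε > 0,
      ∃ k, μ.real (Ioc t (s k)) < ε * ((s k : ℝ) - t)) :
    μ {t | 0 < μ {t}}ᶜ = 0 := by
  have hval : MeasurableEmbedding (Subtype.val : Icc (0 : ℝ) T → ℝ) :=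
    MeasurableEmbedding.subtype_coe measurableSet_Icc
  let J : Set ℝ := {x | 0 < μ.map Subtype.val {x}}
  have hmap : ∀ t : Icc (0 : ℝ) T, μ.map Subtype.val {(t : ℝ)} = μ {t} := by
    intro t
    rw [hval.map_apply, ← image_singleton, preimage_image_eq _ Subtype.val_injective]
  have hmain := measure_diff_atoms_eq_zero (μ.map Subtype.val) hT.le (J := J) (fun x hx => hx)
    (fun x hx => by
      by_contra hne
      exact hx (pos_iff_ne_zero.2 hne)) ?_
  · rw [hval.map_apply] at hmain
    refine measure_mono_null (fun t ht => ?_) hmain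
    refine ⟨t.2, fun htJ => ht ?_⟩
    have htJ' : 0 < μ.map Subtype.val {(t : ℝ)} := htJ
    rwa [hmap t] at htJ'
  · intro x hx hxJ ε hε
    set t : Icc (0 : ℝ) T := ⟨x, hx.1, hx.2.le⟩ with ht
    have ht0 : μ {t} = 0 := by
      by_contra hne
      exact hxJ (show 0 < μ.map Subtype.val {(t : ℝ)} by
        rw [hmap t]; exact pos_iff_ne_zero.2 hne)
    by_contra hcon
    have hfreq := not_eventually.1 hcon
    have hex : ∀ k : ℕ, ∃ s : Icc (0 : ℝ) T, μ {s} = 0 ∧ t < s ∧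
        (s : ℝ) - t < 1 / ((k : ℝ) + 1) ∧ ε / 2 * ((s : ℝ) - t) ≤ μ.real (Ioc t s) := by
      intro k
      have hk : x < min T (x + 1 / ((k : ℝ) + 1)) :=
        lt_min hx.2 (lt_add_of_pos_right _ (by positivity))
      -- the right end `u` may be an atom; it is moved to a nonatom `s` at the price of a factor `2`
      obtain ⟨u, hu, hxu⟩ := (hfreq.and_eventually (Ioo_mem_nhdsGT hk)).exists
      have hxu1 : x < u := hxu.1
      obtain ⟨s, hs0, hus, hsu⟩ := exists_nonatom_between μ (a := u)
        (b := min (min T (x + 1 / ((k : ℝ) + 1))) (x + 2 * (u - x)))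
        (hx.1.trans hxu1.le) (lt_min hxu.2 (by linarith))
        ((min_le_left _ _).trans (min_le_left _ _))
      have hs1 := hsu.trans_le ((min_le_left _ _).trans (min_le_right _ _))
      have hs2 := hsu.trans_le (min_le_right _ _)
      refine ⟨s, hs0, Subtype.coe_lt_coe.1 (hxu1.trans hus), ?_, ?_⟩
      · show (s : ℝ) - x < _
        linarith
      · have h1 : ENNReal.ofReal (ε * (u - x)) < μ (Ioc t s) := by
          refine (not_le.1 hu).trans_le ?_
          rw [hval.map_apply]
          refine measure_mono fun v hv => ⟨?_, ?_⟩
          · exact Subtype.coe_lt_coe.1 (show x < (v : ℝ) from hv.1)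
          · exact Subtype.coe_le_coe.1 ((show (v : ℝ) ≤ u from hv.2).trans hus.le)
        have h2 : ε * (u - x) < μ.real (Ioc t s) :=
          (ENNReal.ofReal_lt_iff_lt_toReal (mul_nonneg hε.le (sub_pos.2 hxu1).le)
            (measure_ne_top _ _)).1 h1
        refine le_trans ?_ h2.le
        show ε / 2 * ((s : ℝ) - x) ≤ _
        nlinarith
    choose s hs0 hts hsk hsε using hex
    have hst : Tendsto s atTop (𝓝 t) := tendsto_coe_add_inv fun k => by
      rw [abs_of_pos (sub_pos.2 (Subtype.coe_lt_coe.2 (hts k)))]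
      exact (hsk k).le
    obtain ⟨k, hk⟩ := h t ht0 s hst hts hs0 (ε / 2) (half_pos hε)
    exact absurd (hsε k) (not_le.2 hk)

end Density

/-! ### Identification of the power -/

section Power

variable {T : ℝ} {X : Type*} [MetricSpace X] {E : ℝ → X → ℝ} {ω : ℝ → X → X} {x₀ : X} {δ : ℕ → ℝ}
  {μbar : Measure (Icc (0 : ℝ) T)} {Ebar D : Icc (0 : ℝ) T → ℝ} {K : Set X} {B : ℝ}
  {A : Set (Icc (0 : ℝ) T)} {ξ : Icc (0 : ℝ) T → X}

theorem HasComponentLimits.tendsto_powerAlong {η : ℕ → Icc (0 : ℝ) T → X}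
    (hlim : HasComponentLimits T E η μbar Ebar K A) (hreg : EnergyRegular T E)
    (hξ : ∀ t, ∃ φ : ℕ → ℕ, StrictMono φ ∧ Tendsto (fun n => η (φ n) t) atTop (𝓝 (ξ t)))
    {t : Icc (0 : ℝ) T}
    (ht : ∀ y, JoinedIn (crit E t) (ξ t) y → timeDeriv T E t y = timeDeriv T E t (ξ t)) :
    Tendsto (fun n => powerAlong E (η n) t) atTop (𝓝 (timeDeriv T E t (ξ t))) := by
  refine tendsto_of_subseq_tendsto fun ns hns => ?_
  obtain ⟨x, -, φ, hφ, hx⟩ := hlim.compact.tendsto_subseq fun n => hlim.mem (ns n) t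
  refine ⟨φ, ?_⟩
  rw [← ht x (hlim.joinedIn_limit hξ (hns.comp hφ.tendsto_atTop) hx)]
  exact ((continuous_timeDeriv hreg).tendsto (t, x)).comp (tendsto_const_nhds.prodMk_nhds hx)

/-- If the power is almost everywhere constant on the limiting component, it is equal to the weak-*
limit of the powers. -/
theorem IsSelected.ae_power_eq (h : IsSelected T E ω x₀ δ μbar Ebar D K B A)
    (hreg : EnergyRegular T E)
    (hlim : HasComponentLimits T E (fun n => evolution T ω x₀ (δ n)) μbar Ebar K A)
    (hξ : ∀ t, ∃ φ : ℕ → ℕ, StrictMono φ ∧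
      Tendsto (fun n => evolution T ω x₀ (δ (φ n)) t) atTop (𝓝 (ξ t)))
    (hconst : ∀ᵐ t : Icc (0 : ℝ) T ∂(leb T), ∀ y, JoinedIn (crit E t) (ξ t) y →
      timeDeriv T E t y = timeDeriv T E t (ξ t)) :
    Integrable (fun t : Icc (0 : ℝ) T => timeDeriv T E t (ξ t)) (leb T) ∧
      ∀ᵐ t : Icc (0 : ℝ) T ∂(leb T), ∀ x, cls T E t x = cls T E t (ξ t) → timeDeriv T E t x = D t := by
  obtain ⟨hint, hae⟩ := h.conv.power.ae_eq_of_tendsto (fun n => measurable_powerAlong hreg _)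
    h.abs_powerAlong_le h.integrable
    (hconst.mono fun t ht => hlim.tendsto_powerAlong hreg hξ ht)
  refine ⟨hint, ?_⟩
  filter_upwards [hconst, hae] with t ht ht' x hx
  rw [← ht']
  exact ht x ((cls_eq_iff_of_mem (hlim.limit_mem_crit hξ t)).1 hx.symm)

/-- If the power is continuous on the quotient space then the limit measure has zero right density
at every `t` that is not an atom: the energy balance expresses the measure of `(t, s]` through the
work, with density `F (cls T E t (ξ t))` at `t`, and the energy difference, whose lower right
derivative is at least this density. -/
theorem IsSelected.measure_compl_atoms [LocallyCompactSpace X]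
    (h : IsSelected T E ω x₀ δ μbar Ebar D K B A) (hT : 0 < T)
    (hreg : EnergyRegular T E) (hcomp : CriticalComponents T E) (hω : AxiomDecreasing T E ω)
    (hlim : HasComponentLimits T E (fun n => evolution T ω x₀ (δ n)) μbar Ebar K A)
    (hξK : ∀ t, ξ t ∈ K) (hξ : ∀ t, ∃ φ : ℕ → ℕ, StrictMono φ ∧
      Tendsto (fun n => evolution T ω x₀ (δ (φ n)) t) atTop (𝓝 (ξ t)))
    (hslope : OneSidedSlopeIneq T E) {F : QuotSpace T E → ℝ} (hF : IsTimeDerivHat T E F)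
    (hint : Integrable (fun t => F (cls T E t (ξ t))) (leb T))
    (hae : (fun t => F (cls T E t (ξ t))) =ᵐ[leb T] D) :
    μbar {t | 0 < μbar {t}}ᶜ = 0 := by
  have := h.conv.finite
  refine measure_compl_atoms_eq_zero hT μbar fun t ht s hs hts hs0 ε hε => ?_
  by_contra! hcon
  obtain ⟨x, -, φ, hφ, hx⟩ := h.compact.tendsto_subseq fun n => hξK (s n)
  have hs' := hs.comp hφ.tendsto_atTop
  have hjoin := hlim.joinedIn_of_tendsto hreg hcomp hξ tendsto_const_nhds hs' tendsto_const_nhds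
    hx (Or.inl ht)
  have hFx : F (cls T E t (ξ t)) = timeDeriv T E t x := by
    rw [(cls_eq_iff_of_mem (hlim.limit_mem_crit hξ t)).2 hjoin, hF.factors]
  have hEx : E t x = Ebar t := by
    rw [← hlim.energy_limit hreg hξ t, hcomp.energy_eq t t.2 _ _ hjoin]
  obtain ⟨a, ha, hle⟩ := hslope.exists_le_quotient hreg hs' hx (fun k => hts (φ k))
    fun k => hlim.limit_mem_crit hξ _
  have hcont : ContinuousAt (fun τ => F (cls T E τ (ξ τ))) t :=
    hF.continuous.continuousAt.comp (hlim.continuousAt_limit hreg hcomp hξK hξ ht)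
  -- along the subsequence, the density of `μbar` is at most a difference that tends to `0`
  have havg := tendsto_average hint hcont hs' fun k => hts (φ k)
  have hdiff := havg.sub ha
  rw [hFx, sub_self] at hdiff
  refine absurd (ge_of_tendsto hdiff ?_) (not_le.2 hε)
  filter_upwards [hle] with k hk
  have hk0 : (0 : ℝ) < s (φ k) - t := sub_pos.2 (Subtype.coe_lt_coe.2 (hts (φ k)))
  have h1 := h.energy_eq hT hreg hω (hs0 (φ k))
  have h2 := h.energy_eq hT hreg hω ht
  have h3 := setIntegral_Iic_sub h.integrable (hts (φ k)).le
  have h4 : μbar.real (Iic (s (φ k))) = μbar.real (Iic t) + μbar.real (Ioc t (s (φ k))) := by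
    rw [← measureReal_union (Iic_disjoint_Ioc le_rfl) measurableSet_Ioc,
      Iic_union_Ioc_eq_Iic (hts (φ k)).le]
  have h5 : ∫ τ in Ioc t (s (φ k)), F (cls T E τ (ξ τ)) ∂(leb T) =
      ∫ τ in Ioc t (s (φ k)), D τ ∂(leb T) :=
    integral_congr_ae (ae_restrict_of_ae hae)
  have h6 : ε ≤ ((∫ τ in Ioc t (s (φ k)), F (cls T E τ (ξ τ)) ∂(leb T)) -
      (E (s (φ k)) (ξ (s (φ k))) - E t x)) / ((s (φ k) : ℝ) - t) := by
    rw [le_div_iff₀ hk0, hlim.energy_limit hreg hξ, hEx, h5]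
    have h7 := hcon (φ k)
    linarith
  rw [sub_div] at h6
  exact h6.trans (sub_le_sub_left hk _)

end Power

end Quasistatic

theorem theorem1 {X : Type*} [MetricSpace X] [LocallyCompactSpace X] (T : ℝ) (hT : 0 < T)
    (E : ℝ → X → ℝ) (hreg : EnergyRegular T E) (hpow : PowerControl T E) (hcoer : Coercive T E)
    (hcomp : CriticalComponents T E) (ω : ℝ → X → X) :
    -- a rule compatible with an action generated by curves satisfies the time-stable axiom
    (∀ (P : Type*) [MetricSpace P] (c : ℝ → X → X → ℝ), IsAction T E c → IsCompatible T E ω c →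
      IsGeneratedByCurves T E c P → AxiomTimeStable T E ω c) ∧
    -- the time-stable axiom is stronger than the axiom on limits
    (∀ c : ℝ → X → X → ℝ, AxiomTimeStable T E ω c → AxiomDecreasing T E ω ∧
      (AxiomCritical T E ω → ∀ x₀ ∈ crit E 0, AxiomLimits T E ω x₀)) ∧
    -- the limit of the discrete evolutions
    (AxiomDecreasing T E ω → AxiomCritical T E ω → ∀ x₀ ∈ crit E 0, AxiomLimits T E ω x₀ →
      ∀ δ : ℕ → ℝ, (∀ n, 0 < δ n) → Tendsto δ atTop (𝓝 0) →
      ∃ φ : ℕ → ℕ, StrictMono φ ∧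
      ∃ (μbar : Measure (Icc (0 : ℝ) T)) (D : Icc (0 : ℝ) T → ℝ)
        (η : Icc (0 : ℝ) T → QuotSpace T E),
        -- convergence of the measures and of the powers
        IsFiniteMeasure μbar ∧ MemLp D ⊤ (leb T) ∧
        WeakStarMeasure (fun n => dropMeasure T E ω x₀ (δ (φ n))) μbar ∧
        WeakStarLinfty (fun n => powerAlong E (evolution T ω x₀ (δ (φ n)))) D ∧
        -- pointwise convergence in the quotient space
        (∀ t, Tendsto (fun n => cls T E t (evolution T ω x₀ (δ (φ n)) t)) atTop (𝓝 (η t))) ∧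
        -- one-sided limits
        (∀ t : Icc (0 : ℝ) T, 0 < (t : ℝ) → Tendsto η (𝓝[<] t) (𝓝 (Function.leftLim η t))) ∧
        (∀ t : Icc (0 : ℝ) T, (t : ℝ) < T → Tendsto η (𝓝[>] t) (𝓝 (Function.rightLim η t))) ∧
        -- energy balance
        (∀ s t : Icc (0 : ℝ) T, s < t →
          energyHat hcomp (Function.rightLim η t) - energyHat hcomp (Function.leftLim η s) =
            (∫ τ in Icc s t, D τ ∂(leb T)) - μbar.real (Icc s t)) ∧
        -- critical points
        (∀ (t s : Icc (0 : ℝ) T) (x : X), cls T E s x = η t → s = t ∧ descSlope E t x = 0) ∧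
        -- continuity off the countable set of atoms
        {t | 0 < μbar {t}}.Countable ∧
        (∀ t, t ∉ {t | 0 < μbar {t}} → ContinuousAt η t) ∧
        -- identification of the power
        (TwoSidedSlopeIneq T E →
          (∀ᵐ t ∂(leb T), ∀ x, cls T E t x = η t → timeDeriv T E t x = D t) ∧
          ∀ (h_t : QuotSpace T E → Icc (0 : ℝ) T) (h_X : QuotSpace T E → X),
            (∀ p, cls T E (h_t p) (h_X p) = p) →
            ∀ s t : Icc (0 : ℝ) T, s < t →
              energyHat hcomp (Function.rightLim η t) - energyHat hcomp (Function.leftLim η s) =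
                (∫ τ in Icc s t, timeDeriv T E τ (h_X (η τ)) ∂(leb T)) - μbar.real (Icc s t)) ∧
        -- characterization of the jumps
        (∀ (c : ℝ → X → X → ℝ) (hc : AxiomTimeStable T E ω c), ∀ t ∈ {t | 0 < μbar {t}},
          energyHat hcomp (Function.leftLim η t) - energyHat hcomp (Function.rightLim η t) =
            μbar.real {t} ∧
          μbar.real {t} = actionHat hc (Function.leftLim η t) (Function.rightLim η t)) ∧
        -- energy balance on the quotient space, and pure atomicity
        (OneSidedSlopeIneq T E → PathSpaceLipschitz T E →
          ∀ F : QuotSpace T E → ℝ, IsTimeDerivHat T E F →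
          Integrable (fun τ => F (η τ)) (leb T) ∧
          (∀ s t : Icc (0 : ℝ) T, s < t →
            energyHat hcomp (Function.rightLim η t) - energyHat hcomp (Function.leftLim η s) =
              (∫ τ in Icc s t, F (η τ) ∂(leb T)) - μbar.real (Icc s t)) ∧
          μbar {t | 0 < μbar {t}}ᶜ = 0)) := by

  refine ⟨fun P _ c hact hω hgen => AxiomTimeStable.of_isGeneratedByCurves hreg hcomp hact hω hgen,
    fun c hc => ⟨hc.decreasing, fun _ x₀ _ => hc.axiomLimits hT hreg hpow hcoer x₀⟩, ?_⟩
  intro hdec hcrit x₀ hx₀ hAx δ hδ hδ0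
  obtain ⟨φ, hφ, μbar, Ebar, D, K, B, A, h⟩ :=
    exists_isSelected hT hreg hpow hcoer hdec x₀ hδ hδ0
  have hlim := h.hasComponentLimits hT hreg hcrit hx₀ hAx
  obtain ⟨ξ, hξK, hξ⟩ := hlim.exists_limit
  have hfin := h.conv.finite
  have hξc := hlim.limit_mem_crit hξ
  choose xl hxl hEl htl sl hsl hslt hslx using
    h.exists_leftLim hT hreg hcomp hdec hlim hξK hξ
  choose xr hxr hEr htr sr hsr hsrt hsrx using
    h.exists_rightLim hT hreg hcomp hdec hlim hξK hξ
  have hbal : ∀ s t : Icc (0 : ℝ) T, s ≤ t →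
      energyHat hcomp (Function.rightLim (fun s => cls T E s (ξ s)) t) -
        energyHat hcomp (Function.leftLim (fun s => cls T E s (ξ s)) s) =
          (∫ τ in Icc s t, D τ ∂(leb T)) - μbar.real (Icc s t) := by
    intro s t hst
    rw [hxl, hxr, ← setIntegral_sub_measure_Icc h.integrable hst, ← hEr, ← hEl]
    rfl
  refine ⟨φ, hφ, μbar, D, fun s => cls T E s (ξ s), hfin, h.conv.memLp, h.conv.measure,
    h.conv.power, hlim.tendsto_cls_limit hξ, ?_, ?_, fun s t hst => hbal s t hst.le, ?_,
    countable_atoms μbar, ?_, ?_, ?_, ?_⟩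
  · intro t ht
    rw [hxl]
    exact htl t ht
  · intro t ht
    rw [hxr]
    exact htr t ht
  · intro t s x hx
    obtain ⟨rfl, hx'⟩ := cls_eq_iff.1 hx
    refine ⟨rfl, ?_⟩
    rcases hx' with rfl | hx'
    · exact hξc s
    · exact hx'.source_mem
  · intro t ht
    refine hlim.continuousAt_limit hreg hcomp hξK hξ ?_
    by_contra hne
    exact ht (pos_iff_ne_zero.2 hne)
  · intro hslope
    have hconst : ∀ᵐ t : Icc (0 : ℝ) T ∂(leb T), ∀ y, JoinedIn (crit E t) (ξ t) y →
        timeDeriv T E t y = timeDeriv T E t (ξ t) := by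
      filter_upwards [(hslope.countable_timeDeriv_ne hreg hcoer hcomp ξ).ae_notMem (leb T)]
        with t ht y hy
      by_contra hne
      exact ht ⟨y, hy, hne⟩
    have hae := (h.ae_power_eq hreg hlim hξ hconst).2
    refine ⟨hae, fun h_t h_X hsec s t hst => ?_⟩
    rw [hbal s t hst.le]
    congr 1
    refine integral_congr_ae (ae_restrict_of_ae ?_)
    filter_upwards [hae] with τ hτ
    have h1 := hsec (cls T E τ (ξ τ))
    rw [(cls_eq_iff.1 h1).1] at h1
    exact (hτ _ h1).symm
  · intro c hc t _
    have h1 := hbal t t le_rfl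
    have h2 := h.action_eq hT hreg hcomp hlim hξ hc (hslt t) (hsrt t) (hsl t) (hsr t) (hslx t)
      (hsrx t)
    rw [Icc_self, setIntegral_measure_zero _ (measure_singleton t), zero_sub] at h1
    have h3 : energyHat hcomp (Function.leftLim (fun s => cls T E s (ξ s)) t) -
        energyHat hcomp (Function.rightLim (fun s => cls T E s (ξ s)) t) = μbar.real {t} := by
      linarith
    refine ⟨h3, ?_⟩
    rw [← h3, hxl, hxr]
    have h4 : actionHat hc (cls T E t (xl t)) (cls T E t (xr t)) = c t (xl t) (xr t) :=
      if_pos rfl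
    rw [h4, h2]
    rfl
  · intro hslope _ F hF
    have hconst : ∀ᵐ t : Icc (0 : ℝ) T ∂(leb T), ∀ y, JoinedIn (crit E t) (ξ t) y →
        timeDeriv T E t y = timeDeriv T E t (ξ t) := by
      refine Eventually.of_forall fun t y hy => ?_
      rw [← hF.factors, ← hF.factors, (cls_eq_iff_of_mem (hξc t)).2 hy]
    obtain ⟨hint, hae⟩ := h.ae_power_eq hreg hlim hξ hconst
    have hint' : Integrable (fun t => F (cls T E t (ξ t))) (leb T) :=
      hint.congr (Eventually.of_forall fun t => (hF.factors t (ξ t)).symm)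
    have hae' : (fun t => F (cls T E t (ξ t))) =ᵐ[leb T] D := by
      filter_upwards [hae] with t ht
      rw [hF.factors]
      exact ht _ rfl
    refine ⟨hint', fun s t hst => ?_,
      h.measure_compl_atoms hT hreg hcomp hdec hlim hξK hξ hslope hF hint' hae'⟩
    rw [hbal s t hst.le]
    congr 1
    exact integral_congr_ae (ae_restrict_of_ae hae'.symm)
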